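/- Let $\mathcal S,\mathcal X,\mathcal Y$ be finite sets (states, inputs, outputs). A stationary Markov channel is given by probability laws $P(\cdot,\cdot\mid s,x)$ on $\mathcal S\times\mathcal Y$ for $s\in\mathcal S$, $x\in\mathcal X$ (the joint law of next state and output), and an initial law $\boldsymbol\mu_1$ on $\mathcal S$. For a law $u$ on $\mathcal X$ put $Q(s_+,y\mid s,u)=\sum_x u(x)P(s_+,y\mid s,x)$ and $Q_S(s_+\mid s,u)=\sum_y Q(s_+,y\mid s,u)$. Assume that for every $f:\mathcal S\to\mathcal X$ the stochastic matrix $\big(Q_S(s_+\mid s,\delta_{f(s)})\big)_{s,s_+}$ is irreducible; then for every $\pi:\mathcal S\to\mathcal P(\mathcal X)$ the matrix $\big(Q_S(s_+\mid s,\pi(s))\big)_{s,s_+}$ has a unique invariant law $\mu_\pi$. With natural logarithms, and $0\log 0=0$, define $$c(s,u)=\sum_{x,y,v}u(x)P(v,y\mid s,x)\log\frac{P(v,y\mid s,x)}{\sum_z u(z)P(v,y\mid s,z)},\qquad C=\sup_{\pi:\mathcal S\to\mathcal P(\mathcal X)}\sum_s\mu_\pi(s)\,c(s,\pi(s)),$$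 $$d(s,u)=\sup_{u'\in\mathcal P(\mathcal X)}D_{KL}\big(Q(\cdot,\cdot\mid s,u)\,\|\,Q(\cdot,\cdot\mid s,u')\big)\in[0,\infty],\qquad D=\sup_{\pi:\mathcal S\to\mathcal P(\mathcal X)}\sum_s\mu_\pi(s)\,d(s,\pi(s))\in[0,\infty].$$ A causal feedback encoder $\Phi$ is a finite message set $\mathcal W$ with maps $\phi_t:\mathcal W\times\mathcal Y^{t-1}\times\mathcal S^t\to\mathcal X$, $t\ge1$. It is run on a probability space with a message $W$, inputs $X_t$, outputs $Y_t$ and states $S_t$ such that $W$ is uniform on $\mathcal W$; $S_1$ has law $\boldsymbol\mu_1$ given $W$; almost surely $X_t=\phi_t(W,Y_1^{t-1},S_1^t)$; and, given $W,S_1^t,X_1^t,Y_1^{t-1}$, the pair $(S_{t+1},Y_t)$ has law $P(\cdot,\cdot\mid S_t,X_t)$. A variable-length block-coding scheme $(\Phi,T,\Psi)$ consists of an encoder $\Phi$, a stopping time $T$ (with values in $\{0,1,2,\dots\}\cup\{\infty\}$) of the filtration $\mathcal F_t=\sigma(S_1^t,Y_1^t)$, $t\ge0$ (trivial for $t=0$),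 and an $\mathcal F_T$-measurable $\mathcal W$-valued decoder $\Psi$. Its error probability is $p_e=\mathbb P(\Psi\ne W)$, its rate is $\log|\mathcal W|/\mathbb E[T]$, and its error exponent is $-\log p_e/\mathbb E[T]$, where $-\log 0=\infty$. Let $0<R<C$ and $E_B(R)=D\,(1-R/C)\in[0,\infty]$ (so $E_B(R)=\infty$ if $D=\infty$). 1. Every sequence of schemes $(\Phi^n,T_n,\Psi^n)_{n\in\mathbb N}$ with $$\lim_n p_e(\Phi^n,T_n,\Psi^n)=0\quad\text{and}\quad\liminf_n\frac{\log|\mathcal W_n|}{\mathbb E[T_n]}\ge R\qquad(*)$$ satisfies $\displaystyle\limsup_n\frac{-\log p_e(\Phi^n,T_n,\Psi^n)}{\mathbb E[T_n]}\le E_B(R)$. 2. There is a sequence of schemes satisfying $(*)$ such that, if $D<\infty$, then $\displaystyle\lim_n\frac{-\log p_e(\Phi^n,T_n,\Psi^n)}{\mathbb E[T_n]}=E_B(R)$, and, if $D=\infty$, then $p_e(\Phi^n,T_n,\Psi^n)=0$ for all $n$. -/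

import Mathlib

open MeasureTheory Filter Topology
open scoped ENNReal

universe u v w

/-- Kullback-Leibler divergence (natural logarithm) between two laws on a discrete set. -/
noncomputable def klPMF {α : Type*} (p q : PMF α) : ℝ≥0∞ :=
  letI : MeasurableSpace α := ⊤
  InformationTheory.klDiv p.toMeasure q.toMeasure

/-- A stationary Markov channel with state set `S`, input set `X`, output set `Y`:
`P s x` is the joint law of (next state, output) given current state `s` and input `x`;
`init` is the law of the initial state. -/
structure MarkovChannel (S X Y : Type*) where
  P : S → X → PMF (S × Y)
  init : PMF S

namespace MarkovChannel

variable {S : Type*} {X : Type*} {Y : Type*}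

/-- `Q(s₊, y | s, u) = ∑ x, P(s₊, y | s, x) u(x)`. -/
noncomputable def Q (K : MarkovChannel S X Y) (s : S) (u : PMF X) : PMF (S × Y) :=
  u.bind (K.P s)

/-- `Q_S(s₊ | s, u)`, the state marginal of `Q(· | s, u)`. -/
noncomputable def QS (K : MarkovChannel S X Y) (s : S) (u : PMF X) : PMF S :=
  (K.Q s u).map Prod.fst

/-- State transition matrix induced by a deterministic stationary policy `π : S → 𝒫(X)`. -/
noncomputable def transitionMatrix (K : MarkovChannel S X Y) (π : S → PMF X) : Matrix S S ℝ :=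
  Matrix.of fun s s' => (K.QS s (π s) s').toReal

/-- For every `f : S → X` the state transition matrix induced by always using the input `f s`
in the state `s` is irreducible. -/
def Ergodic (K : MarkovChannel S X Y) : Prop :=
  ∀ f : S → X, (K.transitionMatrix fun s => PMF.pure (f s)).IsIrreducible

/-- `μ` is an invariant law of the state chain induced by `π`. For an ergodic channel with finite
state set there is exactly one such `μ` for each `π`. -/
def IsInvariant (K : MarkovChannel S X Y) (π : S → PMF X) (μ : PMF S) : Prop :=
  μ.bind (fun s => K.QS s (π s)) = μ

/-- Mutual information cost `c(s, u)`; the conventions of `Real.log` and of division make the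
terms with `u(x) P(v, y | s, x) = 0` vanish. -/
noncomputable def infoCost [Fintype S] [Fintype X] [Fintype Y]
    (K : MarkovChannel S X Y) (s : S) (u : PMF X) : ℝ :=
  ∑ x, ∑ y, ∑ v, (u x).toReal * (K.P s x (v, y)).toReal *
    Real.log ((K.P s x (v, y)).toReal / ∑ z, (u z).toReal * (K.P s z (v, y)).toReal)

/-- Capacity: the supremum over stationary policies `π` of `∑ s, μ_π(s) c(s, π(s))`, where `μ_π` is
the invariant law induced by `π`. -/
noncomputable def capacity [Fintype S] [Fintype X] [Fintype Y] (K : MarkovChannel S X Y) : ℝ :=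
  sSup {r : ℝ | ∃ (π : S → PMF X) (μ : PMF S), K.IsInvariant π μ ∧
    r = ∑ s, (μ s).toReal * K.infoCost s (π s)}

/-- Divergence cost `d(s, u) = sup_{u'} D(Q(· | s, u) ‖ Q(· | s, u'))`, possibly infinite. -/
noncomputable def divCost (K : MarkovChannel S X Y) (s : S) (u : PMF X) : ℝ≥0∞ :=
  ⨆ u' : PMF X, klPMF (K.Q s u) (K.Q s u')

/-- Burnashev coefficient: the supremum over stationary policies `π` of
`∑ s, μ_π(s) d(s, π(s))`, possibly infinite. -/
noncomputable def burnashevCoeff [Fintype S] (K : MarkovChannel S X Y) : ℝ≥0∞ :=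
  sSup {r : ℝ≥0∞ | ∃ (π : S → PMF X) (μ : PMF S), K.IsInvariant π μ ∧
    r = ∑ s, μ s * K.divCost s (π s)}

/-- `E_B(R) = D (1 - R / C)`, for rates `0 < R < C`. -/
noncomputable def burnashevExponent [Fintype S] [Fintype X] [Fintype Y]
    (K : MarkovChannel S X Y) (R : ℝ) : ℝ≥0∞ :=
  K.burnashevCoeff * ENNReal.ofReal (1 - R / K.capacity)

end MarkovChannel

/-- A causal feedback encoder: a finite message set and maps from the message, the past outputs and
the present and past states to the channel input. Times are numbered from `0` here, so `φ t` sees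
`t` outputs and `t + 1` states. -/
structure CausalEncoder (S X Y : Type*) where
  Msg : Type
  [fintypeMsg : Fintype Msg]
  φ : (t : ℕ) → Msg → (Fin t → Y) → (Fin (t + 1) → S) → X

attribute [instance] CausalEncoder.fintypeMsg

/-- A probability space with a message `W`, inputs `X_t`, outputs `Y_t` and states `S_t` produced by
using the encoder `Φ` on the channel `K`. The conditional laws are given on the (countably many)
elementary events of the past, in product form. -/
structure Transmission {S : Type*} {X : Type*} {Y : Type*}
    (K : MarkovChannel S X Y) (Φ : CausalEncoder S X Y)
    {Ω : Type*} [MeasurableSpace Ω] (Pr : Measure Ω) where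
  isProb : IsProbabilityMeasure Pr
  msg : Ω → Φ.Msg
  input : ℕ → Ω → X
  output : ℕ → Ω → Y
  state : ℕ → Ω → S
  measurable_msg : Measurable[_, ⊤] msg
  measurable_input : ∀ t, Measurable[_, ⊤] (input t)
  measurable_output : ∀ t, Measurable[_, ⊤] (output t)
  measurable_state : ∀ t, Measurable[_, ⊤] (state t)
  /-- The message is uniformly distributed. -/
  law_msg : ∀ w, Pr {ω | msg ω = w} = (Fintype.card Φ.Msg : ℝ≥0∞)⁻¹
  /-- The first state has law `K.init` given the message. -/
  law_state_zero : ∀ w s, Pr {ω | msg ω = w ∧ state 0 ω = s} = Pr {ω | msg ω = w} * K.init s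
  /-- Given the message and the past, the input is almost surely the one chosen by the encoder. -/
  law_input : ∀ t, ∀ᵐ ω ∂Pr,
    input t ω = Φ.φ t (msg ω) (fun i => output i ω) (fun i => state i ω)
  /-- Given the message, the states and inputs up to time `t` and the outputs before time `t`, the
  pair (next state, output) has law `P(·, · | S_t, X_t)`. -/
  law_step : ∀ (t : ℕ) (w : Φ.Msg) (s : Fin (t + 1) → S) (x : Fin (t + 1) → X) (y : Fin t → Y)
    (s' : S) (y' : Y),
    Pr {ω | (msg ω = w ∧ (∀ i : Fin (t + 1), state i ω = s i) ∧ (∀ i : Fin (t + 1), input i ω = x i) ∧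
        (∀ i : Fin t, output i ω = y i)) ∧ state (t + 1) ω = s' ∧ output t ω = y'} =
      Pr {ω | msg ω = w ∧ (∀ i : Fin (t + 1), state i ω = s i) ∧ (∀ i : Fin (t + 1), input i ω = x i) ∧
        (∀ i : Fin t, output i ω = y i)} * K.P (s (Fin.last t)) (x (Fin.last t)) (s', y')

/-- The receiver's filtration: after `t` channel uses it is generated by the first `t` states and
the first `t` outputs; it is trivial for `t = 0`. -/
def Transmission.receiverFiltration {S : Type*} {X : Type*} {Y : Type*}
    {K : MarkovChannel S X Y} {Φ : CausalEncoder S X Y}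
    {Ω : Type*} [m : MeasurableSpace Ω] {Pr : Measure Ω} (τ : Transmission K Φ Pr) :
    Filtration ℕ m where
  seq t := ⨆ (i : ℕ) (_ : i < t),
    MeasurableSpace.comap (τ.state i) ⊤ ⊔ MeasurableSpace.comap (τ.output i) ⊤
  mono' := fun _ _ hab => iSup_mono fun _ => iSup_mono' fun hi => ⟨hi.trans_le hab, le_rfl⟩
  le' := fun _ => iSup_le fun i => iSup_le fun _ =>
    sup_le (τ.measurable_state i).comap_le (τ.measurable_output i).comap_le

/-- A variable-length block-coding scheme `(Φ, T, Ψ)` on the channel `K`, with the probability space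
on which it runs: `T` is a stopping time of the receiver's filtration `ℱ` and the decoder `Ψ` is an
`ℱ_T`-measurable message. -/
structure CodingScheme {S : Type u} {X : Type v} {Y : Type w} (K : MarkovChannel S X Y) where
  encoder : CausalEncoder S X Y
  Ω : Type (max u v w)
  [measurableSpace : MeasurableSpace Ω]
  Pr : Measure Ω
  transmission : Transmission K encoder Pr
  T : Ω → ℕ∞
  isStoppingTime : IsStoppingTime transmission.receiverFiltration T
  Ψ : Ω → encoder.Msg
  measurable_Ψ : Measurable[isStoppingTime.measurableSpace, ⊤] Ψ

attribute [instance] CodingScheme.measurableSpace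

namespace CodingScheme

variable {S : Type*} {X : Type*} {Y : Type*} {K : MarkovChannel S X Y}

/-- Error probability `p_e`: the probability that `Ψ ≠ W`. -/
noncomputable def errorProb (𝒮 : CodingScheme K) : ℝ≥0∞ :=
  𝒮.Pr {ω | 𝒮.Ψ ω ≠ 𝒮.transmission.msg ω}

/-- Expected transmission time `𝔼[T]`, possibly infinite. -/
noncomputable def expectedTime (𝒮 : CodingScheme K) : ℝ≥0∞ :=
  ∫⁻ ω, (𝒮.T ω : ℝ≥0∞) ∂𝒮.Pr

/-- Rate `log |𝒲| / 𝔼[T]`. -/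
noncomputable def rate (𝒮 : CodingScheme K) : ℝ≥0∞ :=
  ENNReal.ofReal (Real.log (Fintype.card 𝒮.encoder.Msg)) / 𝒮.expectedTime

/-- `- log p_e / 𝔼[T]`, where `- log 0 = ∞`. -/
noncomputable def errorExponent (𝒮 : CodingScheme K) : ℝ≥0∞ :=
  (-ENNReal.log 𝒮.errorProb).toENNReal / 𝒮.expectedTime

end CodingScheme

/-! Two quantities attached to the receiver's posterior carry the proof. In one channel use its
entropy drops, on average, by the mutual information of the input law that the posterior induces,
and the averaged log-odds of the true message grow by at most the largest divergence available to
the inputs. Both rates depend on the state. The relative value functions of two average-reward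
control problems absorb this dependence and leave the constants C and D
(`Ergodic.exists_optimal_policy`, `Ergodic.burnashevCoeff_eq`).

Converse. If in some state two inputs have outcome laws with different supports, then D is infinite
and, since R < C, so is the claimed bound. Otherwise D is finite, and a transmission is split at the
first time when some message has posterior probability above 1 - δ. Until then the entropy has to
fall from log M to almost nothing, which takes about (log M)/C channel uses. At that moment the
log-odds are still bounded, because positive transition probabilities are bounded below; they then
have to grow to log(1/p), which takes about log(1/p)/D further uses. Hence log(1/p) + (D/C) log M ≤
D E[T] up to lower order terms (`Ergodic.converse_bound`), and division by E[T] gives the exponent.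
The argument is an induction over the decision tree of the scheme cut at a finite horizon
(`DecisionTree.le_time_of_unconcentrated`). Posteriors stay unnormalized, so that neither
conditional expectations nor martingales are needed.

Achievability. A block consists of n₁ uses for communication at a rate just below C and n₂ uses for
confirmation. The first phase is Feinstein's greedy code among random sequences of maps from states
to inputs, with a Chernoff bound for the information density (`Ergodic.exists_block_code`). In the
second phase the encoder, who knows the tentative decision through feedback, follows one policy if
it is right and another one if it is wrong, and the receiver tests between the two. A likelihood
ratio test accepts a wrong decision with probability at most exp(-a n₂) for any a < D; if supports
differ, waiting for an outcome that the second policy cannot produce never accepts a wrong decision.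
Rejected blocks are repeated. Rejection is rare, so E[T] is close to n₁ + n₂
(`BlockCode.IsReliable.exists_codingScheme`), and the proportion n₁ : n₂ = R/C : (1 - R/C) yields
rate R and exponent D (1 - R/C) in the limit. -/

set_option linter.unusedSectionVars false

/-! ### Finite Markov chains: invariant laws, Poisson equation, policy improvement. -/

section FiniteChain

variable {S : Type*} [Fintype S]

/-- A nonempty set of states that is closed under the transitions of `P` is everything. -/
def ChainIrreducible {S : Type*} (P : S → S → ℝ) : Prop :=
  ∀ Z : Set S, Z.Nonempty → (∀ s ∈ Z, ∀ t, 0 < P s t → t ∈ Z) → ∀ s, s ∈ Z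

lemma Matrix.IsIrreducible.chainIrreducible {S : Type*} {A : Matrix S S ℝ}
    (hA : A.IsIrreducible) : ChainIrreducible (fun s t => A s t) := by
  intro Z ⟨z, hz⟩ hcl s
  let := A.toQuiver
  obtain ⟨p, -⟩ := hA.connected z s
  induction p with
  | nil => exact hz
  | cons p e ih => exact hcl _ ih _ e.down

lemma ChainIrreducible.mono {S : Type*} {P P' : S → S → ℝ} (hP : ChainIrreducible P)
    (h : ∀ s t, 0 < P s t → 0 < P' s t) : ChainIrreducible P' :=
  fun Z hZ hcl => hP Z hZ fun s hs t hst => hcl s hs t (h s t hst)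

variable {P : S → S → ℝ}

/-- Maximum principle: where `h` attains its maximum, the average over the successors can only equal
it if all successors attain it too. The set of maximizers is therefore closed under transitions. -/
lemma ChainIrreducible.eq_of_harmonic [Nonempty S] (hirr : ChainIrreducible P)
    (hP0 : ∀ s t, 0 ≤ P s t) (hP1 : ∀ s, ∑ t, P s t = 1)
    {h : S → ℝ} (hh : ∀ s, ∑ t, P s t * h t = h s) : ∃ c, ∀ s, h s = c := by
  obtain ⟨z, hz⟩ := Finite.exists_max h
  refine ⟨h z, hirr {s | h s = h z} ⟨z, rfl⟩ ?_⟩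
  intro s hs t hst
  have hs : h s = h z := hs
  have h1 : ∑ t, P s t * (h z - h t) = 0 := by
    simp only [mul_sub, Finset.sum_sub_distrib, hh, ← Finset.sum_mul, hP1]
    rw [hs]; ring
  have h2 := (Finset.sum_eq_zero_iff_of_nonneg
    (fun t _ => mul_nonneg (hP0 s t) (sub_nonneg.2 (hz t)))).1 h1 t (Finset.mem_univ _)
  have h3 : h z - h t = 0 := (mul_eq_zero.1 h2).resolve_left hst.ne'
  show h t = h z
  linarith

/-- Constants lie in the right kernel of 1 - P, so there is a left null vector `v`. Then |v| ≤ |v| P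
entrywise while both sides have the same total mass; hence equality holds, and |v| only needs
normalizing. -/
lemma exists_invariant_law [Nonempty S] (hP0 : ∀ s t, 0 ≤ P s t) (hP1 : ∀ s, ∑ t, P s t = 1) :
    ∃ m : S → ℝ, (∀ s, 0 ≤ m s) ∧ ∑ s, m s = 1 ∧ ∀ t, ∑ s, m s * P s t = m t := by
  classical
  have hdet : (1 - Matrix.of P).det = 0 := by
    rw [← Matrix.exists_mulVec_eq_zero_iff]
    refine ⟨fun _ => 1, fun h => one_ne_zero (congrFun h (Classical.arbitrary S)), ?_⟩
    rw [Matrix.sub_mulVec, Matrix.one_mulVec]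
    ext s
    simp [Matrix.mulVec, dotProduct, hP1]
  obtain ⟨v, hv0, hv⟩ := Matrix.exists_vecMul_eq_zero_iff.2 hdet
  have hv' : ∀ t, ∑ s, v s * P s t = v t := by
    intro t
    have := congrFun hv t
    rw [Matrix.vecMul_sub, Matrix.vecMul_one] at this
    simp only [Matrix.vecMul, dotProduct, Pi.sub_apply, Matrix.of_apply, Pi.zero_apply] at this
    linarith
  have hle : ∀ t, |v t| ≤ ∑ s, |v s| * P s t := by
    intro t
    rw [← hv' t]
    refine (Finset.abs_sum_le_sum_abs _ _).trans (Finset.sum_le_sum fun s _ => ?_)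
    rw [abs_mul, abs_of_nonneg (hP0 s t)]
  have hsum : ∑ t, (∑ s, |v s| * P s t - |v t|) = 0 := by
    rw [Finset.sum_sub_distrib, Finset.sum_comm]
    simp [← Finset.mul_sum, hP1]
  have heq := (Finset.sum_eq_zero_iff_of_nonneg (fun t _ => sub_nonneg.2 (hle t))).1 hsum
  have hpos : 0 < ∑ s, |v s| := by
    obtain ⟨s, hs⟩ := Function.ne_iff.1 hv0
    exact Finset.sum_pos' (fun _ _ => abs_nonneg _) ⟨s, Finset.mem_univ _, abs_pos.2 hs⟩
  refine ⟨fun s => |v s| / ∑ s, |v s|, fun s => by positivity, ?_, fun t => ?_⟩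
  · rw [← Finset.sum_div, div_self hpos.ne']
  · have := heq t (Finset.mem_univ _)
    simp only [div_mul_eq_mul_div, ← Finset.sum_div]
    rw [sub_eq_zero.1 this]

lemma ChainIrreducible.invariant_pos (hirr : ChainIrreducible P)
    (hP0 : ∀ s t, 0 ≤ P s t) {m : S → ℝ} (hm0 : ∀ s, 0 ≤ m s) (hm1 : ∑ s, m s = 1)
    (hm : ∀ t, ∑ s, m s * P s t = m t) (s : S) : 0 < m s := by
  refine hirr {s | 0 < m s} ?_ ?_ s
  · by_contra hne
    rw [Set.not_nonempty_iff_eq_empty, Set.eq_empty_iff_forall_notMem] at hne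
    have : ∑ s, m s = 0 := Finset.sum_eq_zero fun s _ => le_antisymm (not_lt.1 (hne s)) (hm0 s)
    linarith
  · intro s hs t hst
    show 0 < m t
    rw [← hm t]
    exact Finset.sum_pos' (fun i _ => mul_nonneg (hm0 i) (hP0 i t))
      ⟨s, Finset.mem_univ _, mul_pos hs hst⟩

/-- Fredholm alternative by counting dimensions. Harmonic functions are constant, so the range of 1
- P has codimension at most one; it is contained in the hyperplane of functions with mean zero under
`m` and so equals it. The centred reward lies in that hyperplane. -/
lemma ChainIrreducible.exists_poisson [Nonempty S] (hirr : ChainIrreducible P)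
    (hP0 : ∀ s t, 0 ≤ P s t) (hP1 : ∀ s, ∑ t, P s t = 1) {m : S → ℝ} (hm1 : ∑ s, m s = 1)
    (hm : ∀ t, ∑ s, m s * P s t = m t) (r : S → ℝ) :
    ∃ h : S → ℝ, ∀ s, r s + ∑ t, P s t * h t = ∑ s, m s * r s + h s := by
  classical
  let A : (S → ℝ) →ₗ[ℝ] (S → ℝ) := Matrix.mulVecLin (1 - Matrix.of P)
  have hA : ∀ h s, A h s = h s - ∑ t, P s t * h t := by
    intro h s
    simp only [A, Matrix.mulVecLin_apply, Matrix.sub_mulVec, Matrix.one_mulVec]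
    simp [Matrix.mulVec, dotProduct]
  let φ : (S → ℝ) →ₗ[ℝ] ℝ := ∑ s, m s • LinearMap.proj s
  have hφ : ∀ r, φ r = ∑ s, m s * r s := by intro r; simp [φ]
  have hker : LinearMap.ker A ≤ Submodule.span ℝ {fun _ => (1 : ℝ)} := by
    intro h hh
    obtain ⟨c, hc⟩ := hirr.eq_of_harmonic hP0 hP1 (h := h) fun s => by
      have := congrFun (LinearMap.mem_ker.1 hh) s
      rw [hA] at this
      simp only [Pi.zero_apply] at this
      linarith
    rw [Submodule.mem_span_singleton]
    exact ⟨c, by ext s; simp [hc]⟩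
  have hker1 : Module.finrank ℝ (LinearMap.ker A) ≤ 1 :=
    (Submodule.finrank_mono hker).trans (finrank_span_singleton (one_ne_zero (α := S → ℝ))).le
  have hle : LinearMap.range A ≤ LinearMap.ker φ := by
    rintro _ ⟨h, rfl⟩
    rw [LinearMap.mem_ker, hφ]
    simp only [hA, mul_sub, Finset.sum_sub_distrib, Finset.mul_sum]
    rw [Finset.sum_comm]
    simp only [← mul_assoc, ← Finset.sum_mul, hm, sub_self]
  have hφr : 1 ≤ Module.finrank ℝ (LinearMap.range φ) := by
    have : LinearMap.range φ = ⊤ := by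
      rw [LinearMap.range_eq_top]
      intro c
      exact ⟨fun _ => c, by rw [hφ, ← Finset.sum_mul, hm1, one_mul]⟩
    rw [this]; simp
  have e1 := A.finrank_range_add_finrank_ker
  have e2 := φ.finrank_range_add_finrank_ker
  have heq : LinearMap.range A = LinearMap.ker φ :=
    Submodule.eq_of_le_of_finrank_le hle (by omega)
  have : (fun s => r s - ∑ s, m s * r s) ∈ LinearMap.ker φ := by
    rw [LinearMap.mem_ker, hφ]
    simp only [mul_sub, Finset.sum_sub_distrib, ← Finset.sum_mul, hm1, one_mul, sub_self]
  rw [← heq] at this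
  obtain ⟨h, hh⟩ := this
  refine ⟨h, fun s => ?_⟩
  have := congrFun hh s
  rw [hA] at this
  linarith

/-- If replacing the transition law and the reward of one state does not increase the average
reward, then the new row satisfies the average-reward optimality inequality. -/
lemma optimality_of_row_update [DecidableEq S] {r h : S → ℝ} {g : ℝ}
    (hpoi : ∀ s, r s + ∑ t, P s t * h t = g + h s) {s : S} {r' : ℝ} {P' : S → ℝ}
    {m : S → ℝ} (hm1 : ∑ s, m s = 1) (hms : 0 < m s)
    (hm : ∀ t, ∑ i, m i * Function.update P s P' i t = m t)
    (hle : ∑ i, m i * Function.update r s r' i ≤ g) :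
    r' + ∑ t, P' t * h t ≤ g + h s := by
  have key : ∑ i, m i * (Function.update r s r' i + ∑ t, Function.update P s P' i t * h t - h i)
      = ∑ i, m i * Function.update r s r' i := by
    simp only [mul_sub, mul_add, Finset.sum_sub_distrib, Finset.sum_add_distrib, Finset.mul_sum]
    rw [Finset.sum_comm (s := Finset.univ) (t := Finset.univ)
      (f := fun i t => m i * (Function.update P s P' i t * h t))]
    simp only [← mul_assoc, ← Finset.sum_mul, hm]
    ring
  rw [← key] at hle
  -- Away from `s` the Poisson equation of the old policy makes the bracket equal to `g`, so the
  -- whole change of the average reward comes from the row `s`.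
  have hval : ∀ i, m i * (Function.update r s r' i + ∑ t, Function.update P s P' i t * h t - h i)
      = m i * g + (if i = s then m s * (r' + ∑ t, P' t * h t - h s - g) else 0) := by
    intro i
    by_cases his : i = s
    · subst his; simp; ring
    · simp only [Function.update_of_ne his, if_neg his]
      have := hpoi i
      rw [show r i + ∑ t, P i t * h t - h i = g by linarith]; ring
  simp only [hval, Finset.sum_add_distrib, ← Finset.sum_mul, hm1, Finset.sum_ite_eq',
    Finset.mem_univ, if_true] at hle
  have : m s * (r' + ∑ t, P' t * h t - h s - g) ≤ 0 := by linarith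
  have := nonpos_of_mul_nonpos_right this hms
  linarith

end FiniteChain

/-! ### The channel in real numbers, and optimal deterministic policies. -/

lemma PMF.sum_toReal {α : Type*} [Fintype α] (p : PMF α) : ∑ a, (p a).toReal = 1 := by
  rw [← ENNReal.toReal_sum fun a _ => p.apply_ne_top a, ← tsum_fintype (L := .unconditional α),
    p.tsum_coe, ENNReal.toReal_one]

lemma PMF.exists_toReal_eq {α : Type*} [Fintype α] {u : α → ℝ} (h0 : ∀ a, 0 ≤ u a)
    (h1 : ∑ a, u a = 1) : ∃ p : PMF α, ∀ a, (p a).toReal = u a := by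
  refine ⟨PMF.ofFintype (fun a => ENNReal.ofReal (u a)) ?_, fun a => ?_⟩
  · rw [← ENNReal.ofReal_sum_of_nonneg fun a _ => h0 a, h1, ENNReal.ofReal_one]
  · rw [PMF.ofFintype_apply, ENNReal.toReal_ofReal (h0 a)]

namespace MarkovChannel

variable {S X Y : Type*}

/-- The real-valued transition probabilities `P(o | s, x)`. -/
noncomputable def p (K : MarkovChannel S X Y) (s : S) (x : X) (o : S × Y) : ℝ := (K.P s x o).toReal

lemma p_nonneg (K : MarkovChannel S X Y) (s : S) (x : X) (o : S × Y) : 0 ≤ K.p s x o :=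
  ENNReal.toReal_nonneg

variable [Fintype S] [Fintype Y]

lemma sum_p (K : MarkovChannel S X Y) (s : S) (x : X) : ∑ o, K.p s x o = 1 := (K.P s x).sum_toReal

lemma p_le_one (K : MarkovChannel S X Y) (s : S) (x : X) (o : S × Y) : K.p s x o ≤ 1 :=
  K.sum_p s x ▸ Finset.single_le_sum (fun o _ => K.p_nonneg s x o) (Finset.mem_univ o)

/-- The real-valued transition probabilities of the state for a fixed input. -/
noncomputable def tr (K : MarkovChannel S X Y) (s : S) (x : X) (t : S) : ℝ := ∑ y, K.p s x (t, y)

lemma tr_nonneg (K : MarkovChannel S X Y) (s : S) (x : X) (t : S) : 0 ≤ K.tr s x t :=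
  Finset.sum_nonneg fun _ _ => K.p_nonneg _ _ _

lemma sum_tr_mul (K : MarkovChannel S X Y) (s : S) (x : X) (h : S → ℝ) :
    ∑ t, K.tr s x t * h t = ∑ o, K.p s x o * h o.1 := by
  simp only [tr, Finset.sum_mul, Fintype.sum_prod_type]

lemma sum_tr (K : MarkovChannel S X Y) (s : S) (x : X) : ∑ t, K.tr s x t = 1 := by
  simpa [K.sum_p] using K.sum_tr_mul s x fun _ => 1

variable [Fintype X]

lemma Q_toReal (K : MarkovChannel S X Y) (s : S) (u : PMF X) (o : S × Y) :
    (K.Q s u o).toReal = ∑ x, (u x).toReal * K.p s x o := by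
  rw [Q, PMF.bind_apply, tsum_fintype, ENNReal.toReal_sum]
  · simp [p, ENNReal.toReal_mul]
  · exact fun x _ => ENNReal.mul_ne_top (u.apply_ne_top _) ((K.P s x).apply_ne_top _)

lemma QS_toReal (K : MarkovChannel S X Y) (s : S) (u : PMF X) (t : S) :
    (K.QS s u t).toReal = ∑ x, (u x).toReal * K.tr s x t := by
  classical
  have : K.QS s u t = ∑ y, K.Q s u (t, y) := by
    rw [QS, PMF.map_apply, tsum_fintype, Fintype.sum_prod_type_right]
    exact Finset.sum_congr rfl fun y _ => by simp
  rw [this, ENNReal.toReal_sum fun y _ => (K.Q s u).apply_ne_top _]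
  simp only [Q_toReal, tr, Finset.mul_sum]
  exact Finset.sum_comm

/-- The transition matrix of the state under a randomized stationary policy. -/
noncomputable def trans (K : MarkovChannel S X Y) (π : S → X → ℝ) (s t : S) : ℝ :=
  ∑ x, π s x * K.tr s x t

lemma isInvariant_iff (K : MarkovChannel S X Y) (π : S → PMF X) (μ : PMF S) :
    K.IsInvariant π μ ↔ ∀ t, ∑ s, (μ s).toReal * K.trans (fun s x => (π s x).toReal) s t
      = (μ t).toReal := by
  rw [IsInvariant, PMF.ext_iff]
  refine forall_congr' fun t => ?_
  rw [PMF.bind_apply, tsum_fintype,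
    ← ENNReal.toReal_eq_toReal_iff' _ (μ.apply_ne_top t), ENNReal.toReal_sum]
  · simp only [ENNReal.toReal_mul, QS_toReal, trans]
  · exact fun s _ => ENNReal.mul_ne_top (μ.apply_ne_top _) (PMF.apply_ne_top _ _)
  · exact ENNReal.sum_ne_top.2 fun s _ =>
      ENNReal.mul_ne_top (μ.apply_ne_top _) (PMF.apply_ne_top _ _)

variable {K : MarkovChannel S X Y}

lemma trans_nonneg {π : S → X → ℝ} (hπ : ∀ s x, 0 ≤ π s x) (s t : S) : 0 ≤ K.trans π s t :=
  Finset.sum_nonneg fun _ _ => mul_nonneg (hπ _ _) (K.tr_nonneg _ _ _)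

lemma sum_trans_mul (π : S → X → ℝ) (s : S) (h : S → ℝ) :
    ∑ t, K.trans π s t * h t = ∑ x, π s x * ∑ o, K.p s x o * h o.1 := by
  simp only [trans, Finset.sum_mul, ← K.sum_tr_mul, Finset.mul_sum, mul_assoc]
  exact Finset.sum_comm

lemma sum_trans {π : S → X → ℝ} (hπ : ∀ s, ∑ x, π s x = 1) (s : S) :
    ∑ t, K.trans π s t = 1 := by
  simpa [K.sum_p, hπ] using K.sum_trans_mul π s fun _ => 1

lemma Ergodic.irreducible_tr (hK : K.Ergodic) (f : S → X) :
    ChainIrreducible fun s t => K.tr s (f s) t := by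
  classical
  refine (hK f).chainIrreducible.mono fun s t h => ?_
  have h : 0 < (K.QS s (PMF.pure (f s)) t).toReal := h
  rw [QS_toReal] at h
  simpa [PMF.pure_apply, apply_ite ENNReal.toReal, Finset.sum_ite_eq'] using h

/-- Choose in each state an input of positive probability: every transition of this deterministic
policy is also possible under the randomized one. -/
lemma Ergodic.irreducible (hK : K.Ergodic) {π : S → X → ℝ} (hπ0 : ∀ s x, 0 ≤ π s x)
    (hπ : ∀ s, ∑ x, π s x = 1) : ChainIrreducible (K.trans π) := by
  have : ∀ s, ∃ x, 0 < π s x := by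
    intro s
    by_contra! h
    have : ∑ x, π s x = 0 := Finset.sum_eq_zero fun x _ => le_antisymm (h x) (hπ0 s x)
    linarith [hπ s]
  choose f hf using this
  refine (hK.irreducible_tr f).mono fun s t h => ?_
  exact Finset.sum_pos' (fun x _ => mul_nonneg (hπ0 _ _) (K.tr_nonneg _ _ _))
    ⟨f s, Finset.mem_univ _, mul_pos (hf s) h⟩

lemma nonempty_state (K : MarkovChannel S X Y) : Nonempty S := K.init.support_nonempty.to_type

/-- A deterministic policy of maximal average reward, together with the relative value function:
the average-reward optimality equation. -/
lemma Ergodic.exists_optimal_deterministic [Nonempty X] (hK : K.Ergodic) (r : S → X → ℝ) :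
    ∃ (f : S → X) (m h : S → ℝ) (g : ℝ), (∀ s, 0 < m s) ∧ ∑ s, m s = 1 ∧
      (∀ t, ∑ s, m s * K.tr s (f s) t = m t) ∧ g = ∑ s, m s * r s (f s) ∧
      (∀ s, r s (f s) + ∑ o, K.p s (f s) o * h o.1 = g + h s) ∧
      ∀ s x, r s x + ∑ o, K.p s x o * h o.1 ≤ g + h s := by
  classical
  have := K.nonempty_state
  have hex : ∀ f : S → X, ∃ m : S → ℝ, (∀ s, 0 < m s) ∧ ∑ s, m s = 1 ∧
      ∀ t, ∑ s, m s * K.tr s (f s) t = m t := by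
    intro f
    obtain ⟨m, hm0, hm1, hm⟩ := exists_invariant_law (P := fun s t => K.tr s (f s) t)
      (fun s t => K.tr_nonneg _ _ _) (fun s => K.sum_tr _ _)
    exact ⟨m, (hK.irreducible_tr f).invariant_pos (fun s t => K.tr_nonneg _ _ _) hm0 hm1 hm, hm1, hm⟩
  choose m hmpos hm1 hm using hex
  -- Among the finitely many deterministic policies one is best. Comparing it with its modifications
  -- in a single state gives the optimality inequality for every pair of state and input.
  obtain ⟨f, hf⟩ := Finite.exists_max fun f : S → X => ∑ s, m f s * r s (f s)
  obtain ⟨h, hh⟩ := (hK.irreducible_tr f).exists_poisson (fun s t => K.tr_nonneg _ _ _)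
    (fun s => K.sum_tr _ _) (hm1 f) (hm f) fun s => r s (f s)
  refine ⟨f, m f, h, _, hmpos f, hm1 f, hm f, rfl, fun s => by rw [← K.sum_tr_mul, hh],
    fun s x => ?_⟩
  rw [← K.sum_tr_mul]
  have e : ∀ i, Function.update f s x i = if i = s then x else f i := fun i => by
    simp [Function.update_apply]
  refine optimality_of_row_update hh (m := m (Function.update f s x)) (hm1 _) (hmpos _ s) ?_ ?_
  · intro t
    rw [← hm (Function.update f s x) t]
    refine Finset.sum_congr rfl fun i _ => ?_
    by_cases his : i = s
    · subst his; simp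
    · simp [Function.update_of_ne his]
  · refine le_trans (le_of_eq (Finset.sum_congr rfl fun i _ => ?_)) (hf (Function.update f s x))
    by_cases his : i = s
    · subst his; simp
    · simp [Function.update_of_ne his]

end MarkovChannel

/-! ### Divergences of finite laws and the Burnashev coefficient. -/

section KL

variable {α : Type*}

lemma klPMF_eq_top {p q : PMF α} {a : α} (hq : q a = 0) (hp : p a ≠ 0) : klPMF p q = ∞ := by
  let _ : MeasurableSpace α := ⊤
  refine InformationTheory.klDiv_of_not_ac fun hac => hp ?_
  have := hac (s := {a}) (by rw [PMF.toMeasure_apply_singleton _ _ (MeasurableSet.singleton a), hq])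
  rwa [PMF.toMeasure_apply_singleton _ _ (MeasurableSet.singleton a)] at this

lemma klPMF_eq_ofReal [Fintype α] {p q : PMF α} (h : ∀ a, q a = 0 → p a = 0) :
    klPMF p q = ENNReal.ofReal (∑ a, (p a).toReal * Real.log ((p a).toReal / (q a).toReal)) := by
  let _ : MeasurableSpace α := ⊤
  have hsing : ∀ (r : PMF α) (a : α), r.toMeasure {a} = r a := fun r a =>
    PMF.toMeasure_apply_singleton _ _ (MeasurableSet.singleton a)
  have hac : p.toMeasure ≪ q.toMeasure := by
    intro s hs
    rw [← Set.biUnion_of_singleton s, measure_biUnion_null_iff (Set.to_countable s)]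
    intro a ha
    rw [hsing]
    refine h a ?_
    rw [← hsing]
    exact measure_mono_null (Set.singleton_subset_iff.2 ha) hs
  have hint : Integrable (llr p.toMeasure q.toMeasure) p.toMeasure := Integrable.of_finite
  have hne : klPMF p q ≠ ∞ := InformationTheory.klDiv_ne_top hac hint
  rw [← ENNReal.ofReal_toReal hne]
  congr 1
  refine (InformationTheory.toReal_klDiv_of_measure_eq hac (by simp)).trans ?_
  rw [integral_fintype hint]
  refine Finset.sum_congr rfl fun a _ => ?_
  rw [Measure.real, hsing, smul_eq_mul]
  by_cases hqa : q a = 0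
  · simp [h a hqa]
  have hd : p.toMeasure.rnDeriv q.toMeasure a * q a = p a := by
    have := Measure.withDensity_rnDeriv_eq _ _ hac
    have h2 := congrArg (fun μ : Measure α => μ {a}) this
    rwa [withDensity_apply _ (MeasurableSet.singleton a), lintegral_singleton, hsing, hsing] at h2
  have : (p.toMeasure.rnDeriv q.toMeasure a).toReal = (p a).toReal / (q a).toReal := by
    rw [← hd, ENNReal.toReal_mul, mul_div_cancel_right₀]
    exact (ENNReal.toReal_pos hqa (q.apply_ne_top a)).ne'
  rw [llr, this]

end KL

/-- Concavity of the logarithm for a finite convex combination. -/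
lemma sum_mul_log_le_log_sum {ι : Type*} [Fintype ι] {w a : ι → ℝ} (hw : ∀ i, 0 ≤ w i)
    (hw1 : ∑ i, w i = 1) (ha : ∀ i, 0 < a i) :
    ∑ i, w i * Real.log (a i) ≤ Real.log (∑ i, w i * a i) := by
  have := strictConcaveOn_log_Ioi.concaveOn.le_map_sum (t := Finset.univ) (w := w) (p := a)
    (fun i _ => hw i) hw1 (fun i _ => ha i)
  simpa [smul_eq_mul] using this

/-- Convexity of `t log t` for a finite convex combination. -/
lemma mul_log_sum_le {ι : Type*} [Fintype ι] {w a : ι → ℝ} (hw : ∀ i, 0 ≤ w i)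
    (hw1 : ∑ i, w i = 1) (ha : ∀ i, 0 ≤ a i) :
    (∑ i, w i * a i) * Real.log (∑ i, w i * a i) ≤ ∑ i, w i * (a i * Real.log (a i)) := by
  have := Real.convexOn_mul_log.map_sum_le (t := Finset.univ) (w := w) (p := a)
    (fun i _ => hw i) hw1 (fun i _ => ha i)
  simpa [smul_eq_mul] using this

namespace MarkovChannel

variable {S X Y : Type*} [Fintype S] [Fintype Y] [Fintype X]

/-- All output laws of a state have the same support. -/
def CommonSupport (K : MarkovChannel S X Y) : Prop :=
  ∀ s x x' o, K.p s x' o = 0 → K.p s x o = 0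

/-- The divergence between the laws of the outcomes of two inputs. -/
noncomputable def kl (K : MarkovChannel S X Y) (s : S) (x x' : X) : ℝ :=
  ∑ o, K.p s x o * Real.log (K.p s x o / K.p s x' o)

/-- The largest divergence that the input `x` can have in the state `s`. -/
noncomputable def dmax (K : MarkovChannel S X Y) (s : S) (x : X) : ℝ := ⨆ x', K.kl s x x'

variable {K : MarkovChannel S X Y}

lemma kl_le_dmax (s : S) (x x' : X) : K.kl s x x' ≤ K.dmax s x :=
  le_ciSup (f := fun x' => K.kl s x x') (Set.finite_range _).bddAbove x'

lemma exists_kl_eq_dmax (s : S) (x : X) : ∃ x', K.kl s x x' = K.dmax s x := by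
  have : Nonempty X := ⟨x⟩
  exact exists_eq_ciSup_of_finite

lemma kl_self (s : S) (x : X) : K.kl s x x = 0 := by
  refine Finset.sum_eq_zero fun o _ => ?_
  by_cases h : K.p s x o = 0
  · simp [h]
  · simp [div_self h]

lemma dmax_nonneg (s : S) (x : X) : 0 ≤ K.dmax s x := K.kl_self s x ▸ K.kl_le_dmax s x x

lemma p_eq_zero_iff {s : S} {x : X} {o : S × Y} : K.p s x o = 0 ↔ K.P s x o = 0 := by
  rw [p, ENNReal.toReal_eq_zero_iff, or_iff_left ((K.P s x).apply_ne_top o)]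

lemma Q_pure (s : S) (x : X) : K.Q s (PMF.pure x) = K.P s x := PMF.pure_bind _ _

lemma klPMF_pure (hK : K.CommonSupport) (s : S) (x x' : X) :
    klPMF (K.Q s (PMF.pure x)) (K.Q s (PMF.pure x')) = ENNReal.ofReal (K.kl s x x') := by
  rw [Q_pure, Q_pure, klPMF_eq_ofReal fun o ho => ?_]
  · rfl
  · exact p_eq_zero_iff.1 (hK s x x' o (p_eq_zero_iff.2 ho))

lemma ofReal_dmax_le_divCost (hK : K.CommonSupport) (s : S) (x : X) :
    ENNReal.ofReal (K.dmax s x) ≤ K.divCost s (PMF.pure x) := by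
  obtain ⟨x', hx'⟩ := K.exists_kl_eq_dmax s x
  rw [← hx', ← klPMF_pure hK]
  exact le_iSup (fun u' => klPMF (K.Q s (PMF.pure x)) (K.Q s u')) (PMF.pure x')

/-- Divergence is convex in both arguments: convexity of t log t handles the mixture in the first,
concavity of log the one in the second. What remains is an average of divergences between pure
inputs. -/
lemma divCost_le (hK : K.CommonSupport) (s : S) (u : PMF X) :
    K.divCost s u ≤ ENNReal.ofReal (∑ x, (u x).toReal * K.dmax s x) := by
  refine iSup_le fun u' => ?_
  have hu0 : ∀ x, 0 ≤ (u x).toReal := fun x => ENNReal.toReal_nonneg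
  have hu1 := u.sum_toReal
  have hu0' : ∀ x, 0 ≤ (u' x).toReal := fun x => ENNReal.toReal_nonneg
  have hu1' := u'.sum_toReal
  have hzero : ∀ (o : S × Y) (v : PMF X), (K.Q s v o).toReal = 0 → ∀ x, K.p s x o = 0 := by
    intro o v h x
    rw [Q_toReal] at h
    have h2 := (Finset.sum_eq_zero_iff_of_nonneg
      (fun x _ => mul_nonneg ENNReal.toReal_nonneg (K.p_nonneg s x o))).1 h
    obtain ⟨x', hx'⟩ := v.support_nonempty
    refine hK s x x' o ((mul_eq_zero.1 (h2 x' (Finset.mem_univ _))).resolve_left ?_)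
    exact (ENNReal.toReal_pos ((v.mem_support_iff x').1 hx') (v.apply_ne_top _)).ne'
  rw [klPMF_eq_ofReal]
  swap
  · intro o ho
    have h1 := hzero o u' (by rw [ho, ENNReal.toReal_zero])
    rw [← ENNReal.toReal_eq_zero_iff _ |>.trans (or_iff_left ((K.Q s u).apply_ne_top o)), Q_toReal]
    simp [h1]
  refine ENNReal.ofReal_le_ofReal ?_
  calc ∑ o, (K.Q s u o).toReal * Real.log ((K.Q s u o).toReal / (K.Q s u' o).toReal)
      ≤ ∑ o, ∑ x, (u x).toReal * ∑ x', (u' x').toReal *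
          (K.p s x o * Real.log (K.p s x o / K.p s x' o)) := by
        refine Finset.sum_le_sum fun o _ => ?_
        by_cases hq : (K.Q s u o).toReal = 0
        · have := hzero o u hq
          simp [hq, this]
        -- With a common support, an outcome is either impossible for all inputs or possible for all
        -- of them, so the logarithms below can be split.
        have hne : ∀ x, K.p s x o ≠ 0 := by
          intro x hx
          refine hq ?_
          rw [Q_toReal]
          exact Finset.sum_eq_zero fun x' _ => by rw [hK s x' x o hx, mul_zero]
        have hpos : ∀ x, 0 < K.p s x o := fun x => (K.p_nonneg s x o).lt_of_ne' (hne x)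
        have hq' : (K.Q s u' o).toReal ≠ 0 := by
          intro h
          obtain ⟨x, -⟩ := u.support_nonempty
          exact hne x (hzero o u' h x)
        rw [Real.log_div hq hq', mul_sub]
        have h1 := mul_log_sum_le hu0 hu1 (fun x => K.p_nonneg s x o)
        have h2 := sum_mul_log_le_log_sum hu0' hu1' hpos
        rw [← Q_toReal] at h1 h2
        have h3 : ∑ x, (u x).toReal * ∑ x', (u' x').toReal *
            (K.p s x o * Real.log (K.p s x o / K.p s x' o))
            = ∑ x, (u x).toReal * (K.p s x o * Real.log (K.p s x o))
              - (K.Q s u o).toReal * ∑ x', (u' x').toReal * Real.log (K.p s x' o) := by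
          rw [Q_toReal, Finset.sum_mul, ← Finset.sum_sub_distrib]
          refine Finset.sum_congr rfl fun x _ => ?_
          have : ∀ x', (u' x').toReal * (K.p s x o * Real.log (K.p s x o / K.p s x' o))
              = (u' x').toReal * (K.p s x o * Real.log (K.p s x o))
                - K.p s x o * ((u' x').toReal * Real.log (K.p s x' o)) := by
            intro x'
            rw [Real.log_div (hne _) (hne _)]; ring
          simp only [this, Finset.sum_sub_distrib, ← Finset.sum_mul, hu1', ← Finset.mul_sum]
          ring
        rw [h3]
        have := mul_le_mul_of_nonneg_left h2 (ENNReal.toReal_nonneg (a := K.Q s u o))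
        linarith
    _ = ∑ x, (u x).toReal * ∑ x', (u' x').toReal * K.kl s x x' := by
        rw [Finset.sum_comm]
        refine Finset.sum_congr rfl fun x _ => ?_
        rw [← Finset.mul_sum, Finset.sum_comm]
        simp only [kl, Finset.mul_sum]
    _ ≤ ∑ x, (u x).toReal * ∑ x', (u' x').toReal * K.dmax s x := by
        gcongr with x _ x' _
        exact kl_le_dmax s x x'
    _ = ∑ x, (u x).toReal * K.dmax s x := by
        simp only [← Finset.sum_mul, hu1', one_mul]

/-- If all output laws of a state have the same support then the Burnashev coefficient is finite,
it is attained by a deterministic policy, and it satisfies the optimality equation. -/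
lemma Ergodic.burnashevCoeff_eq [Nonempty X] (hE : K.Ergodic) (hK : K.CommonSupport) :
    ∃ (f : S → X) (h : S → ℝ) (D : ℝ), 0 ≤ D ∧ K.burnashevCoeff = ENNReal.ofReal D ∧
      (∀ s, K.dmax s (f s) + ∑ o, K.p s (f s) o * h o.1 = D + h s) ∧
      ∀ s x, K.dmax s x + ∑ o, K.p s x o * h o.1 ≤ D + h s := by
  classical
  obtain ⟨f, m, h, g, hmpos, hm1, hm, hg, hpoi, hopt⟩ := hE.exists_optimal_deterministic K.dmax
  refine ⟨f, h, g, ?_, le_antisymm ?_ ?_, hpoi, hopt⟩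
  · rw [hg]
    exact Finset.sum_nonneg fun s _ => mul_nonneg (hmpos s).le (dmax_nonneg _ _)
  · refine sSup_le ?_
    rintro _ ⟨π, μ, hμ, rfl⟩
    rw [isInvariant_iff] at hμ
    calc ∑ s, μ s * K.divCost s (π s)
        ≤ ∑ s, ENNReal.ofReal ((μ s).toReal * ∑ x, (π s x).toReal * K.dmax s x) := by
          refine Finset.sum_le_sum fun s _ => ?_
          rw [ENNReal.ofReal_mul ENNReal.toReal_nonneg, ENNReal.ofReal_toReal (μ.apply_ne_top s)]
          gcongr
          exact divCost_le hK s (π s)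
      _ = ENNReal.ofReal (∑ s, (μ s).toReal * ∑ x, (π s x).toReal * K.dmax s x) := by
          rw [ENNReal.ofReal_sum_of_nonneg]
          exact fun s _ => mul_nonneg ENNReal.toReal_nonneg
            (Finset.sum_nonneg fun x _ => mul_nonneg ENNReal.toReal_nonneg (dmax_nonneg _ _))
      _ ≤ ENNReal.ofReal g := by
          refine ENNReal.ofReal_le_ofReal ?_
          -- The optimality inequality is linear in the input law. Integrated against an invariant
          -- law its relative values cancel, so randomization does not beat `g`.
          have h1 : ∀ s, ∑ x, (π s x).toReal * K.dmax s x ≤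
              g + h s - ∑ t, K.trans (fun s x => (π s x).toReal) s t * h t := by
            intro s
            rw [sum_trans_mul]
            have : ∑ x, (π s x).toReal * (K.dmax s x + ∑ o, K.p s x o * h o.1)
                ≤ ∑ x, (π s x).toReal * (g + h s) :=
              Finset.sum_le_sum fun x _ =>
                mul_le_mul_of_nonneg_left (hopt s x) ENNReal.toReal_nonneg
            rw [← Finset.sum_mul, PMF.sum_toReal] at this
            simp only [mul_add, Finset.sum_add_distrib] at this
            linarith
          have h2 : ∑ s, (μ s).toReal * ∑ x, (π s x).toReal * K.dmax s x ≤
              ∑ s, (μ s).toReal *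
                (g + h s - ∑ t, K.trans (fun s x => (π s x).toReal) s t * h t) :=
            Finset.sum_le_sum fun s _ => mul_le_mul_of_nonneg_left (h1 s) ENNReal.toReal_nonneg
          refine h2.trans (le_of_eq ?_)
          simp only [mul_sub, mul_add, Finset.sum_sub_distrib, Finset.sum_add_distrib,
            Finset.mul_sum]
          rw [Finset.sum_comm (s := Finset.univ) (t := Finset.univ)
            (f := fun s t => (μ s).toReal * (K.trans (fun s x => (π s x).toReal) s t * h t))]
          simp only [← mul_assoc, ← Finset.sum_mul, hμ, μ.sum_toReal]
          ring
  · obtain ⟨μ, hμ⟩ := PMF.exists_toReal_eq (fun s => (hmpos s).le) hm1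
    refine le_trans ?_ (le_sSup ⟨fun s => PMF.pure (f s), μ, ?_, rfl⟩)
    · rw [hg, ENNReal.ofReal_sum_of_nonneg fun s _ => mul_nonneg (hmpos s).le (dmax_nonneg _ _)]
      refine Finset.sum_le_sum fun s _ => ?_
      rw [ENNReal.ofReal_mul (hmpos s).le, ← hμ, ENNReal.ofReal_toReal (μ.apply_ne_top s)]
      gcongr
      exact ofReal_dmax_le_divCost hK s (f s)
    · rw [isInvariant_iff]
      intro t
      simp only [hμ, trans]
      rw [← hm t]
      refine Finset.sum_congr rfl fun s _ => ?_
      simp [PMF.pure_apply, apply_ite ENNReal.toReal]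

/-- Always use an input `x` which in the state `s` can produce an outcome impossible for `x'`. Its
divergence cost at `s` is infinite, and irreducibility gives `s` positive stationary mass. -/
lemma Ergodic.burnashevCoeff_eq_top (hE : K.Ergodic) (hK : ¬ K.CommonSupport) :
    K.burnashevCoeff = ∞ := by
  classical
  simp only [CommonSupport, not_forall] at hK
  obtain ⟨s, x, x', o, h0, h1⟩ := hK
  have := K.nonempty_state
  obtain ⟨m, hm0, hm1, hm⟩ := exists_invariant_law (P := fun s t => K.tr s x t)
      (fun s t => K.tr_nonneg _ _ _) (fun s => K.sum_tr _ _)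
  have hpos := (hE.irreducible_tr fun _ => x).invariant_pos (fun s t => K.tr_nonneg _ _ _) hm0 hm1 hm
  obtain ⟨μ, hμ⟩ := PMF.exists_toReal_eq hm0 hm1
  refine top_le_iff.1 (le_trans ?_ (le_sSup ⟨fun s => PMF.pure x, μ, ?_, rfl⟩))
  · have htop : K.divCost s (PMF.pure x) = ∞ := by
      refine top_le_iff.1 (le_trans ?_
        (le_iSup (fun u' => klPMF (K.Q s (PMF.pure x)) (K.Q s u')) (PMF.pure x')))
      rw [Q_pure, Q_pure, klPMF_eq_top (a := o)]
      · exact p_eq_zero_iff.1 h0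
      · exact fun h => h1 (p_eq_zero_iff.2 h)
    refine le_trans (le_of_eq ?_) (Finset.single_le_sum (fun _ _ => zero_le) (Finset.mem_univ s))
    rw [htop, ENNReal.mul_top]
    intro h
    have := hpos s
    rw [← hμ, h] at this
    simp at this
  · rw [isInvariant_iff]
    intro t
    simp only [hμ, trans]
    rw [← hm t]
    refine Finset.sum_congr rfl fun s _ => ?_
    simp [PMF.pure_apply, apply_ite ENNReal.toReal]

end MarkovChannel

/-! ### Mutual information and policies that attain the capacity. -/

namespace MarkovChannel

variable {S X Y : Type*} [Fintype S] [Fintype Y] [Fintype X]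

/-- The outcome law of an input law `u`. -/
noncomputable def q (K : MarkovChannel S X Y) (s : S) (u : X → ℝ) (o : S × Y) : ℝ :=
  ∑ x, u x * K.p s x o

/-- The mutual information cost in terms of real-valued input laws. -/
noncomputable def info (K : MarkovChannel S X Y) (s : S) (u : X → ℝ) : ℝ :=
  ∑ x, ∑ o, u x * K.p s x o * Real.log (K.p s x o / K.q s u o)

lemma infoCost_eq (K : MarkovChannel S X Y) (s : S) (u : PMF X) :
    K.infoCost s u = K.info s fun x => (u x).toReal := by
  simp only [infoCost, info, Fintype.sum_prod_type_right, p, q]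

variable {K : MarkovChannel S X Y}

lemma q_nonneg {u : X → ℝ} (hu : ∀ x, 0 ≤ u x) (s : S) (o : S × Y) : 0 ≤ K.q s u o :=
  Finset.sum_nonneg fun x _ => mul_nonneg (hu x) (K.p_nonneg s x o)

lemma le_q {u : X → ℝ} (hu : ∀ x, 0 ≤ u x) (s : S) (x : X) (o : S × Y) :
    u x * K.p s x o ≤ K.q s u o :=
  Finset.single_le_sum (f := fun x => u x * K.p s x o)
    (fun x _ => mul_nonneg (hu x) (K.p_nonneg s x o)) (Finset.mem_univ x)

/-- Outcome entropy minus conditional entropy. In contrast to the form with quotients, this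
expression is visibly continuous in `u`, also where probabilities vanish. -/
lemma info_eq {u : X → ℝ} (hu : ∀ x, 0 ≤ u x) (s : S) :
    K.info s u = ∑ o, Real.negMulLog (K.q s u o)
      + ∑ x, u x * ∑ o, K.p s x o * Real.log (K.p s x o) := by
  have h1 : ∀ x o, u x * K.p s x o * Real.log (K.p s x o / K.q s u o)
      = u x * (K.p s x o * Real.log (K.p s x o)) - u x * K.p s x o * Real.log (K.q s u o) := by
    intro x o
    by_cases hx : u x * K.p s x o = 0
    · rw [hx, ← mul_assoc, hx]; ring
    · have h2 : 0 < K.q s u o := lt_of_lt_of_le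
        ((mul_nonneg (hu x) (K.p_nonneg s x o)).lt_of_ne' hx) (le_q hu s x o)
      rw [Real.log_div (right_ne_zero_of_mul hx) h2.ne']; ring
  simp only [info, h1, Finset.sum_sub_distrib, Real.negMulLog, Finset.mul_sum]
  rw [Finset.sum_comm (f := fun x o => u x * K.p s x o * Real.log (K.q s u o))]
  simp only [← Finset.sum_mul]
  simp only [neg_mul, Finset.sum_neg_distrib, q]
  ring

/-- A stationary policy attaining the capacity, with the average-reward optimality equation. -/
lemma Ergodic.exists_optimal_policy [Nonempty X] (hE : K.Ergodic) :
    ∃ (π : S → X → ℝ) (h : S → ℝ), (∀ s x, 0 ≤ π s x) ∧ (∀ s, ∑ x, π s x = 1) ∧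
      (∀ s, K.info s (π s) + ∑ x, π s x * ∑ o, K.p s x o * h o.1 = K.capacity + h s) ∧
      ∀ s (u : X → ℝ), (∀ x, 0 ≤ u x) → ∑ x, u x = 1 →
        K.info s u + ∑ x, u x * ∑ o, K.p s x o * h o.1 ≤ K.capacity + h s := by
  classical
  have := K.nonempty_state
  -- The invariant law is kept as a second coordinate subject to closed equations. This makes the
  -- feasible set compact without any discussion of how the invariant law depends on the policy.
  let Z : Set ((S → X → ℝ) × (S → ℝ)) :=
    {z | (∀ s, z.1 s ∈ stdSimplex ℝ X) ∧ z.2 ∈ stdSimplex ℝ S ∧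
      ∀ t, ∑ s, z.2 s * K.trans z.1 s t = z.2 t}
  let G : (S → X → ℝ) × (S → ℝ) → ℝ := fun z =>
    ∑ s, z.2 s * (∑ o, Real.negMulLog (K.q s (z.1 s) o)
      + ∑ x, z.1 s x * ∑ o, K.p s x o * Real.log (K.p s x o))
  have hG : Continuous G := by
    simp only [G, q]
    fun_prop
  have hGZ : ∀ z ∈ Z, G z = ∑ s, z.2 s * K.info s (z.1 s) := fun z hz =>
    Finset.sum_congr rfl fun s _ => by rw [info_eq (hz.1 s).1]
  have hZc : IsCompact Z := by
    have hc : IsCompact ((Set.univ.pi fun _ : S => stdSimplex ℝ X) ×ˢ stdSimplex ℝ S) :=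
      (isCompact_univ_pi fun _ => isCompact_stdSimplex ℝ X).prod (isCompact_stdSimplex ℝ S)
    have hcl : IsClosed {z : (S → X → ℝ) × (S → ℝ) |
        ∀ t, ∑ s, z.2 s * K.trans z.1 s t = z.2 t} := by
      simp only [Set.ofPred_forall]
      refine isClosed_iInter fun t => isClosed_eq ?_ ?_
      · simp only [trans]; fun_prop
      · fun_prop
    convert hc.inter_right hcl using 1
    ext z
    simp [Z, and_assoc]
  have hex : ∀ π : S → X → ℝ, (∀ s, π s ∈ stdSimplex ℝ X) → ∃ m, (π, m) ∈ Z ∧ ∀ s, 0 < m s := by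
    intro π hπ
    obtain ⟨m, hm0, hm1, hm⟩ := exists_invariant_law (trans_nonneg fun s x => (hπ s).1 x)
      (sum_trans (K := K) fun s => (hπ s).2)
    exact ⟨m, ⟨hπ, ⟨hm0, hm1⟩, hm⟩, (hE.irreducible (fun s x => (hπ s).1 x)
      fun s => (hπ s).2).invariant_pos (trans_nonneg fun s x => (hπ s).1 x) hm0 hm1 hm⟩
  have hne : Z.Nonempty := by
    obtain ⟨m, hm, -⟩ := hex (fun _ => Pi.single (Classical.arbitrary X) 1)
      fun s => single_mem_stdSimplex ℝ _
    exact ⟨_, hm⟩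
  obtain ⟨⟨π, m⟩, hzZ, hmax⟩ := hZc.exists_isMaxOn hne hG.continuousOn
  have hcap : K.capacity = ∑ s, m s * K.info s (π s) := by
    refine IsGreatest.csSup_eq ⟨?_, ?_⟩
    · obtain ⟨μ, hμ⟩ := PMF.exists_toReal_eq hzZ.2.1.1 hzZ.2.1.2
      choose u hu using fun s => PMF.exists_toReal_eq (hzZ.1 s).1 (hzZ.1 s).2
      refine ⟨u, μ, ?_, ?_⟩
      · rw [isInvariant_iff]
        simp only [hμ, hu]
        exact hzZ.2.2
      · simp only [infoCost_eq, hμ, hu]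
    · rintro _ ⟨u, μ, hμ, rfl⟩
      rw [isInvariant_iff] at hμ
      have hmem : ((fun s x => (u s x).toReal, fun s => (μ s).toReal) :
          (S → X → ℝ) × (S → ℝ)) ∈ Z :=
        ⟨fun s => ⟨fun x => ENNReal.toReal_nonneg, (u s).sum_toReal⟩,
          ⟨fun x => ENNReal.toReal_nonneg, μ.sum_toReal⟩, hμ⟩
      have := hmax hmem
      simp only [Set.mem_ofPred_eq] at this
      rw [hGZ _ hmem, hGZ _ hzZ] at this
      simpa only [infoCost_eq] using this
  have hπ0 : ∀ s x, 0 ≤ π s x := fun s x => (hzZ.1 s).1 x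
  have hπ1 : ∀ s, ∑ x, π s x = 1 := fun s => (hzZ.1 s).2
  obtain ⟨h, hh⟩ := (hE.irreducible hπ0 hπ1).exists_poisson (trans_nonneg hπ0)
    (sum_trans hπ1) hzZ.2.1.2 hzZ.2.2 fun s => K.info s (π s)
  rw [← hcap] at hh
  refine ⟨π, h, hπ0, hπ1, fun s => by rw [← sum_trans_mul, hh], fun s u hu0 hu1 => ?_⟩
  -- Policy improvement again: the maximizer is compared with the policy that uses `u` in the single
  -- state `s`.
  obtain ⟨m', hm', hpos'⟩ := hex (Function.update π s u) fun i => by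
    by_cases his : i = s
    · subst his; simpa using ⟨hu0, hu1⟩
    · simpa [Function.update_of_ne his] using hzZ.1 i
  have e := sum_trans_mul (K := K) (fun _ => u) s h
  rw [← e]
  refine optimality_of_row_update hh (m := m') hm'.2.1.2 (hpos' s) ?_ ?_
  · intro t
    refine Eq.trans (Finset.sum_congr rfl fun i _ => ?_) (hm'.2.2 t)
    by_cases his : i = s
    · subst his; simp [trans]
    · simp [Function.update_of_ne his, trans]
  · have := hmax hm'
    simp only [Set.mem_ofPred_eq] at this
    rw [hGZ _ hm', hGZ _ hzZ, ← hcap] at this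
    refine le_trans (le_of_eq (Finset.sum_congr rfl fun i _ => ?_)) this
    by_cases his : i = s
    · subst his; simp
    · simp [Function.update_of_ne his]

end MarkovChannel

/-! ### Entropy and log-odds of an unnormalized posterior. -/

section Potentials

variable {W : Type*} [Fintype W]

/-- Unnormalized average log-likelihood ratio of a positive vector. -/
noncomputable def likelihoodPotential (v : W → ℝ) : ℝ :=
  ∑ w, v w * Real.log (v w / (∑ i, v i - v w))

/-- Unnormalized entropy of a positive vector. -/
noncomputable def entropyPotential (v : W → ℝ) : ℝ :=
  ∑ w, v w * Real.log ((∑ i, v i) / v w)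

variable {v : W → ℝ}

lemma sum_pos_of_forall_pos [Nonempty W] (hv : ∀ w, 0 < v w) : 0 < ∑ w, v w :=
  Finset.sum_pos (fun w _ => hv w) Finset.univ_nonempty

lemma lt_sum_of_pos [Nontrivial W] (hv : ∀ w, 0 < v w) (w : W) : v w < ∑ i, v i := by
  obtain ⟨w', hw'⟩ := exists_ne w
  exact Finset.single_lt_sum hw' (Finset.mem_univ w) (Finset.mem_univ w') (hv w')
    fun _ _ _ => (hv _).le

/-- Gibbs' inequality against a subprobability reference law. -/
lemma entropyPotential_le_of_ref [Nonempty W] (hv : ∀ w, 0 < v w) {r : W → ℝ} (hr : ∀ w, 0 < r w)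
    (hr1 : ∑ w, r w ≤ 1) : entropyPotential v ≤ ∑ w, v w * Real.log (1 / r w) := by
  have hV := sum_pos_of_forall_pos hv
  set V := ∑ w, v w with hVdef
  have h1 := sum_mul_log_le_log_sum (w := fun w => v w / V) (a := fun w => r w * V / v w)
    (fun w => div_nonneg (hv w).le hV.le) (by rw [← Finset.sum_div, div_self hV.ne'])
    (fun w => div_pos (mul_pos (hr w) hV) (hv w))
  have h2 : ∑ w, v w / V * (r w * V / v w) = ∑ w, r w := Finset.sum_congr rfl fun w _ => by
    have := (hv w).ne'
    field_simp
  rw [h2] at h1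
  have h3 : Real.log (∑ w, r w) ≤ 0 := Real.log_nonpos (Finset.sum_nonneg fun w _ => (hr w).le) hr1
  have h4 : ∑ w, v w / V * Real.log (r w * V / v w)
      = (entropyPotential v - ∑ w, v w * Real.log (1 / r w)) / V := by
    rw [entropyPotential, ← Finset.sum_sub_distrib, Finset.sum_div]
    refine Finset.sum_congr rfl fun w _ => ?_
    rw [Real.log_div (mul_pos (hr w) hV).ne' (hv w).ne', Real.log_mul (hr w).ne' hV.ne',
      ← hVdef, Real.log_div hV.ne' (hv w).ne', one_div, Real.log_inv]
    ring
  rw [h4] at h1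
  have := (div_le_iff₀ hV).1 (h1.trans h3)
  linarith

lemma entropyPotential_le_card [Nonempty W] (hv : ∀ w, 0 < v w) :
    entropyPotential v ≤ (∑ w, v w) * Real.log (Fintype.card W) := by
  have hM : (0 : ℝ) < Fintype.card W := by exact_mod_cast Fintype.card_pos
  have := entropyPotential_le_of_ref hv (r := fun _ => 1 / (Fintype.card W : ℝ))
    (fun _ => by positivity) (by simp)
  simpa [← Finset.sum_mul] using this

/-- Fano's inequality. -/
lemma entropyPotential_le_fano [Nonempty W] (hv : ∀ w, 0 < v w) (d : W) :
    entropyPotential v ≤ (∑ w, v w) * Real.log 2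
      + (∑ w, v w - v d) * Real.log (Fintype.card W) := by
  classical
  have hM : (0 : ℝ) < Fintype.card W := by exact_mod_cast Fintype.card_pos
  have hM1 : (1 : ℝ) ≤ Fintype.card W := by exact_mod_cast Fintype.card_pos
  refine (entropyPotential_le_of_ref hv
    -- Half of the reference mass sits on the decision, the other half is spread uniformly over all
    -- messages. The share of `d` in the second half is dropped, whence only a subprobability.
    (r := fun w => if w = d then 1 / 2 else 1 / (2 * Fintype.card W)) (fun w => ?_) ?_).trans ?_
  · split_ifs <;> positivity
  · have : ∀ w, (if w = d then (1 : ℝ) / 2 else 1 / (2 * Fintype.card W)) ≤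
        (if w = d then 1 / 2 else 0) + 1 / (2 * Fintype.card W) := by
      intro w
      split_ifs
      · have : (0 : ℝ) ≤ 1 / (2 * Fintype.card W) := by positivity
        linarith
      · simp
    refine (Finset.sum_le_sum fun w _ => this w).trans (le_of_eq ?_)
    rw [Finset.sum_add_distrib]
    simp only [Finset.sum_ite_eq', Finset.mem_univ, if_true, Finset.sum_const, Finset.card_univ,
      nsmul_eq_mul]
    field_simp
    norm_num
  · have : ∀ w, v w * Real.log (1 / (if w = d then (1 : ℝ) / 2 else 1 / (2 * Fintype.card W)))
        = v w * Real.log 2 + (v w * Real.log (Fintype.card W)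
          - if w = d then v d * Real.log (Fintype.card W) else 0) := by
      intro w
      split_ifs with h
      · subst h; simp
      · rw [one_div_one_div, Real.log_mul two_ne_zero hM.ne']; ring
    simp only [this, Finset.sum_add_distrib, Finset.sum_sub_distrib, ← Finset.sum_mul,
      Finset.sum_ite_eq', Finset.mem_univ, if_true]
    linarith

/-- If no message takes more than the fraction 1 - η of the mass, all odds are below 1/η. This
bounds the starting value of the log-odds when the confirmation stage of the converse begins. -/
lemma likelihoodPotential_le [Nontrivial W] (hv : ∀ w, 0 < v w) {η : ℝ} (hη : 0 < η)
    (h : ∀ w, η * ∑ i, v i ≤ ∑ i, v i - v w) :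
    likelihoodPotential v ≤ (∑ w, v w) * Real.log (1 / η) := by
  rw [likelihoodPotential, Finset.sum_mul]
  refine Finset.sum_le_sum fun w _ => mul_le_mul_of_nonneg_left ?_ (hv w).le
  have h1 := lt_sum_of_pos hv w
  refine Real.log_le_log (div_pos (hv w) (by linarith)) ?_
  rw [div_le_div_iff₀ (by linarith) hη]
  nlinarith [h w, mul_lt_mul_of_pos_left h1 hη]

/-- The likelihood potential at a decision is large when the error is small. -/
lemma le_likelihoodPotential [Nontrivial W] (hv : ∀ w, 0 < v w) (d : W) {p : ℝ} (hp : 0 < p) :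
    (∑ w, v w) * (Real.log (1 / p) - Real.log 2) ≤ likelihoodPotential v
      + (∑ w, v w - v d) * (Real.log (Fintype.card W) + 1 / p) := by
  classical
  have hV := sum_pos_of_forall_pos hv
  have hlt := fun w => lt_sum_of_pos hv w
  have hF := entropyPotential_le_fano hv d
  set V := ∑ w, v w with hVdef
  set e := V - v d with he
  have he0 : 0 < e := by linarith [hlt d]
  -- For messages other than `d` the competing mass is at most `V`, which leaves minus an entropy
  -- term; the decision alone contributes the large logarithm.
  have h1 : -entropyPotential v + v d * Real.log (V / e) ≤ likelihoodPotential v := by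
    have : ∀ w, -(v w * Real.log (V / v w)) + (if w = d then v d * Real.log (V / e) else 0)
        ≤ v w * Real.log (v w / (V - v w)) := by
      intro w
      have hw : 0 < V - v w := by linarith [hlt w]
      rw [Real.log_div hV.ne' (hv w).ne', Real.log_div (hv w).ne' hw.ne']
      split_ifs with h
      · subst h
        rw [Real.log_div hV.ne' he0.ne']
        apply le_of_eq; ring
      · have : Real.log (V - v w) ≤ Real.log V := Real.log_le_log hw (by linarith [hv w])
        nlinarith [hv w]
    have := Finset.sum_le_sum fun w (_ : w ∈ Finset.univ) => this w
    rw [Finset.sum_add_distrib, Finset.sum_neg_distrib] at this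
    simpa [entropyPotential, likelihoodPotential] using this
  have h2 : e * Real.log (V / e) ≤ V - e := by
    have := Real.log_le_sub_one_of_pos (div_pos hV he0)
    have := mul_le_mul_of_nonneg_left this he0.le
    rwa [mul_sub, mul_div_cancel₀ _ he0.ne', mul_one] at this
  -- Tangent to -log at the error ratio `p`. The bound becomes linear in the error mass `e`, so that
  -- it can be summed over the leaves of a tree.
  have h3 : V * Real.log (1 / p) + V - e / p ≤ V * Real.log (V / e) := by
    have := Real.log_le_sub_one_of_pos (div_pos he0 (mul_pos hV hp))
    rw [Real.log_div he0.ne' (mul_pos hV hp).ne', Real.log_mul hV.ne' hp.ne'] at this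
    have := mul_le_mul_of_nonneg_left this hV.le
    have h4 : V * (e / (V * p)) = e / p := by field_simp
    rw [mul_sub, mul_sub, h4] at this
    rw [one_div, Real.log_inv, Real.log_div hV.ne' he0.ne']
    linarith
  have h5 : v d = V - e := by rw [he]; ring
  rw [h5, sub_mul] at h1
  have h6 : e * (Real.log (Fintype.card W) + 1 / p) = e * Real.log (Fintype.card W) + e / p := by
    ring
  rw [h6]
  linarith

end Potentials

/-! ### Drift of the potentials in one channel use, and the converse on decision trees. -/

namespace MarkovChannel

variable {S X Y : Type*} [Fintype S] [Fintype Y] [Fintype X] {W : Type*} [Fintype W]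

/-- The unnormalized posterior after the outcome `o`. -/
noncomputable def post (K : MarkovChannel S X Y) (s : S) (x : W → X) (v : W → ℝ) (o : S × Y) :
    W → ℝ :=
  fun w => v w * K.p s (x w) o

variable {K : MarkovChannel S X Y}

lemma sum_sum_post_mul (s : S) (x : W → X) (v : W → ℝ) (h : S → ℝ) :
    ∑ o, (∑ w, K.post s x v o w) * h o.1 = ∑ w, v w * ∑ o, K.p s (x w) o * h o.1 := by
  simp only [post, Finset.sum_mul, Finset.mul_sum]
  rw [Finset.sum_comm]
  simp only [mul_assoc]

lemma sum_sum_post (s : S) (x : W → X) (v : W → ℝ) :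
    ∑ o, ∑ w, K.post s x v o w = ∑ w, v w := by
  simpa [K.sum_p] using sum_sum_post_mul (K := K) s x v fun _ => 1

lemma post_eq_zero_or_pos (hK : K.CommonSupport) (s : S) (x : W → X) (v : W → ℝ)
    (o : S × Y) : (∀ w, K.post s x v o w = 0) ∨ ∀ w, 0 < K.p s (x w) o := by
  by_cases h : ∃ w, K.p s (x w) o = 0
  · obtain ⟨w, hw⟩ := h
    exact Or.inl fun w' => by rw [post, hK s (x w') (x w) o hw, mul_zero]
  · push Not at h
    exact Or.inr fun w => (K.p_nonneg _ _ _).lt_of_ne' (h w)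

/-- For a fixed message `w` the odds are multiplied by the ratio of its outcome probability to a
mixture over the other messages. Concavity of log bounds the mean log-ratio by an average of
divergences `kl`, each at most `dmax`. -/
lemma likelihoodPotential_step [Nontrivial W] (hK : K.CommonSupport) (s : S) (x : W → X)
    {v : W → ℝ} (hv : ∀ w, 0 < v w) :
    ∑ o, likelihoodPotential (K.post s x v o)
      ≤ likelihoodPotential v + ∑ w, v w * K.dmax s (x w) := by
  classical
  simp only [likelihoodPotential]
  rw [Finset.sum_comm, ← Finset.sum_add_distrib]
  refine Finset.sum_le_sum fun w _ => ?_
  have hVw : 0 < ∑ i, v i - v w := by linarith [lt_sum_of_pos hv w]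
  set Vw := ∑ i, v i - v w with hVwdef
  -- The posterior law of the competitors of `w`.
  set l : W → ℝ := fun i => if i = w then 0 else v i / Vw with hl
  have hl0 : ∀ i, 0 ≤ l i := fun i => by
    simp only [hl]; split_ifs
    · rfl
    · exact div_nonneg (hv i).le hVw.le
  have hlsum : ∀ g : W → ℝ, Vw * ∑ i, l i * g i = ∑ i, v i * g i - v w * g w := by
    intro g
    rw [← Finset.add_sum_erase _ _ (Finset.mem_univ w),
      ← Finset.add_sum_erase (a := w) _ (fun i => v i * g i) (Finset.mem_univ w), mul_add,
      Finset.mul_sum]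
    have : ∀ i ∈ Finset.univ.erase w, Vw * (l i * g i) = v i * g i := by
      intro i hi
      simp only [hl, if_neg (Finset.ne_of_mem_erase hi)]
      field_simp
    rw [Finset.sum_congr rfl this]
    simp [hl]
  have hl1 : ∑ i, l i = 1 := by
    have := hlsum fun _ => 1
    simp only [mul_one] at this
    rw [← hVwdef] at this
    exact mul_left_cancel₀ hVw.ne' (by rw [this, mul_one])
  have hstep : ∀ o, K.post s x v o w * Real.log (K.post s x v o w /
      (∑ i, K.post s x v o i - K.post s x v o w)) ≤
      K.p s (x w) o * (v w * Real.log (v w / Vw)) + v w * ∑ i, l i *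
        (K.p s (x w) o * Real.log (K.p s (x w) o / K.p s (x i) o)) := by
    intro o
    rcases post_eq_zero_or_pos hK s x v o with h0 | hpos
    · have hw0 : K.p s (x w) o = 0 := (mul_eq_zero.1 (h0 w)).resolve_left (hv w).ne'
      simp [h0 w, hw0]
    · have e1 : ∑ i, K.post s x v o i - K.post s x v o w = Vw * ∑ i, l i * K.p s (x i) o :=
        (hlsum fun i => K.p s (x i) o).symm
      have hJ := sum_mul_log_le_log_sum hl0 hl1 hpos
      have hlp : 0 < ∑ i, l i * K.p s (x i) o := by
        obtain ⟨w', hw'⟩ := exists_ne w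
        refine Finset.sum_pos' (fun i _ => mul_nonneg (hl0 i) (hpos i).le)
          ⟨w', Finset.mem_univ _, mul_pos ?_ (hpos w')⟩
        simp only [hl, if_neg hw']
        exact div_pos (hv w') hVw
      rw [e1, post, Real.log_div (mul_pos (hv w) (hpos w)).ne' (mul_pos hVw hlp).ne',
        Real.log_mul (hv w).ne' (hpos w).ne', Real.log_mul hVw.ne' hlp.ne',
        Real.log_div (hv w).ne' hVw.ne']
      have e2 : ∑ i, l i * (K.p s (x w) o * Real.log (K.p s (x w) o / K.p s (x i) o))
          = K.p s (x w) o * (Real.log (K.p s (x w) o) - ∑ i, l i * Real.log (K.p s (x i) o)) := by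
        have : ∀ i, l i * (K.p s (x w) o * Real.log (K.p s (x w) o / K.p s (x i) o))
            = K.p s (x w) o * (l i * Real.log (K.p s (x w) o) - l i * Real.log (K.p s (x i) o)) := by
          intro i
          rw [Real.log_div (hpos w).ne' (hpos i).ne']; ring
        simp only [this, ← Finset.mul_sum, Finset.sum_sub_distrib, ← Finset.sum_mul, hl1, one_mul]
      rw [e2]
      have := mul_le_mul_of_nonneg_left hJ (mul_pos (hv w) (hpos w)).le
      linarith
  refine (Finset.sum_le_sum fun o _ => hstep o).trans ?_
  rw [Finset.sum_add_distrib, ← Finset.sum_mul, K.sum_p, one_mul, ← Finset.mul_sum,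
    Finset.sum_comm]
  simp only [← Finset.mul_sum]
  have : ∑ i, l i * K.kl s (x w) (x i) ≤ ∑ i, l i * K.dmax s (x w) :=
    Finset.sum_le_sum fun i _ => mul_le_mul_of_nonneg_left (kl_le_dmax _ _ _) (hl0 i)
  rw [← Finset.sum_mul, hl1, one_mul] at this
  have := mul_le_mul_of_nonneg_left this (hv w).le
  simp only [kl] at this
  linarith

/-- The expected entropy drop equals the total mass times the mutual information between input and
outcome: the outcome depends on the message through the input only. The optimality inequality of the
capacity problem then bounds it. -/
lemma entropyPotential_step [Nonempty W] {C : ℝ} {h : S → ℝ}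
    (hopt : ∀ s (u : X → ℝ), (∀ x, 0 ≤ u x) → ∑ x, u x = 1 →
        K.info s u + ∑ x, u x * ∑ o, K.p s x o * h o.1 ≤ C + h s)
    (s : S) (x : W → X) {v : W → ℝ} (hv : ∀ w, 0 < v w) :
    entropyPotential v + ∑ o, (∑ w, K.post s x v o w) * h o.1 ≤
      ∑ o, entropyPotential (K.post s x v o) + (∑ w, v w) * (C + h s) := by
  classical
  have hV := sum_pos_of_forall_pos hv
  rw [sum_sum_post_mul]
  simp only [entropyPotential]
  set V := ∑ i, v i with hVdef
  -- The input law induced by the posterior, the image of `v / V` under `x`.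
  set u : X → ℝ := fun a => ∑ w, if x w = a then v w / V else 0 with hu
  have hfib : ∀ g : X → ℝ, V * ∑ a, u a * g a = ∑ w, v w * g (x w) := by
    intro g
    simp only [hu, Finset.sum_mul]
    rw [Finset.sum_comm, Finset.mul_sum]
    refine Finset.sum_congr rfl fun w _ => ?_
    simp only [ite_mul, zero_mul, Finset.sum_ite_eq, Finset.mem_univ, if_true]
    field_simp
  have hu0 : ∀ a, 0 ≤ u a := fun a => Finset.sum_nonneg fun w _ => by
    split_ifs
    · exact div_nonneg (hv w).le hV.le
    · rfl
  have hu1 : ∑ a, u a = 1 := by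
    have := hfib fun _ => 1
    simp only [mul_one] at this
    rw [← hVdef] at this
    exact mul_left_cancel₀ hV.ne' (by rw [this, mul_one])
  have hq : ∀ o, ∑ i, K.post s x v o i = V * K.q s u o := fun o =>
    (hfib fun a => K.p s a o).symm
  have hterm : ∀ w o, v w * K.p s (x w) o * Real.log (K.p s (x w) o / K.q s u o)
      = K.p s (x w) o * (v w * Real.log (V / v w))
        - K.post s x v o w * Real.log ((∑ i, K.post s x v o i) / K.post s x v o w) := by
    intro w o
    rw [hq, post]
    by_cases hp : K.p s (x w) o = 0
    · simp [hp]
    have hp' : 0 < K.p s (x w) o := (K.p_nonneg _ _ _).lt_of_ne' hp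
    have hq0 : 0 < K.q s u o := by
      refine pos_of_mul_pos_right (b := K.q s u o) (a := V) ?_ hV.le
      rw [← hq]
      exact Finset.sum_pos' (fun i _ => mul_nonneg (hv i).le (K.p_nonneg _ _ _))
        ⟨w, Finset.mem_univ _, mul_pos (hv w) hp'⟩
    rw [Real.log_div hp hq0.ne', Real.log_div hV.ne' (hv w).ne',
      Real.log_div (mul_pos hV hq0).ne' (mul_pos (hv w) hp').ne', Real.log_mul hV.ne' hq0.ne',
      Real.log_mul (hv w).ne' hp]
    ring
  have hinfo : V * K.info s u = ∑ w, v w * Real.log (V / v w)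
      - ∑ o, ∑ w, K.post s x v o w * Real.log ((∑ i, K.post s x v o i) / K.post s x v o w) := by
    have : K.info s u
        = ∑ a, u a * ∑ o, K.p s a o * Real.log (K.p s a o / K.q s u o) := by
      simp only [info, Finset.mul_sum, mul_assoc]
    rw [this, hfib]
    rw [Finset.sum_comm (s := Finset.univ (α := S × Y)), ← Finset.sum_sub_distrib]
    refine Finset.sum_congr rfl fun w _ => ?_
    rw [Finset.mul_sum]
    simp only [← mul_assoc, hterm, Finset.sum_sub_distrib, ← Finset.sum_mul, K.sum_p, one_mul]
  have := mul_le_mul_of_nonneg_left (hopt s u hu0 hu1) hV.le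
  rw [mul_add, hinfo, hfib] at this
  linarith

end MarkovChannel

/-- A bounded-horizon feedback communication strategy: at a node the message determines the
channel input and the outcome determines the next node; at a leaf a message is decoded. -/
inductive DecisionTree (W X O : Type*)
  | leaf (d : W) : DecisionTree W X O
  | node (x : W → X) (c : O → DecisionTree W X O) : DecisionTree W X O

namespace DecisionTree

variable {S X Y : Type*} [Fintype S] [Fintype Y] [Fintype X] {W : Type*} [Fintype W]

/-- The (unnormalized) expected number of channel uses. -/
noncomputable def time (K : MarkovChannel S X Y) :
    DecisionTree W X (S × Y) → S → (W → ℝ) → ℝ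
  | leaf _, _, _ => 0
  | node x c, s, v => ∑ w, v w + ∑ o, (c o).time K o.1 (K.post s x v o)

/-- The (unnormalized) error probability. -/
noncomputable def err (K : MarkovChannel S X Y) :
    DecisionTree W X (S × Y) → S → (W → ℝ) → ℝ
  | leaf d, _, v => ∑ w, v w - v d
  | node x c, s, v => ∑ o, (c o).err K o.1 (K.post s x v o)

variable {K : MarkovChannel S X Y}

/-- Impossible branches contribute nothing. They are treated apart because the estimates for the
potentials need strictly positive vectors. -/
lemma time_err_zero (T : DecisionTree W X (S × Y)) : ∀ (s : S) {v : W → ℝ}, (∀ w, v w = 0) →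
    T.time K s v = 0 ∧ T.err K s v = 0 := by
  induction T with
  | leaf d => intro s v hv; simp [time, err, hv]
  | node x c ih =>
    intro s v hv
    have h : ∀ o w, K.post s x v o w = 0 := fun o w => by rw [MarkovChannel.post, hv, zero_mul]
    simp only [time, err, (ih _ _ (h _)).1, (ih _ _ (h _)).2, hv, Finset.sum_const_zero, add_zero,
      and_self]

lemma err_nonneg (T : DecisionTree W X (S × Y)) : ∀ (s : S) {v : W → ℝ}, (∀ w, 0 ≤ v w) →
    0 ≤ T.err K s v := by
  induction T with
  | leaf d =>
    intro s v hv
    exact sub_nonneg.2 (Finset.single_le_sum (fun w _ => hv w) (Finset.mem_univ d))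
  | node x c ih =>
    intro s v hv
    exact Finset.sum_nonneg fun o _ => ih o _ fun w => mul_nonneg (hv w) (K.p_nonneg _ _ _)

variable {D : ℝ} {hD : S → ℝ}

/-- The likelihood potential grows at rate at most `D`, and has to be large at a reliable
decision. -/
lemma le_time_of_likelihood [Nontrivial W] (hK : K.CommonSupport) (hD0 : ∀ s, 0 ≤ hD s)
    (hopt : ∀ s x, K.dmax s x + ∑ o, K.p s x o * hD o.1 ≤ D + hD s) {p : ℝ} (hp : 0 < p)
    (T : DecisionTree W X (S × Y)) : ∀ (s : S) {v : W → ℝ}, (∀ w, 0 < v w) →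
    (∑ w, v w) * (Real.log (1 / p) - Real.log 2) ≤
      likelihoodPotential v + (∑ w, v w) * hD s + D * T.time K s v
        + T.err K s v * (Real.log (Fintype.card W) + 1 / p) := by
  induction T with
  | leaf d =>
    intro s v hv
    have := le_likelihoodPotential hv d hp
    have h2 := mul_nonneg (sum_pos_of_forall_pos hv).le (hD0 s)
    simp only [time, err, mul_zero, add_zero]
    linarith
  | node x c ih =>
    intro s v hv
    have hchild : ∀ o, (∑ w, K.post s x v o w) * (Real.log (1 / p) - Real.log 2) ≤
        likelihoodPotential (K.post s x v o) + (∑ w, K.post s x v o w) * hD o.1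
        + D * (c o).time K o.1 (K.post s x v o)
        + (c o).err K o.1 (K.post s x v o) * (Real.log (Fintype.card W) + 1 / p) := by
      intro o
      rcases MarkovChannel.post_eq_zero_or_pos hK s x v o with h0 | hpos
      · have := time_err_zero (K := K) (c o) o.1 h0
        simp [this.1, this.2, h0, likelihoodPotential]
      · exact ih o o.1 fun w => mul_pos (hv w) (hpos w)
    have hsum := Finset.sum_le_sum fun o (_ : o ∈ Finset.univ) => hchild o
    simp only [Finset.sum_add_distrib, ← Finset.sum_mul, ← Finset.mul_sum,
      MarkovChannel.sum_sum_post] at hsum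
    have hstep := MarkovChannel.likelihoodPotential_step hK s x hv
    -- The drift `dmax` depends on state and input. Adding the relative value `hD` to the potential
    -- replaces it by the constant `D` per unit of time.
    have hd : ∑ w, v w * (K.dmax s (x w) + ∑ o, K.p s (x w) o * hD o.1)
        ≤ ∑ w, v w * (D + hD s) :=
      Finset.sum_le_sum fun w _ => mul_le_mul_of_nonneg_left (hopt _ _) (hv w).le
    simp only [mul_add, Finset.sum_add_distrib, ← Finset.sum_mul] at hd
    rw [← MarkovChannel.sum_sum_post_mul] at hd
    simp only [time, err]
    linarith

/-- The combined converse at a node where no message is likely. -/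
lemma le_time_of_unconcentrated [Nontrivial W] (hK : K.CommonSupport) (hD0 : ∀ s, 0 ≤ hD s)
    (hopt : ∀ s x, K.dmax s x + ∑ o, K.p s x o * hD o.1 ≤ D + hD s)
    {C : ℝ} (hC : 0 < C) (hDnn : 0 ≤ D) {hc : S → ℝ} (hc0 : ∀ s, 0 ≤ hc s)
    (hcopt : ∀ s (u : X → ℝ), (∀ x, 0 ≤ u x) → ∑ x, u x = 1 →
        K.info s u + ∑ x, u x * ∑ o, K.p s x o * hc o.1 ≤ C + hc s)
    {p δ l B : ℝ} (hp : 0 < p) (hδ : 0 < δ) (hl : 0 < l) (hl1 : l ≤ 1)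
    (hpl : ∀ s x o, K.p s x o ≠ 0 → l ≤ K.p s x o) (hB : ∀ s, hD s ≤ B)
    (T : DecisionTree W X (S × Y)) : ∀ (s : S) {v : W → ℝ}, (∀ w, 0 < v w) →
    (∀ w, v w ≤ (1 - δ) * ∑ i, v i) →
    (∑ w, v w) * (Real.log (1 / p) - Real.log 2)
      + D / C * (entropyPotential v - (∑ w, v w) * hc s) ≤
      D * T.time K s v + (∑ w, v w) * (Real.log (1 / (l * δ)) + B
        + D / C * (Real.log 2 + δ * Real.log (Fintype.card W)))
        + T.err K s v * (Real.log (Fintype.card W) + 1 / p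
          + D / C * (Real.log (Fintype.card W) / δ)) := by
  have hDC : 0 ≤ D / C := div_nonneg hDnn hC.le
  have hM1 : (1 : ℝ) ≤ Fintype.card W := by exact_mod_cast Fintype.card_pos
  have hlogM : 0 ≤ Real.log (Fintype.card W) := Real.log_nonneg hM1
  have hlog2 : 0 ≤ Real.log 2 := Real.log_nonneg one_le_two
  have hlδ : 0 < l * δ := mul_pos hl hδ
  induction T with
  | leaf d =>
    intro s v hv hun
    have hV := sum_pos_of_forall_pos hv
    have h1 := le_likelihoodPotential hv d hp
    have h2 := likelihoodPotential_le hv hlδ fun w => by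
      have := hun w
      have h3 : l * δ * ∑ i, v i ≤ δ * ∑ i, v i :=
        mul_le_mul_of_nonneg_right (mul_le_of_le_one_left hδ.le hl1) hV.le
      linarith
    have h3 := entropyPotential_le_card hv
    -- A leaf reached without any concentration has error mass at least `δ` times its total mass.
    -- All of the remaining entropy is therefore charged to the error term.
    have he : δ * ∑ i, v i ≤ ∑ i, v i - v d := by have := hun d; linarith
    have h4 : (∑ i, v i) * Real.log (Fintype.card W)
        ≤ (∑ i, v i - v d) * (Real.log (Fintype.card W) / δ) := by
      rw [← mul_div_assoc, le_div_iff₀ hδ]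
      nlinarith
    have h5 : entropyPotential v - (∑ w, v w) * hc s
        ≤ (∑ i, v i - v d) * (Real.log (Fintype.card W) / δ) := by
      have := mul_nonneg hV.le (hc0 s)
      linarith
    have h6 := mul_le_mul_of_nonneg_left h5 hDC
    have h7 : 0 ≤ (∑ w, v w) * (B + D / C * (Real.log 2 + δ * Real.log (Fintype.card W))) := by
      have hB0 : 0 ≤ B := (hD0 s).trans (hB s)
      positivity
    simp only [time, err, mul_zero, zero_add]
    linarith
  | node x c ih =>
    intro s v hv hun
    have hV := sum_pos_of_forall_pos hv
    have hchild : ∀ o, (∑ w, K.post s x v o w) * (Real.log (1 / p) - Real.log 2)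
        + D / C * (entropyPotential (K.post s x v o) - (∑ w, K.post s x v o w) * hc o.1) ≤
        D * (c o).time K o.1 (K.post s x v o) + (∑ w, K.post s x v o w) *
          (Real.log (1 / (l * δ)) + B + D / C * (Real.log 2 + δ * Real.log (Fintype.card W)))
        + (c o).err K o.1 (K.post s x v o) * (Real.log (Fintype.card W) + 1 / p
          + D / C * (Real.log (Fintype.card W) / δ)) := by
      intro o
      rcases MarkovChannel.post_eq_zero_or_pos hK s x v o with h0 | hpos
      · have := time_err_zero (K := K) (c o) o.1 h0
        simp [this.1, this.2, h0, entropyPotential]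
      have hv' : ∀ w, 0 < K.post s x v o w := fun w => mul_pos (hv w) (hpos w)
      -- Either the child is still unconcentrated and the induction goes on, or this step is the
      -- first crossing of the level 1 - δ and the pure log-odds bound takes over.
      by_cases hun' : ∀ w, K.post s x v o w ≤ (1 - δ) * ∑ i, K.post s x v o i
      · exact ih o o.1 hv' hun'
      push Not at hun'
      obtain ⟨d, hd⟩ := hun'
      have h1 := le_time_of_likelihood hK hD0 hopt hp (c o) o.1 hv'
      have hV' := sum_pos_of_forall_pos hv'
      -- Before the step the competitors of `w` held at least the fraction `δ`, and one step shrinks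
      -- no weight by more than the factor `l`. So the odds cannot have overshot 1/(lδ).
      have h2 := likelihoodPotential_le hv' hlδ fun w => by
        have e1 : l * ∑ i, v i - l * v w ≤ ∑ i, K.post s x v o i - K.post s x v o w := by
          classical
          rw [← Finset.add_sum_erase _ _ (Finset.mem_univ w),
            ← Finset.add_sum_erase (a := w) _ (fun i => K.post s x v o i) (Finset.mem_univ w),
            mul_add, add_sub_cancel_left, add_sub_cancel_left, Finset.mul_sum]
          refine Finset.sum_le_sum fun i _ => ?_
          rw [MarkovChannel.post, mul_comm]
          exact mul_le_mul_of_nonneg_left (hpl _ _ _ (hpos i).ne') (hv i).le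
        have e2 : ∑ i, K.post s x v o i ≤ ∑ i, v i :=
          Finset.sum_le_sum fun i _ => mul_le_of_le_one_right (hv i).le (K.p_le_one _ _ _)
        have e3 := mul_le_mul_of_nonneg_left (hun w) hl.le
        have e4 := mul_le_mul_of_nonneg_left e2 hlδ.le
        linarith
      -- At the crossing Fano's inequality shows that almost all of the entropy has been spent.
      have h3 := entropyPotential_le_fano hv' d
      have h4 : (∑ i, K.post s x v o i - K.post s x v o d) * Real.log (Fintype.card W)
          ≤ (∑ i, K.post s x v o i) * (δ * Real.log (Fintype.card W)) := by
        rw [← mul_assoc]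
        exact mul_le_mul_of_nonneg_right (by linarith) hlogM
      have h5 : entropyPotential (K.post s x v o) - (∑ w, K.post s x v o w) * hc o.1
          ≤ (∑ w, K.post s x v o w) * (Real.log 2 + δ * Real.log (Fintype.card W)) := by
        have := mul_nonneg hV'.le (hc0 o.1)
        linarith
      have h6 := mul_le_mul_of_nonneg_left h5 hDC
      have h7 := mul_le_mul_of_nonneg_left (hB o.1) hV'.le
      have h8 : 0 ≤ (c o).err K o.1 (K.post s x v o) * (D / C * (Real.log (Fintype.card W) / δ)) :=
        mul_nonneg (err_nonneg _ _ fun w => (hv' w).le) (by positivity)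
      linarith
    have hsum := Finset.sum_le_sum fun o (_ : o ∈ Finset.univ) => hchild o
    simp only [Finset.sum_add_distrib, ← Finset.sum_mul, ← Finset.mul_sum,
      Finset.sum_sub_distrib, MarkovChannel.sum_sum_post] at hsum
    have hstep := MarkovChannel.entropyPotential_step hcopt s x hv
    have h1 := mul_le_mul_of_nonneg_left hstep hDC
    -- With the weight D/C an entropy drop at rate `C` costs exactly `D` per channel use, the price
    -- of time in the claim.
    have h2 : D / C * ((∑ w, v w) * (C + hc s)) = (∑ w, v w) * D + D / C * ((∑ w, v w) * hc s) := by
      field_simp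
    simp only [time, err]
    linarith

end DecisionTree

/-! ### Histories of a transmission and the decision tree of a scheme. -/

section Aux

lemma comap_top_le_comap_top {Ω α β : Type*} {f : Ω → α} {g : Ω → β}
    (h : ∀ ω ω', g ω = g ω' → f ω = f ω') :
    MeasurableSpace.comap f ⊤ ≤ MeasurableSpace.comap g ⊤ := by
  rintro _ ⟨B, -, rfl⟩
  refine ⟨g '' (f ⁻¹' B), trivial, ?_⟩
  ext ω
  constructor
  · rintro ⟨ω', hω', he⟩
    show f ω ∈ B
    rw [← h _ _ he]; exact hω'
  · exact fun hω => ⟨ω, hω, rfl⟩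

lemma measureReal_eq_sum_fiber {Ω ι : Type*} [Fintype ι] {m : MeasurableSpace Ω} (μ : Measure Ω)
    [IsFiniteMeasure μ] {f : Ω → ι} (hf : ∀ i, MeasurableSet {ω | f ω = i}) (A : Set Ω) :
    μ.real A = ∑ i, μ.real (A ∩ {ω | f ω = i}) := by
  have h := sum_measureReal_preimage_singleton (μ := μ.restrict A) (f := f) Finset.univ
    fun i _ => hf i
  simp only [Finset.coe_univ, Set.preimage_univ, measureReal_restrict_apply_univ] at h
  rw [← h]
  refine Finset.sum_congr rfl fun i _ => ?_
  exact (measureReal_restrict_apply (hf i)).trans (by rw [Set.inter_comm])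

/-- The state reached after a list of outcomes. -/
def lastState {S Y : Type*} (s : S) (l : List (S × Y)) : S := l.foldl (fun _ o => o.1) s

@[simp] lemma lastState_nil {S Y : Type*} (s : S) : lastState s ([] : List (S × Y)) = s := rfl

@[simp] lemma lastState_cons {S Y : Type*} (s : S) (o : S × Y) (l : List (S × Y)) :
    lastState s (o :: l) = lastState o.1 l := rfl

@[simp] lemma lastState_append {S Y : Type*} (s : S) (l l' : List (S × Y)) :
    lastState s (l ++ l') = lastState (lastState s l) l' := List.foldl_append

end Aux

/-- The encoder in terms of the initial state and the list of past outcomes. -/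
def CausalEncoder.enc {S X Y : Type*} (Φ : CausalEncoder S X Y) (w : Φ.Msg) (s : S)
    (l : List (S × Y)) : X :=
  Φ.φ l.length w (fun i => (l.get i).2) (Fin.cons s fun i => (l.get i).1)

lemma CausalEncoder.φ_eq_enc {S X Y : Type*} (Φ : CausalEncoder S X Y) (w : Φ.Msg) {t : ℕ}
    (y : Fin t → Y) (s : Fin (t + 1) → S) {l : List (S × Y)} (hl : l.length = t)
    (h : ∀ i : Fin t, l.get (i.cast hl.symm) = (s i.succ, y i)) :
    Φ.φ t w y s = Φ.enc w (s 0) l := by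
  subst hl
  rw [CausalEncoder.enc]
  congr 1
  · ext i
    rw [show l.get i = _ from h i]
  · refine funext fun i => ?_
    refine Fin.cases rfl (fun i => ?_) i
    rw [Fin.cons_succ, show l.get i = _ from h i]

namespace Transmission

variable {S X Y : Type*} {K : MarkovChannel S X Y} {Φ : CausalEncoder S X Y}
  {Ω : Type*} [m : MeasurableSpace Ω] {Pr : Measure Ω} (τ : Transmission K Φ Pr)

/-- The list of the first `t` outcomes. -/
def hist (t : ℕ) (ω : Ω) : List (S × Y) :=
  (List.range t).map fun i => (τ.state (i + 1) ω, τ.output i ω)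

@[simp] lemma length_hist (t : ℕ) (ω : Ω) : (τ.hist t ω).length = t := by simp [hist]

lemma hist_succ (t : ℕ) (ω : Ω) :
    τ.hist (t + 1) ω = τ.hist t ω ++ [(τ.state (t + 1) ω, τ.output t ω)] := by
  simp [hist, List.range_succ]

lemma hist_eq_iff {t : ℕ} {ω ω' : Ω} : τ.hist t ω = τ.hist t ω' ↔
    ∀ i < t, τ.state (i + 1) ω = τ.state (i + 1) ω' ∧ τ.output i ω = τ.output i ω' := by
  simp [hist, List.map_inj_left]

lemma lastState_hist (t : ℕ) (ω : Ω) : lastState (τ.state 0 ω) (τ.hist t ω) = τ.state t ω := by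
  cases t with
  | zero => rfl
  | succ t => simp [hist_succ]

lemma φ_eq_enc_hist (w : Φ.Msg) (t : ℕ) (ω : Ω) :
    Φ.φ t w (fun i => τ.output i ω) (fun i => τ.state i ω)
      = Φ.enc w (τ.state 0 ω) (τ.hist t ω) := by
  refine Φ.φ_eq_enc w _ _ (τ.length_hist t ω) fun i => ?_
  simp only [hist, List.get_eq_getElem, List.getElem_map, List.getElem_range]
  rfl

/-- The event that the initial state is `s` and the first outcomes are `l`. -/
def histEvent (s : S) (l : List (S × Y)) : Set Ω := {ω | τ.state 0 ω = s ∧ τ.hist l.length ω = l}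

lemma histEvent_append (s : S) (l : List (S × Y)) (o : S × Y) :
    τ.histEvent s (l ++ [o]) = τ.histEvent s l ∩
      {ω | (τ.state (l.length + 1) ω, τ.output l.length ω) = o} := by
  ext ω
  simp only [histEvent, List.length_append, List.length_singleton, hist_succ, Set.mem_ofPred_eq,
    Set.mem_inter_iff, and_assoc]
  refine and_congr_right fun _ => ⟨fun h => ?_, fun ⟨h, h'⟩ => by rw [h, h']⟩
  exact (List.append_inj' h rfl).imp id List.singleton_inj.1

/-- The probability of a message and a sequence of outcomes. -/
noncomputable def nodeProb (s : S) (l : List (S × Y)) (w : Φ.Msg) : ℝ :=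
  Pr.real (τ.histEvent s l ∩ {ω | τ.msg ω = w})

lemma nodeProb_nonneg (s : S) (l : List (S × Y)) (w : Φ.Msg) : 0 ≤ τ.nodeProb s l w :=
  measureReal_nonneg

lemma nodeProb_nil (s : S) (w : Φ.Msg) :
    τ.nodeProb s [] w = (K.init s).toReal / Fintype.card Φ.Msg := by
  have : τ.histEvent s [] ∩ {ω | τ.msg ω = w} = {ω | τ.msg ω = w ∧ τ.state 0 ω = s} := by
    ext ω; simp [histEvent, hist, and_comm]
  rw [nodeProb, this, Measure.real, τ.law_state_zero, τ.law_msg, ENNReal.toReal_mul,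
    ENNReal.toReal_inv, ENNReal.toReal_natCast]
  ring

/-- Given the message and the past outcomes the inputs are almost surely determined by the encoder,
so the conditioning on inputs in `law_step` changes the event by a null set only. -/
lemma nodeProb_append (s : S) (l : List (S × Y)) (o : S × Y) (w : Φ.Msg) :
    τ.nodeProb s (l ++ [o]) w
      = τ.nodeProb s l w * K.p (lastState s l) (Φ.enc w s l) o := by
  -- If some sample point realizes the node, it supplies the concrete sequences of states, inputs
  -- and outputs required by `law_step`; otherwise both sides vanish.
  by_cases hne : ∃ ω₀, ω₀ ∈ τ.histEvent s l ∩ {ω | τ.msg ω = w}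
  swap
  · have h0 : τ.histEvent s l ∩ {ω | τ.msg ω = w} = ∅ :=
      Set.eq_empty_iff_forall_notMem.2 fun ω hω => hne ⟨ω, hω⟩
    have h1 : τ.histEvent s (l ++ [o]) ∩ {ω | τ.msg ω = w} = ∅ := by
      rw [histEvent_append, Set.inter_right_comm, h0, Set.empty_inter]
    rw [nodeProb, nodeProb, h0, h1]
    simp
  obtain ⟨ω₀, ⟨hs, hl⟩, -⟩ := hne
  set t := l.length with ht
  let x : Fin (t + 1) → X := fun i =>
    Φ.φ i w (fun j => τ.output j ω₀) (fun j => τ.state j ω₀)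
  have hstep := τ.law_step t w (fun i => τ.state i ω₀) x (fun i => τ.output i ω₀) o.1 o.2
  have hin : ∀ᵐ ω ∂Pr, ∀ i, τ.input i ω =
      Φ.φ i (τ.msg ω) (fun j => τ.output j ω) (fun j => τ.state j ω) :=
    ae_all_iff.2 fun i => τ.law_input i
  have hiff : ∀ ω, (τ.state 0 ω = s ∧ τ.hist t ω = l) ↔
      (∀ i : Fin (t + 1), τ.state i ω = τ.state i ω₀) ∧
        ∀ i : Fin t, τ.output i ω = τ.output i ω₀ := by
    intro ω
    rw [← hl, ← hs, hist_eq_iff]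
    constructor
    · rintro ⟨h0, h1⟩
      refine ⟨fun i => Fin.cases h0 (fun i => ?_) i, fun i => (h1 i i.2).2⟩
      simpa using (h1 i i.2).1
    · rintro ⟨h0, h1⟩
      exact ⟨h0 0, fun i hi => ⟨h0 ⟨i + 1, by omega⟩, h1 ⟨i, hi⟩⟩⟩
  have hae : (τ.histEvent s l ∩ {ω | τ.msg ω = w} : Set Ω) =ᵐ[Pr] {ω | τ.msg ω = w ∧
      (∀ i : Fin (t + 1), τ.state i ω = τ.state i ω₀) ∧
      (∀ i : Fin (t + 1), τ.input i ω = x i) ∧ ∀ i : Fin t, τ.output i ω = τ.output i ω₀} := by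
    rw [Filter.eventuallyEq_set]
    filter_upwards [hin] with ω hω
    simp only [histEvent, ← ht, Set.mem_inter_iff, Set.mem_ofPred_eq, hiff]
    constructor
    · rintro ⟨⟨h1, h2⟩, h3⟩
      refine ⟨h3, h1, fun i => ?_, h2⟩
      rw [hω i, h3]
      simp only [x]
      congr 1
      · exact funext fun j => h2 ⟨j, by omega⟩
      · exact funext fun j => h1 ⟨j, by omega⟩
    · rintro ⟨h3, h1, -, h2⟩
      exact ⟨⟨h1, h2⟩, h3⟩
  have hae' : (τ.histEvent s (l ++ [o]) ∩ {ω | τ.msg ω = w} : Set Ω) =ᵐ[Pr]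
      {ω | (τ.msg ω = w ∧ (∀ i : Fin (t + 1), τ.state i ω = τ.state i ω₀) ∧
      (∀ i : Fin (t + 1), τ.input i ω = x i) ∧ ∀ i : Fin t, τ.output i ω = τ.output i ω₀) ∧
      τ.state (t + 1) ω = o.1 ∧ τ.output t ω = o.2} := by
    rw [histEvent_append, Set.inter_right_comm]
    refine (hae.inter (ae_eq_refl _)).trans (Filter.EventuallyEq.of_eq ?_)
    refine Set.ext fun ω => ?_
    simp only [Set.mem_inter_iff, Set.mem_ofPred_eq, Prod.ext_iff, ← ht]
  rw [nodeProb, nodeProb, measureReal_congr hae, measureReal_congr hae', Measure.real, hstep,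
    ENNReal.toReal_mul]
  congr 1
  rw [MarkovChannel.p]
  have e1 : τ.state (Fin.last t : Fin (t + 1)) ω₀ = lastState s l := by
    rw [← hl, ← hs, lastState_hist]; rfl
  have e2 : x (Fin.last t) = Φ.enc w s l := by
    rw [← hl, ← hs, ← φ_eq_enc_hist]; rfl
  rw [e1, e2]

lemma measurableSet_msg (w : Φ.Msg) : MeasurableSet {ω | τ.msg ω = w} :=
  τ.measurable_msg (show MeasurableSet[⊤] {w} from trivial)

lemma measurableSet_outcome (t : ℕ) (o : S × Y) :
    MeasurableSet {ω | (τ.state (t + 1) ω, τ.output t ω) = o} := by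
  simp only [Prod.ext_iff, Set.ofPred_and]
  exact ((τ.measurable_state (t + 1)) (show MeasurableSet[⊤] {o.1} from trivial)).inter
    ((τ.measurable_output t) (show MeasurableSet[⊤] {o.2} from trivial))

lemma sum_nodeProb (s : S) (l : List (S × Y)) :
    ∑ w, τ.nodeProb s l w = Pr.real (τ.histEvent s l) :=
  have := τ.isProb
  (measureReal_eq_sum_fiber Pr (f := τ.msg) τ.measurableSet_msg _).symm

lemma nonempty_msg (τ : Transmission K Φ Pr) : Nonempty Φ.Msg :=
  have := τ.isProb
  (nonempty_of_isProbabilityMeasure Pr).map τ.msg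

lemma sum_histEvent_append [Fintype S] [Fintype Y] (s : S) (l : List (S × Y)) (A : Set Ω) :
    ∑ o, Pr.real (τ.histEvent s (l ++ [o]) ∩ A) = Pr.real (τ.histEvent s l ∩ A) := by
  have := τ.isProb
  rw [measureReal_eq_sum_fiber Pr (τ.measurableSet_outcome l.length) (τ.histEvent s l ∩ A)]
  refine Finset.sum_congr rfl fun o _ => ?_
  rw [histEvent_append, Set.inter_right_comm]

lemma sum_histEvent_nil [Fintype S] (A : Set Ω) :
    ∑ s, Pr.real (τ.histEvent s [] ∩ A) = Pr.real A := by
  have := τ.isProb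
  rw [measureReal_eq_sum_fiber Pr (f := τ.state 0)
    (fun s => (τ.measurable_state 0) (show MeasurableSet[⊤] {s} from trivial)) A]
  refine Finset.sum_congr rfl fun s _ => ?_
  rw [Set.inter_comm]
  congr 1
  ext ω; simp [histEvent, hist]

/-- Events known to the receiver depend on the outcomes only. -/
lemma mem_iff_of_measurableSet {t : ℕ} {A : Set Ω} (hA : MeasurableSet[τ.receiverFiltration t] A)
    {ω ω' : Ω} (h0 : τ.state 0 ω = τ.state 0 ω') (h : τ.hist t ω = τ.hist t ω') :
    ω ∈ A ↔ ω' ∈ A := by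
  -- The filtration at time `t` sees the states before `t` only, whereas `hist t` also contains the
  -- state at time `t`; an inclusion is all that is needed.
  have hle : (τ.receiverFiltration t : MeasurableSpace Ω) ≤
      MeasurableSpace.comap (fun ω => (τ.state 0 ω, τ.hist t ω)) ⊤ := by
    refine iSup_le fun i => iSup_le fun hi => sup_le ?_ ?_
    · refine comap_top_le_comap_top fun a b hab => ?_
      rw [Prod.mk.injEq, hist_eq_iff] at hab
      cases i with
      | zero => exact hab.1
      | succ i => exact (hab.2 i (by omega)).1
    · refine comap_top_le_comap_top fun a b hab => ?_
      rw [Prod.mk.injEq, hist_eq_iff] at hab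
      exact (hab.2 i hi).2
  obtain ⟨B, -, rfl⟩ := hle _ hA
  simp only [Set.mem_preimage, h0, h]

section Tree

variable {T : Ω → ℕ∞} {Ψ : Ω → Φ.Msg}

lemma stop_iff (hT : IsStoppingTime τ.receiverFiltration T) {s : S} {l : List (S × Y)} {ω ω' : Ω}
    (hω : ω ∈ τ.histEvent s l) (hω' : ω' ∈ τ.histEvent s l) :
    T ω ≤ l.length ↔ T ω' ≤ l.length :=
  τ.mem_iff_of_measurableSet (hT l.length) (hω.1.trans hω'.1.symm) (hω.2.trans hω'.2.symm)

lemma decision_eq (hT : IsStoppingTime τ.receiverFiltration T)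
    (hΨ : Measurable[hT.measurableSpace, ⊤] Ψ) {s : S} {l : List (S × Y)} {ω ω' : Ω}
    (hω : ω ∈ τ.histEvent s l) (hω' : ω' ∈ τ.histEvent s l) (h : T ω ≤ l.length) :
    Ψ ω' = Ψ ω := by
  have hm : MeasurableSet[hT.measurableSpace] (Ψ ⁻¹' {Ψ ω}) := hΨ trivial
  exact ((τ.mem_iff_of_measurableSet (hm.2 l.length) (hω.1.trans hω'.1.symm)
    (hω.2.trans hω'.2.symm)).1 ⟨rfl, h⟩).1

open Classical in
/-- The decision tree of a scheme that is stopped after `n` more channel uses. -/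
noncomputable def tree (T : Ω → ℕ∞) (Ψ : Ω → Φ.Msg) (w₀ : Φ.Msg) (s : S) :
    ℕ → List (S × Y) → DecisionTree Φ.Msg X (S × Y)
  | 0, l => if h : ∃ ω, ω ∈ τ.histEvent s l ∧ T ω ≤ l.length then .leaf (Ψ h.choose) else .leaf w₀
  | n + 1, l => if h : ∃ ω, ω ∈ τ.histEvent s l ∧ T ω ≤ l.length then .leaf (Ψ h.choose)
      else .node (fun w => Φ.enc w s l) fun o => tree T Ψ w₀ s n (l ++ [o])

variable [Fintype S] [Fintype X] [Fintype Y]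

lemma post_nodeProb (s : S) (l : List (S × Y)) (o : S × Y) :
    K.post (lastState s l) (fun w => Φ.enc w s l) (τ.nodeProb s l) o
      = τ.nodeProb s (l ++ [o]) := by
  ext w
  rw [MarkovChannel.post, nodeProb_append]

/-- Whether the scheme has stopped is constant on a node. A stopped node contributes to no tail, and
at a running node the tail event with `j = 0` is the whole node, whose mass is what the tree counts.
-/
lemma time_tree (hT : IsStoppingTime τ.receiverFiltration T) (Ψ : Ω → Φ.Msg) (w₀ : Φ.Msg)
    (s : S) (n : ℕ) :
    ∀ l : List (S × Y), (τ.tree T Ψ w₀ s n l).time K (lastState s l) (τ.nodeProb s l)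
      = ∑ j ∈ Finset.range n, Pr.real (τ.histEvent s l ∩ {ω | ((l.length + j : ℕ) : ℕ∞) < T ω}) := by
  induction n with
  | zero =>
    intro l
    rw [tree]
    split_ifs <;> simp [DecisionTree.time]
  | succ n ih =>
    intro l
    rw [tree]
    split_ifs with h
    · obtain ⟨ω, hω, hTω⟩ := h
      simp only [DecisionTree.time]
      refine (Finset.sum_eq_zero fun j _ => ?_).symm
      rw [show τ.histEvent s l ∩ {ω | ((l.length + j : ℕ) : ℕ∞) < T ω} = ∅ from ?_,
        measureReal_empty]
      refine Set.eq_empty_iff_forall_notMem.2 fun ω' hω' => ?_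
      have h1 := (τ.stop_iff hT hω hω'.1).1 hTω
      have h2 : ((l.length + j : ℕ) : ℕ∞) < T ω' := hω'.2
      exact absurd (h2.trans_le h1) (by simp)
    · simp only [not_exists, not_and, not_le] at h
      simp only [DecisionTree.time, post_nodeProb, sum_nodeProb]
      have e : ∀ o : S × Y, o.1 = lastState s (l ++ [o]) := fun o => by simp
      have h1 : ∀ o : S × Y, (τ.tree T Ψ w₀ s n (l ++ [o])).time K o.1 (τ.nodeProb s (l ++ [o]))
          = ∑ j ∈ Finset.range n, Pr.real (τ.histEvent s (l ++ [o]) ∩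
            {ω | ((l.length + (j + 1) : ℕ) : ℕ∞) < T ω}) := by
        intro o
        have := ih (l ++ [o])
        rw [← e] at this
        rw [this]
        refine Finset.sum_congr rfl fun j _ => ?_
        simp only [List.length_append, List.length_singleton]
        rw [show l.length + 1 + j = l.length + (j + 1) by ring]
      simp only [h1]
      rw [Finset.sum_comm, Finset.sum_range_succ', add_comm]
      congr 1
      · exact Finset.sum_congr rfl fun j _ => τ.sum_histEvent_append s l _
      · congr 1
        ext ω
        simp only [Set.mem_inter_iff, Set.mem_ofPred_eq, iff_self_and, add_zero]
        exact h ω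

/-- At a stopped node the tree decides as the scheme does. A branch still running at the horizon
gets an arbitrary decision, and its mass is covered by the event that `T` exceeds the horizon. -/
lemma err_tree_le (hT : IsStoppingTime τ.receiverFiltration T)
    (hΨ : Measurable[hT.measurableSpace, ⊤] Ψ) (w₀ : Φ.Msg) (s : S) (n : ℕ) :
    ∀ l : List (S × Y), (τ.tree T Ψ w₀ s n l).err K (lastState s l) (τ.nodeProb s l)
      ≤ Pr.real (τ.histEvent s l ∩
        ({ω | Ψ ω ≠ τ.msg ω} ∪ {ω | ((l.length + n : ℕ) : ℕ∞) < T ω})) := by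
  have := τ.isProb
  have hleaf : ∀ (l : List (S × Y)) (n : ℕ) (ω : Ω), ω ∈ τ.histEvent s l → T ω ≤ l.length →
      (DecisionTree.leaf (Ψ ω)).err K (lastState s l) (τ.nodeProb s l)
      ≤ Pr.real (τ.histEvent s l ∩
        ({ω | Ψ ω ≠ τ.msg ω} ∪ {ω | ((l.length + n : ℕ) : ℕ∞) < T ω})) := by
    intro l n ω hω hTω
    rw [DecisionTree.err, sum_nodeProb, nodeProb, sub_le_iff_le_add]
    refine (measureReal_mono ?_).trans (measureReal_union_le _ _)
    intro ω' hω'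
    by_cases hm : τ.msg ω' = Ψ ω
    · exact Or.inr ⟨hω', hm⟩
    · refine Or.inl ⟨hω', Or.inl ?_⟩
      show Ψ ω' ≠ _
      rw [τ.decision_eq hT hΨ hω hω' hTω]
      exact Ne.symm hm
  induction n with
  | zero =>
    intro l
    rw [tree]
    split_ifs with h
    · exact hleaf l 0 _ h.choose_spec.1 h.choose_spec.2
    · simp only [not_exists, not_and, not_le] at h
      rw [DecisionTree.err, sum_nodeProb]
      refine (sub_le_self _ (τ.nodeProb_nonneg _ _ _)).trans (measureReal_mono ?_)
      exact fun ω hω => ⟨hω, Or.inr (h ω hω)⟩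
  | succ n ih =>
    intro l
    rw [tree]
    split_ifs with h
    · exact hleaf l _ _ h.choose_spec.1 h.choose_spec.2
    · simp only [DecisionTree.err, post_nodeProb]
      rw [← sum_histEvent_append]
      refine Finset.sum_le_sum fun o _ => ?_
      have := ih (l ++ [o])
      rw [lastState_append, lastState_cons, lastState_nil] at this
      refine this.trans (le_of_eq ?_)
      simp only [List.length_append, List.length_singleton]
      rw [show l.length + 1 + n = l.length + (n + 1) by ring]

end Tree

end Transmission

/-! ### The nonasymptotic converse and its limit. -/

section TailSum

variable {Ω : Type*} [MeasurableSpace Ω] {Pr : Measure Ω} [IsProbabilityMeasure Pr] {T : Ω → ℕ∞}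

lemma sum_prob_lt_le (hT : ∀ n : ℕ, MeasurableSet {ω | (n : ℕ∞) < T ω})
    (hfin : ∫⁻ ω, (T ω : ℝ≥0∞) ∂Pr ≠ ∞) (N : ℕ) :
    ∑ j ∈ Finset.range N, Pr.real {ω | (j : ℕ∞) < T ω} ≤ (∫⁻ ω, (T ω : ℝ≥0∞) ∂Pr).toReal := by
  classical
  simp only [Measure.real]
  rw [← ENNReal.toReal_sum fun j _ => measure_ne_top _ _]
  refine ENNReal.toReal_mono hfin ?_
  calc ∑ j ∈ Finset.range N, Pr {ω | (j : ℕ∞) < T ω}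
      = ∑ j ∈ Finset.range N, ∫⁻ ω, {ω | (j : ℕ∞) < T ω}.indicator 1 ω ∂Pr :=
        Finset.sum_congr rfl fun j _ => (lintegral_indicator_one (hT j)).symm
    _ = ∫⁻ ω, ∑ j ∈ Finset.range N, {ω | (j : ℕ∞) < T ω}.indicator 1 ω ∂Pr :=
        (lintegral_finsetSum _ fun j _ => measurable_one.indicator (hT j)).symm
    _ ≤ ∫⁻ ω, (T ω : ℝ≥0∞) ∂Pr := by
        refine lintegral_mono fun ω => ?_
        simp only [Set.indicator_apply, Set.mem_ofPred_eq, Pi.one_apply, Finset.sum_boole]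
        cases hω : T ω with
        | top => simp
        | coe k =>
          have hsub : (Finset.range N).filter (fun j : ℕ => (j : ℕ∞) < (k : ℕ∞)) ⊆
              Finset.range k := by
            intro j hj
            rw [Finset.mem_range]
            exact_mod_cast (Finset.mem_filter.1 hj).2
          have := Finset.card_le_card hsub
          rw [Finset.card_range] at this
          simpa using (Nat.cast_le (α := ℝ≥0∞)).2 this

end TailSum

namespace MarkovChannel

variable {S X Y : Type*} [Fintype S] [Fintype Y] [Fintype X] {K : MarkovChannel S X Y}

/-- Mutual information is a mean divergence to a mixture, hence by concavity of log at most the mean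
divergence between pairs of inputs. It serves to show that the capacity does not exceed `D`. -/
lemma info_le_sum_dmax (hK : K.CommonSupport) (s : S) {u : X → ℝ} (hu0 : ∀ x, 0 ≤ u x)
    (hu1 : ∑ x, u x = 1) : K.info s u ≤ ∑ x, u x * K.dmax s x := by
  have hx : ∀ x, ∑ o, u x * K.p s x o * Real.log (K.p s x o / K.q s u o)
      ≤ u x * ∑ x', u x' * K.kl s x x' := by
    intro x
    simp only [kl, Finset.mul_sum]
    rw [Finset.sum_comm]
    refine Finset.sum_le_sum fun o _ => ?_
    by_cases hp : K.p s x o = 0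
    · simp [hp]
    have hpos : ∀ x', 0 < K.p s x' o := fun x' =>
      (K.p_nonneg _ _ _).lt_of_ne' fun h => hp (hK s x x' o h)
    have hJ := sum_mul_log_le_log_sum hu0 hu1 hpos
    have hq : 0 < K.q s u o := by
      have : ∃ x', 0 < u x' := by
        by_contra! h
        have : ∑ x, u x = 0 := Finset.sum_eq_zero fun x _ => le_antisymm (h x) (hu0 x)
        linarith
      obtain ⟨x', hx'⟩ := this
      exact (mul_pos hx' (hpos x')).trans_le (le_q hu0 s x' o)
    have e : ∑ x', u x * (u x' * (K.p s x o * Real.log (K.p s x o / K.p s x' o)))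
        = u x * K.p s x o * (Real.log (K.p s x o) - ∑ x', u x' * Real.log (K.p s x' o)) := by
      have : ∀ x', u x * (u x' * (K.p s x o * Real.log (K.p s x o / K.p s x' o)))
          = u x * K.p s x o * (u x' * Real.log (K.p s x o) - u x' * Real.log (K.p s x' o)) := by
        intro x'
        rw [Real.log_div hp (hpos x').ne']; ring
      simp only [this, ← Finset.mul_sum, Finset.sum_sub_distrib, ← Finset.sum_mul, hu1, one_mul]
    rw [e, Real.log_div hp hq.ne']
    exact mul_le_mul_of_nonneg_left (sub_le_sub_left hJ _)
      (mul_nonneg (hu0 x) (K.p_nonneg _ _ _))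
  refine (Finset.sum_le_sum fun x _ => hx x).trans (Finset.sum_le_sum fun x _ =>
    mul_le_mul_of_nonneg_left ?_ (hu0 x))
  calc ∑ x', u x' * K.kl s x x' ≤ ∑ x', u x' * K.dmax s x :=
        Finset.sum_le_sum fun x' _ => mul_le_mul_of_nonneg_left (kl_le_dmax _ _ _) (hu0 x')
    _ = K.dmax s x := by rw [← Finset.sum_mul, hu1, one_mul]

lemma exists_pos_le_p (K : MarkovChannel S X Y) :
    ∃ l : ℝ, 0 < l ∧ l ≤ 1 ∧ ∀ s x o, K.p s x o ≠ 0 → l ≤ K.p s x o := by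
  classical
  rcases isEmpty_or_nonempty (S × X × (S × Y)) with h | h
  · exact ⟨1, one_pos, le_rfl, fun s x o => (h.false (s, x, o)).elim⟩
  obtain ⟨z, hz⟩ := Finite.exists_min fun z : S × X × (S × Y) =>
    if K.p z.1 z.2.1 z.2.2 = 0 then 1 else K.p z.1 z.2.1 z.2.2
  refine ⟨if K.p z.1 z.2.1 z.2.2 = 0 then 1 else K.p z.1 z.2.1 z.2.2, ?_, ?_, fun s x o ho => ?_⟩
  · split_ifs with h
    · exact one_pos
    · exact (K.p_nonneg _ _ _).lt_of_ne' h
  · split_ifs with h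
    · exact le_rfl
    · exact K.p_le_one _ _ _
  · have := hz (s, x, o)
    simpa only [if_neg ho] using this

lemma sum_p_mul_add (s : S) (x : X) (h : S → ℝ) (c : ℝ) :
    ∑ o, K.p s x o * (h o.1 + c) = ∑ o, K.p s x o * h o.1 + c := by
  simp only [mul_add, Finset.sum_add_distrib, ← Finset.sum_mul, K.sum_p, one_mul]

/-- Relative value functions matter up to constants only, so they may be taken nonnegative and
bounded. -/
lemma exists_shift_nonneg (h : S → ℝ) : ∃ c B : ℝ, ∀ s, 0 ≤ h s + c ∧ h s + c ≤ B := by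
  refine ⟨∑ s, |h s|, ∑ s, |h s| + ∑ s, |h s|, fun s => ?_⟩
  have h1 : |h s| ≤ ∑ s, |h s| :=
    Finset.single_le_sum (f := fun s => |h s|) (fun _ _ => abs_nonneg _) (Finset.mem_univ s)
  have h2 := abs_le.1 h1
  constructor <;> linarith

/-- The nonasymptotic converse. -/
lemma Ergodic.converse_bound [Nonempty X] (hE : K.Ergodic) (hK : K.CommonSupport)
    (hC : 0 < K.capacity) :
    ∃ D : ℝ, K.capacity ≤ D ∧ K.burnashevCoeff = ENNReal.ofReal D ∧ ∀ δ : ℝ, 0 < δ → δ ≤ 1 / 2 →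
      ∃ κ : ℝ, ∀ 𝒮 : CodingScheme K, Nontrivial 𝒮.encoder.Msg → 𝒮.expectedTime ≠ ∞ →
        ∀ p : ℝ, 0 < p → 𝒮.errorProb < ENNReal.ofReal p →
        Real.log (1 / p) + (D / K.capacity * (1 - δ - p / δ) - p)
            * Real.log (Fintype.card 𝒮.encoder.Msg)
          ≤ D * 𝒮.expectedTime.toReal + κ := by
  classical
  have := K.nonempty_state
  obtain ⟨f, hD', D, hD0, hDeq, hDpoi, hDopt'⟩ := hE.burnashevCoeff_eq hK
  obtain ⟨π, hc', hπ0, hπ1, hcpoi, hcopt'⟩ := hE.exists_optimal_policy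
  obtain ⟨c1, B1, hB1⟩ := exists_shift_nonneg hD'
  obtain ⟨c2, B2, hB2⟩ := exists_shift_nonneg hc'
  set hD : S → ℝ := fun s => hD' s + c1 with hDdef
  set hc : S → ℝ := fun s => hc' s + c2 with hcdef
  have hDopt : ∀ s x, K.dmax s x + ∑ o, K.p s x o * hD o.1 ≤ D + hD s := by
    intro s x
    simp only [hDdef, sum_p_mul_add]
    linarith [hDopt' s x]
  have hcopt : ∀ s (u : X → ℝ), (∀ x, 0 ≤ u x) → ∑ x, u x = 1 →
        K.info s u + ∑ x, u x * ∑ o, K.p s x o * hc o.1 ≤ K.capacity + hc s := by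
    intro s u hu0 hu1
    simp only [hcdef, sum_p_mul_add]
    simp only [mul_add, Finset.sum_add_distrib, ← Finset.sum_mul, hu1, one_mul]
    linarith [hcopt' s u hu0 hu1]
  have hCD : K.capacity ≤ D := by
    -- Maximum principle: where the difference of the two value functions is largest it cannot grow
    -- on average, and subtracting the two optimality relations there compares the constants.
    obtain ⟨s, hs⟩ := Finite.exists_max fun s => hc' s - hD' s
    have h1 := hcpoi s
    have h2 := info_le_sum_dmax hK s (hπ0 s) (hπ1 s)
    have h3 : ∑ x, π s x * (K.dmax s x + ∑ o, K.p s x o * hD' o.1)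
        ≤ ∑ x, π s x * (D + hD' s) :=
      Finset.sum_le_sum fun x _ => mul_le_mul_of_nonneg_left (hDopt' s x) (hπ0 s x)
    rw [← Finset.sum_mul, hπ1, one_mul] at h3
    simp only [mul_add, Finset.sum_add_distrib] at h3
    have h4 : ∑ x, π s x * ∑ o, K.p s x o * (hc' o.1 - hD' o.1) ≤ hc' s - hD' s := by
      calc ∑ x, π s x * ∑ o, K.p s x o * (hc' o.1 - hD' o.1)
          ≤ ∑ x, π s x * ∑ o, K.p s x o * (hc' s - hD' s) :=
            Finset.sum_le_sum fun x _ => mul_le_mul_of_nonneg_left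
              (Finset.sum_le_sum fun o _ =>
                mul_le_mul_of_nonneg_left (hs o.1) (K.p_nonneg _ _ _)) (hπ0 s x)
        _ = hc' s - hD' s := by simp only [← Finset.sum_mul, K.sum_p, hπ1, one_mul]
    simp only [mul_sub, Finset.sum_sub_distrib] at h4
    linarith
  obtain ⟨l, hl0, hl1, hpl⟩ := K.exists_pos_le_p
  refine ⟨D, hCD, hDeq, fun δ hδ hδ2 => ?_⟩
  set C := K.capacity with hCdef
  -- All terms that are not proportional to log M; the final 1 is the product of the error bound `p`
  -- with the slope 1/p of the tangent.
  refine ⟨Real.log 2 + D / C * B2 + Real.log (1 / (l * δ)) + B1 + D / C * Real.log 2 + 1,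
    fun 𝒮 hnt hfin p hp hpe => ?_⟩
  set τ := 𝒮.transmission
  have := τ.isProb
  set M : ℝ := ((Fintype.card 𝒮.encoder.Msg : ℕ) : ℝ) with hMdef
  have hM2 : 2 ≤ M := by
    have := Fintype.one_lt_card (α := 𝒮.encoder.Msg)
    rw [hMdef]; exact_mod_cast this
  have hTm : ∀ n : ℕ, MeasurableSet {ω | (n : ℕ∞) < 𝒮.T ω} := by
    intro n
    have h1 : MeasurableSet {ω | 𝒮.T ω ≤ (n : ℕ∞)} :=
      τ.receiverFiltration.le n _ (𝒮.isStoppingTime n)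
    convert h1.compl using 1
    ext ω
    simp
  set E := 𝒮.expectedTime.toReal with hEdef
  have hsum := sum_prob_lt_le (Pr := 𝒮.Pr) hTm hfin
  have hpe' : 𝒮.Pr.real {ω | 𝒮.Ψ ω ≠ τ.msg ω} < p :=
    (ENNReal.lt_ofReal_iff_toReal_lt (measure_ne_top _ _)).1 hpe
  -- The strict inequality between the error probability and `p` leaves room for the event that the
  -- horizon `N` is exceeded, whose probability is at most E/N by Markov's inequality.
  obtain ⟨N, hN⟩ : ∃ N : ℕ, 𝒮.Pr.real {ω | 𝒮.Ψ ω ≠ τ.msg ω}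
      + 𝒮.Pr.real {ω | (N : ℕ∞) < 𝒮.T ω} ≤ p := by
    obtain ⟨N, hN⟩ := exists_nat_gt (E / (p - 𝒮.Pr.real {ω | 𝒮.Ψ ω ≠ τ.msg ω}))
    refine ⟨N, ?_⟩
    have h0 : 0 < p - 𝒮.Pr.real {ω | 𝒮.Ψ ω ≠ τ.msg ω} := by linarith
    rw [div_lt_iff₀ h0] at hN
    by_contra! hcon
    have h1 : (N : ℝ) * 𝒮.Pr.real {ω | (N : ℕ∞) < 𝒮.T ω} ≤ E := by
      refine le_trans (le_of_eq ?_) ((Finset.sum_le_sum (s := Finset.range N)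
        (f := fun _ => 𝒮.Pr.real {ω | (N : ℕ∞) < 𝒮.T ω}) fun j hj => ?_).trans (hsum N))
      · simp
      · refine measureReal_mono fun ω hω => ?_
        have hjN : (j : ℕ∞) < (N : ℕ∞) := by exact_mod_cast Finset.mem_range.1 hj
        exact hjN.trans hω
    have hN0 : (0 : ℝ) ≤ N := Nat.cast_nonneg N
    have h2 := mul_le_mul_of_nonneg_left (show p - 𝒮.Pr.real {ω | 𝒮.Ψ ω ≠ τ.msg ω}
      ≤ 𝒮.Pr.real {ω | (N : ℕ∞) < 𝒮.T ω} by linarith) hN0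
    linarith
  let w₀ : 𝒮.encoder.Msg := Classical.arbitrary _
  have htime : ∑ s, (τ.tree 𝒮.T 𝒮.Ψ w₀ s N []).time K s (τ.nodeProb s []) ≤ E := by
    have h1 : ∀ s, (τ.tree 𝒮.T 𝒮.Ψ w₀ s N []).time K s (τ.nodeProb s [])
        = ∑ j ∈ Finset.range N, 𝒮.Pr.real (τ.histEvent s [] ∩ {ω | (j : ℕ∞) < 𝒮.T ω}) := by
      intro s
      simpa using τ.time_tree 𝒮.isStoppingTime 𝒮.Ψ w₀ s N []
    simp only [h1]
    rw [Finset.sum_comm]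
    simp only [τ.sum_histEvent_nil]
    exact hsum N
  have herr : ∑ s, (τ.tree 𝒮.T 𝒮.Ψ w₀ s N []).err K s (τ.nodeProb s []) ≤ p := by
    have h1 : ∀ s, (τ.tree 𝒮.T 𝒮.Ψ w₀ s N []).err K s (τ.nodeProb s [])
        ≤ 𝒮.Pr.real (τ.histEvent s [] ∩
          ({ω | 𝒮.Ψ ω ≠ τ.msg ω} ∪ {ω | (N : ℕ∞) < 𝒮.T ω})) := by
      intro s
      simpa using τ.err_tree_le 𝒮.isStoppingTime 𝒮.measurable_Ψ w₀ s N []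
    refine (Finset.sum_le_sum fun s _ => h1 s).trans ?_
    rw [τ.sum_histEvent_nil]
    exact (measureReal_union_le _ _).trans hN
  set κ₁ := Real.log (1 / (l * δ)) + B1 + D / C * (Real.log 2 + δ * Real.log M) with hκ₁
  set κ₂ := Real.log M + 1 / p + D / C * (Real.log M / δ) with hκ₂
  have hlogM : 0 ≤ Real.log M := Real.log_nonneg (by linarith)
  have hDC : 0 ≤ D / C := div_nonneg hD0 hC.le
  have hroot : ∀ s, (K.init s).toReal *
      (Real.log (1 / p) - Real.log 2 + D / C * (Real.log M - B2)) ≤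
      D * (τ.tree 𝒮.T 𝒮.Ψ w₀ s N []).time K s (τ.nodeProb s []) + (K.init s).toReal * κ₁
        + (τ.tree 𝒮.T 𝒮.Ψ w₀ s N []).err K s (τ.nodeProb s []) * κ₂ := by
    intro s
    have hM0 : 0 < M := by linarith
    by_cases hs : (K.init s).toReal = 0
    · have h0 : ∀ w, τ.nodeProb s [] w = 0 := fun w => by rw [τ.nodeProb_nil, hs, zero_div]
      have := DecisionTree.time_err_zero (K := K) (τ.tree 𝒮.T 𝒮.Ψ w₀ s N []) s h0
      simp [this.1, this.2, hs]
    have hs0 : 0 < (K.init s).toReal := ENNReal.toReal_nonneg.lt_of_ne' hs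
    have hv : ∀ w, 0 < τ.nodeProb s [] w := fun w => by
      rw [τ.nodeProb_nil]
      exact div_pos hs0 hM0
    have hVsum : ∑ w, τ.nodeProb s [] w = (K.init s).toReal := by
      simp only [τ.nodeProb_nil, Finset.sum_const, Finset.card_univ, nsmul_eq_mul]
      exact mul_div_cancel₀ _ hM0.ne'
    have hent : entropyPotential (τ.nodeProb s []) = (K.init s).toReal * Real.log M := by
      rw [entropyPotential, hVsum]
      have : ∀ w, (K.init s).toReal / τ.nodeProb s [] w = M := fun w => by
        rw [τ.nodeProb_nil, div_div_cancel₀ hs]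
      simp only [this, ← Finset.sum_mul, hVsum]
    -- The root is unconcentrated: each message has prior probability 1/M ≤ 1/2 ≤ 1 - δ.
    have hmain := DecisionTree.le_time_of_unconcentrated hK (fun s => (hB1 s).1) hDopt hC hD0
      (fun s => (hB2 s).1) hcopt hp hδ hl0 hl1 hpl (fun s => (hB1 s).2)
      (τ.tree 𝒮.T 𝒮.Ψ w₀ s N []) s hv (fun w => by
        rw [hVsum, τ.nodeProb_nil, div_eq_mul_inv, mul_comm]
        refine mul_le_mul_of_nonneg_right ?_ hs0.le
        have : M⁻¹ ≤ 2⁻¹ := inv_anti₀ two_pos hM2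
        linarith)
    rw [hVsum, hent] at hmain
    have h1 := mul_le_mul_of_nonneg_left ((hB2 s).2) hs0.le
    have h2 := mul_le_mul_of_nonneg_left h1 hDC
    simp only [hκ₁, hκ₂]
    simp only [← hMdef] at hmain
    linarith
  have htot := Finset.sum_le_sum fun s (_ : s ∈ Finset.univ) => hroot s
  simp only [Finset.sum_add_distrib, ← Finset.sum_mul, ← Finset.mul_sum, PMF.sum_toReal,
    one_mul] at htot
  have h1 := mul_le_mul_of_nonneg_left htime hD0
  have hκ₂0 : 0 ≤ κ₂ := by positivity
  have h2 := mul_le_mul_of_nonneg_right herr hκ₂0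
  have h3 : p * κ₂ = p * Real.log M + 1 + D / C * (p / δ) * Real.log M := by
    rw [hκ₂]; field_simp
  rw [h3] at h2
  simp only [hκ₁] at htot
  linarith

end MarkovChannel

lemma neg_log_toENNReal {r : ℝ} (hr : 0 < r) :
    (-ENNReal.log (ENNReal.ofReal r)).toENNReal = ENNReal.ofReal (-Real.log r) := by
  rw [ENNReal.log_ofReal_of_pos hr, ← EReal.coe_neg, EReal.real_coe_toENNReal]

namespace MarkovChannel

variable {S X Y : Type*} [Fintype S] [Fintype Y] [Fintype X] {K : MarkovChannel S X Y}

lemma nonempty_input_of_capacity_ne_zero (h : K.capacity ≠ 0) : Nonempty X := by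
  by_contra hX
  have := K.nonempty_state
  refine h ?_
  rw [capacity, show {r : ℝ | ∃ (π : S → PMF X) (μ : PMF S), K.IsInvariant π μ ∧
    r = ∑ s, (μ s).toReal * K.infoCost s (π s)} = ∅ from ?_, Real.sSup_empty]
  refine Set.eq_empty_iff_forall_notMem.2 ?_
  rintro r ⟨π, -⟩
  exact hX (π (Classical.arbitrary S)).support_nonempty.to_type

/-- An upper bound on the error exponent for a small error probability at a fixed rate. -/
lemma exponent_le_of_converse {D C δ κ E L pe R' A ε : ℝ} (hC : 0 < C) (hCD : C ≤ D)
    (hδ : 0 < δ) (hδ3 : δ ≤ 1 / 3) (hE : 0 ≤ E) (hR' : 0 < R') (hL : R' * E ≤ L)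
    (hpe0 : 0 ≤ pe) (hε : 0 < ε) (hpe : pe < δ ^ 2 / 2)
    (hA : D * (1 - (1 - 3 * δ) * R' / C) ≤ A) (hA0 : 0 < A)
    (hpes : pe < Real.exp (-(|κ| + Real.log 2) * (A / ε + 1)))
    (hbound : ∀ p, 0 < p → pe < p →
      Real.log (1 / p) + (D / C * (1 - δ - p / δ) - p) * L ≤ D * E + κ) :
    0 < pe ∧ 0 < E ∧ -Real.log pe ≤ (A + ε) * E := by
  have hDC : 1 ≤ D / C := (one_le_div hC).2 hCD
  have hL0 : 0 ≤ L := (mul_nonneg hR'.le hE).trans hL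
  -- For p ≤ δ² both p/δ and `p` are at most `δ`, and 1 ≤ D/C, so all corrections together cost at
  -- most 3δ in the coefficient of `L`.
  have key : ∀ p, 0 < p → pe < p → p ≤ δ ^ 2 → Real.log (1 / p) ≤ A * E + κ := by
    intro p hp hpp hpδ
    have h1 : p / δ ≤ δ := by rw [div_le_iff₀ hδ]; nlinarith
    have h2 : p ≤ δ := by nlinarith
    have h3 : D / C * (1 - 3 * δ) ≤ D / C * (1 - δ - p / δ) - p := by nlinarith
    have h4 := mul_le_mul_of_nonneg_right h3 hL0
    have h5 : D / C * (1 - 3 * δ) * (R' * E) ≤ D / C * (1 - 3 * δ) * L :=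
      mul_le_mul_of_nonneg_left hL (mul_nonneg (by linarith) (by linarith))
    have h6 := mul_le_mul_of_nonneg_right hA hE
    have h7 : D * (1 - (1 - 3 * δ) * R' / C) * E = D * E - D / C * (1 - 3 * δ) * (R' * E) := by
      field_simp
    have h8 := hbound p hp hpp
    linarith
  -- With error probability zero `p` could be taken arbitrarily small, which the finite expected
  -- time forbids.
  have hpe1 : 0 < pe := by
    by_contra hcon
    have hpe' : pe = 0 := le_antisymm (not_lt.1 hcon) hpe0
    have hp : 0 < min (δ ^ 2) (Real.exp (-(A * E + κ + 1))) := lt_min (by positivity)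
      (Real.exp_pos _)
    have h1 := key _ hp (by rw [hpe']; exact hp) (min_le_left _ _)
    rw [one_div, Real.log_inv] at h1
    have h2 : Real.log (min (δ ^ 2) (Real.exp (-(A * E + κ + 1)))) ≤ -(A * E + κ + 1) :=
      (Real.log_le_log hp (min_le_right _ _)).trans_eq (Real.log_exp _)
    linarith
  -- The bound needs `p` strictly above the error probability; the factor 2 costs log 2.
  have h1 := key (2 * pe) (by linarith) (by linarith) (by linarith)
  rw [one_div, Real.log_inv, Real.log_mul two_ne_zero hpe1.ne'] at h1
  have hlog : Real.log pe < -(|κ| + Real.log 2) * (A / ε + 1) := by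
    have := Real.log_lt_log hpe1 hpes
    rwa [Real.log_exp] at this
  have hκ := le_abs_self κ
  have hlog2 : 0 < Real.log 2 := Real.log_pos one_lt_two
  have hκ' : 0 < |κ| + Real.log 2 := by positivity
  -- A tiny error probability forces a long expected time, long enough to absorb the additive
  -- constants into ε E.
  have h2 : (|κ| + Real.log 2) * (A / ε) < A * E := by nlinarith
  have h3 : |κ| + Real.log 2 ≤ ε * E := by
    have h4 : (|κ| + Real.log 2) * (A / ε) = A * ((|κ| + Real.log 2) / ε) := by ring
    rw [h4] at h2
    have := lt_of_mul_lt_mul_left h2 hA0.le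
    rw [div_lt_iff₀ hε] at this
    linarith
  refine ⟨hpe1, ?_, by linarith⟩
  by_contra hcon
  have : E = 0 := le_antisymm (not_lt.1 hcon) hE
  rw [this] at h3
  linarith

lemma Ergodic.limsup_errorExponent_le (hE : K.Ergodic) {R : ℝ} (hR : 0 < R) (hRC : R < K.capacity)
    (𝒮 : ℕ → CodingScheme K) (hpe : Tendsto (fun n => (𝒮 n).errorProb) atTop (𝓝 0))
    (hrate : ENNReal.ofReal R ≤ liminf (fun n => (𝒮 n).rate) atTop) :
    limsup (fun n => (𝒮 n).errorExponent) atTop ≤ K.burnashevExponent R := by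
  have hC : 0 < K.capacity := hR.trans hRC
  have hX := nonempty_input_of_capacity_ne_zero hC.ne'
  have hRC1 : 0 < 1 - R / K.capacity := by rw [sub_pos, div_lt_one hC]; exact hRC
  by_cases hK : K.CommonSupport
  swap
  · rw [burnashevExponent, hE.burnashevCoeff_eq_top hK, ENNReal.top_mul]
    · exact le_top
    · exact (ENNReal.ofReal_pos.2 hRC1).ne'
  obtain ⟨D, hCD, hD, hconv⟩ := hE.converse_bound hK hC
  have hD0 : 0 < D := hC.trans_le hCD
  set C := K.capacity with hCdef
  rw [burnashevExponent, hD, ← hCdef, ← ENNReal.ofReal_mul hD0.le]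
  refine ENNReal.le_of_forall_pos_le_add fun ε hε _ => ?_
  have hε : (0 : ℝ) < ε := hε
  rw [← ENNReal.ofReal_coe_nnreal, ← ENNReal.ofReal_add (mul_nonneg hD0.le hRC1.le) hε.le]
  -- choose the parameters
  obtain ⟨δ, hδ0, hδ3, hδε⟩ : ∃ δ : ℝ, 0 < δ ∧ δ ≤ 1 / 3 ∧ D * (4 * δ) ≤ ε / 2 := by
    refine ⟨min (1 / 3) (ε / (8 * D)), by positivity, min_le_left _ _, ?_⟩
    have := min_le_right (1 / 3 : ℝ) (ε / (8 * D))
    calc D * (4 * min (1 / 3) (ε / (8 * D))) ≤ D * (4 * (ε / (8 * D))) := by gcongr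
      _ = ε / 2 := by field_simp; norm_num
  obtain ⟨κ, hκ⟩ := hconv δ hδ0 (by linarith)
  set R' := (1 - δ) * R with hR'def
  have hR'0 : 0 < R' := mul_pos (by linarith) hR
  have hR'R : R' < R := by rw [hR'def]; nlinarith
  set A := D * (1 - R / C) + ε / 2 with hA
  have hA0 : 0 < A := by positivity
  have hAle : D * (1 - (1 - 3 * δ) * R' / C) ≤ A := by
    have h1 : D * (1 - (1 - 3 * δ) * R' / C)
        = D * (1 - R / C) + D * ((4 * δ - 3 * δ ^ 2) * (R / C)) := by
      rw [hR'def]; field_simp; ring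
    have h2 : R / C ≤ 1 := by linarith
    have h3 : (4 * δ - 3 * δ ^ 2) * (R / C) ≤ 4 * δ := by
      have : 0 ≤ R / C := (div_pos hR hC).le
      nlinarith [sq_nonneg δ, mul_nonneg (sq_nonneg δ) this]
    have := mul_le_mul_of_nonneg_left h3 hD0.le
    rw [h1, hA]; linarith
  have hev1 : ∀ᶠ n in atTop, ENNReal.ofReal R' < (𝒮 n).rate :=
    eventually_lt_of_lt_liminf (((ENNReal.ofReal_lt_ofReal_iff hR).2 hR'R).trans_le hrate)
  have hev2 : ∀ᶠ n in atTop, (𝒮 n).errorProb < ENNReal.ofReal (δ ^ 2 / 2) :=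
    hpe.eventually_lt_const (ENNReal.ofReal_pos.2 (by positivity))
  have hev3 : ∀ᶠ n in atTop, (𝒮 n).errorProb <
      ENNReal.ofReal (Real.exp (-(|κ| + Real.log 2) * (A / (ε / 2) + 1))) :=
    hpe.eventually_lt_const (ENNReal.ofReal_pos.2 (Real.exp_pos _))
  refine limsup_le_of_le (h := ?_)
  filter_upwards [hev1, hev2, hev3] with n h1 h2 h3
  have := (𝒮 n).transmission.isProb
  have hfin : (𝒮 n).expectedTime ≠ ∞ := by
    intro h
    rw [CodingScheme.rate, h, ENNReal.div_top] at h1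
    exact not_lt_zero h1
  have hne := (𝒮 n).transmission.nonempty_msg
  have hnt : Nontrivial (𝒮 n).encoder.Msg := by
    rw [← Fintype.one_lt_card_iff_nontrivial]
    by_contra hcard
    have hcard1 : Fintype.card (𝒮 n).encoder.Msg = 1 :=
      le_antisymm (not_lt.1 hcard) Fintype.card_pos
    rw [CodingScheme.rate, hcard1] at h1
    simp at h1
  have hpefin : (𝒮 n).errorProb ≠ ∞ := measure_ne_top _ _
  have hL : R' * (𝒮 n).expectedTime.toReal ≤ Real.log (Fintype.card (𝒮 n).encoder.Msg) := by
    have hlog : 0 ≤ Real.log (Fintype.card (𝒮 n).encoder.Msg) :=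
      Real.log_nonneg (by exact_mod_cast Fintype.card_pos)
    have h4 := ENNReal.mul_le_of_le_div h1.le
    have h5 := ENNReal.toReal_mono ENNReal.ofReal_ne_top h4
    rwa [ENNReal.toReal_mul, ENNReal.toReal_ofReal hR'0.le, ENNReal.toReal_ofReal hlog] at h5
  obtain ⟨hpe0, hE0, hle⟩ := exponent_le_of_converse (pe := (𝒮 n).errorProb.toReal)
    (ε := ε / 2) hC hCD hδ0 hδ3 ENNReal.toReal_nonneg hR'0 hL ENNReal.toReal_nonneg
    (by positivity) ((ENNReal.lt_ofReal_iff_toReal_lt hpefin).1 h2) hAle hA0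
    ((ENNReal.lt_ofReal_iff_toReal_lt hpefin).1 h3) fun p hp hpp =>
      hκ (𝒮 n) hnt hfin p hp ((ENNReal.lt_ofReal_iff_toReal_lt hpefin).2 hpp)
  rw [CodingScheme.errorExponent, ← ENNReal.ofReal_toReal hpefin, neg_log_toENNReal hpe0,
    ← ENNReal.ofReal_toReal hfin, ← ENNReal.ofReal_div_of_pos hE0]
  refine ENNReal.ofReal_le_ofReal ?_
  rw [div_le_iff₀ hE0]
  refine hle.trans (le_of_eq ?_)
  rw [hA]; ring

end MarkovChannel

/-! ### Exponential moments of Markov additive functionals. -/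

section Chernoff

/-- The exponential moment of a bounded centred variable. -/
lemma sum_mul_exp_neg_le {ι : Type*} [Fintype ι] {k ξ : ι → ℝ} {α b : ℝ} (hk : ∀ i, 0 ≤ k i)
    (hk1 : ∑ i, k i = 1) (hξ : ∑ i, k i * ξ i = 0) (hb : ∀ i, k i ≠ 0 → |ξ i| ≤ b) (hα : 0 ≤ α)
    (hαb : α * b ≤ 1) : ∑ i, k i * Real.exp (-(α * ξ i)) ≤ Real.exp (α ^ 2 * b ^ 2) := by
  have h1 : ∀ i, k i * Real.exp (-(α * ξ i)) ≤ k i * (1 + α ^ 2 * b ^ 2) - α * (k i * ξ i) := by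
    intro i
    by_cases hki : k i = 0
    · simp [hki]
    have hbi := hb i hki
    have h2 : |-(α * ξ i)| ≤ α * b := by
      rw [abs_neg, abs_mul, abs_of_nonneg hα]
      exact mul_le_mul_of_nonneg_left hbi hα
    have h3 := (abs_le.1 (Real.abs_exp_sub_one_sub_id_le (h2.trans hαb))).2
    have h4 : (-(α * ξ i)) ^ 2 ≤ α ^ 2 * b ^ 2 := by
      rw [← sq_abs, ← mul_pow]
      exact pow_le_pow_left₀ (abs_nonneg _) h2 2
    have := mul_le_mul_of_nonneg_left (show Real.exp (-(α * ξ i)) ≤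
      1 + α ^ 2 * b ^ 2 - α * ξ i by linarith) (hk i)
    linarith
  refine (Finset.sum_le_sum fun i _ => h1 i).trans ?_
  rw [Finset.sum_sub_distrib, ← Finset.sum_mul, ← Finset.mul_sum, hk1, hξ]
  have := Real.add_one_le_exp (α ^ 2 * b ^ 2)
  linarith

/-- The total weight of the paths of length `n` that start in the state `s`. -/
noncomputable def pathSum {S O : Type*} [Fintype O] (k : S → O → ℝ) (nx : O → S) : ℕ → S → ℝ
  | 0, _ => 1
  | n + 1, s => ∑ o, k s o * pathSum k nx n (nx o)

/-- The test function `φ` shrinks at least by the factor `c` under the kernel; its values between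
1/B and 1 make it comparable with the constant 1. -/
lemma pathSum_le {S O : Type*} [Fintype O] {k : S → O → ℝ} {nx : O → S} {φ : S → ℝ} {c B : ℝ}
    (hk : ∀ s o, 0 ≤ k s o) (hφ : ∀ s, φ s ≤ 1) (hB : ∀ s, 1 ≤ B * φ s) (hc : 0 ≤ c) (hB0 : 0 ≤ B)
    (hstep : ∀ s, ∑ o, k s o * φ (nx o) ≤ c * φ s) (n : ℕ) (s : S) :
    pathSum k nx n s ≤ B * c ^ n := by
  have h : ∀ s, pathSum k nx n s ≤ B * c ^ n * φ s := by
    induction n with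
    | zero => intro s; simpa [pathSum] using hB s
    | succ n ih =>
      intro s
      calc pathSum k nx (n + 1) s ≤ ∑ o, k s o * (B * c ^ n * φ (nx o)) :=
            Finset.sum_le_sum fun o _ => mul_le_mul_of_nonneg_left (ih _) (hk s o)
        _ = B * c ^ n * ∑ o, k s o * φ (nx o) := by
            rw [Finset.mul_sum]; exact Finset.sum_congr rfl fun o _ => by ring
        _ ≤ B * c ^ n * (c * φ s) := mul_le_mul_of_nonneg_left (hstep s) (by positivity)
        _ = B * c ^ (n + 1) * φ s := by ring
  refine (h s).trans (mul_le_of_le_one_right (by positivity) (hφ s))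

/-- Chernoff bound for a Markov additive functional with a solution `h` of the Poisson equation:
the exponential moment of the negative of the accumulated reward `r`. -/
lemma pathSum_exp_le {S O : Type*} [Finite S] [Fintype O] {k : S → O → ℝ} {nx : O → S}
    {r : S → O → ℝ} {h : S → ℝ} {g : ℝ} (hk : ∀ s o, 0 ≤ k s o) (hk1 : ∀ s, ∑ o, k s o = 1)
    (hpoi : ∀ s, ∑ o, k s o * (r s o + h (nx o)) = g + h s) :
    ∃ b : ℝ, 0 < b ∧ ∀ α, 0 ≤ α → α * b ≤ 1 → ∀ n s,
      pathSum (fun s o => k s o * Real.exp (-(α * r s o))) nx n s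
        ≤ Real.exp b * Real.exp (-(α * (g - α * b ^ 2))) ^ n := by
  have := Fintype.ofFinite S
  obtain ⟨c, B, hB⟩ := MarkovChannel.exists_shift_nonneg h
  obtain ⟨b, hb⟩ := ((Set.finite_range fun z : S × O =>
    |r z.1 z.2 + h (nx z.2) - g - h z.1|).bddAbove)
  have hb : ∀ s o, |r s o + h (nx o) - g - h s| ≤ b := fun s o => hb ⟨(s, o), rfl⟩
  refine ⟨max 1 (max b B), lt_of_lt_of_le one_pos (le_max_left _ _), fun α hα hαb n s => ?_⟩
  set b' := max 1 (max b B) with hb'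
  have hbb : b ≤ b' := (le_max_left _ _).trans (le_max_right _ _)
  have hBb : B ≤ b' := (le_max_right _ _).trans (le_max_right _ _)
  have h1b : 1 ≤ b' := le_max_left _ _
  have hα1 : α ≤ 1 := by nlinarith
  -- Weighting by the relative value replaces the reward by r + h(next) - h - g, which is centred by
  -- the Poisson equation and bounded, so its exponential moment is 1 up to second order in `α`.
  refine pathSum_le (φ := fun s => Real.exp (-(α * (h s + c))))
    (fun s o => mul_nonneg (hk s o) (Real.exp_pos _).le) (fun s => ?_) (fun s => ?_)
    (Real.exp_pos _).le (Real.exp_pos _).le (fun s => ?_) n s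
  · rw [Real.exp_le_one_iff]
    have := mul_nonneg hα (hB s).1
    linarith
  · rw [← Real.exp_add, Real.one_le_exp_iff]
    have : α * (h s + c) ≤ 1 * (h s + c) := mul_le_mul_of_nonneg_right hα1 (hB s).1
    linarith [(hB s).2]
  · have h1 := sum_mul_exp_neg_le (k := k s) (ξ := fun o => r s o + h (nx o) - g - h s) (hk s)
      (hk1 s) (by
        have := hpoi s
        simp only [mul_sub, Finset.sum_sub_distrib, ← Finset.sum_mul, hk1, this]
        ring) (fun o _ => (hb s o).trans hbb) hα hαb
    have h2 : ∀ o, k s o * Real.exp (-(α * r s o)) * Real.exp (-(α * (h (nx o) + c)))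
        = k s o * Real.exp (-(α * (r s o + h (nx o) - g - h s)))
          * Real.exp (-(α * (g + h s + c))) := by
      intro o
      rw [mul_assoc, mul_assoc, ← Real.exp_add, ← Real.exp_add]
      congr 2; ring
    simp only [h2, ← Finset.sum_mul]
    refine (mul_le_mul_of_nonneg_right h1 (Real.exp_pos _).le).trans (le_of_eq ?_)
    rw [← Real.exp_add, ← Real.exp_add]
    congr 1; ring

end Chernoff

/-! ### Expectations under causal strategies, and tests between two policies. -/

namespace MarkovChannel

variable {S X Y : Type*} [Fintype S] [Fintype Y]

/-- The expectation of `F` of the first `n` outcomes when the inputs are chosen by the causal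
strategy `ψ`. -/
noncomputable def expect (K : MarkovChannel S X Y) :
    ℕ → (List (S × Y) → X) → S → (List (S × Y) → ℝ) → ℝ
  | 0, _, _, F => F []
  | n + 1, ψ, s, F =>
    ∑ o, K.p s (ψ []) o * K.expect n (fun l => ψ (o :: l)) o.1 (fun l => F (o :: l))

variable {K : MarkovChannel S X Y}

lemma expect_mono (n : ℕ) : ∀ (ψ : List (S × Y) → X) (s : S) {F G : List (S × Y) → ℝ},
    (∀ l, l.length = n → F l ≤ G l) → K.expect n ψ s F ≤ K.expect n ψ s G := by
  induction n with
  | zero => intro ψ s F G h; exact h [] rfl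
  | succ n ih =>
    intro ψ s F G h
    exact Finset.sum_le_sum fun o _ => mul_le_mul_of_nonneg_left
      (ih _ _ fun l hl => h _ (by rw [List.length_cons, hl])) (K.p_nonneg _ _ _)

lemma expect_congr (n : ℕ) : ∀ {ψ ψ' : List (S × Y) → X} (s : S) {F G : List (S × Y) → ℝ},
    (∀ l, l.length < n → ψ l = ψ' l) → (∀ l, l.length = n → F l = G l) →
    K.expect n ψ s F = K.expect n ψ' s G := by
  induction n with
  | zero => intro ψ ψ' s F G _ h; exact h [] rfl
  | succ n ih =>
    intro ψ ψ' s F G hψ h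
    simp only [expect, hψ [] (Nat.succ_pos n)]
    refine Finset.sum_congr rfl fun o _ => congrArg _ (ih _ (fun l hl => hψ _ ?_) fun l hl => h _ ?_)
    · simpa using hl
    · rw [List.length_cons, hl]

lemma expect_const (n : ℕ) (c : ℝ) : ∀ (ψ : List (S × Y) → X) (s : S),
    K.expect n ψ s (fun _ => c) = c := by
  induction n with
  | zero => intro ψ s; rfl
  | succ n ih => intro ψ s; simp only [expect, ih, ← Finset.sum_mul, K.sum_p, one_mul]

lemma expect_add (n : ℕ) : ∀ (ψ : List (S × Y) → X) (s : S) (F G : List (S × Y) → ℝ),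
    K.expect n ψ s (fun l => F l + G l) = K.expect n ψ s F + K.expect n ψ s G := by
  induction n with
  | zero => intro ψ s F G; rfl
  | succ n ih => intro ψ s F G; simp only [expect, ih, mul_add, Finset.sum_add_distrib]

lemma expect_const_mul (n : ℕ) (c : ℝ) : ∀ (ψ : List (S × Y) → X) (s : S) (F : List (S × Y) → ℝ),
    K.expect n ψ s (fun l => c * F l) = c * K.expect n ψ s F := by
  induction n with
  | zero => intro ψ s F; rfl
  | succ n ih =>
    intro ψ s F
    simp only [expect, ih, Finset.mul_sum]
    exact Finset.sum_congr rfl fun o _ => by ring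

lemma expect_append (n m : ℕ) : ∀ (ψ : List (S × Y) → X) (s : S) (F : List (S × Y) → ℝ),
    K.expect (n + m) ψ s F = K.expect n ψ s fun l =>
      K.expect m (fun l' => ψ (l ++ l')) (lastState s l) fun l' => F (l ++ l') := by
  induction n with
  | zero => intro ψ s F; simp [expect]
  | succ n ih =>
    intro ψ s F
    rw [Nat.succ_add]
    simp only [expect, ih]
    rfl

/-- The accumulated reward along a list of outcomes. -/
def reward (r : S → S × Y → ℝ) : S → List (S × Y) → ℝ
  | _, [] => 0
  | s, o :: l => r s o + reward r o.1 l

lemma expect_exp_reward (f : S → X) (r : S → S × Y → ℝ) (n : ℕ) : ∀ s,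
    K.expect n (fun l => f (lastState s l)) s (fun l => Real.exp (reward r s l))
      = pathSum (fun s o => K.p s (f s) o * Real.exp (r s o)) Prod.fst n s := by
  induction n with
  | zero => intro s; simp [expect, pathSum, reward]
  | succ n ih =>
    intro s
    simp only [expect, pathSum, reward, Real.exp_add, expect_const_mul, lastState_cons,
      lastState_nil, ih, mul_assoc]

open Classical in
/-- Markov's inequality for the probability that the reward is small. -/
lemma expect_reward_lt_le (f : S → X) (r : S → S × Y → ℝ) (n : ℕ) (s : S) {α : ℝ} (hα : 0 ≤ α)
    (a : ℝ) : K.expect n (fun l => f (lastState s l)) s (fun l => if reward r s l < a then 1 else 0)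
      ≤ Real.exp (α * a) *
        pathSum (fun s o => K.p s (f s) o * Real.exp (-(α * r s o))) Prod.fst n s := by
  have hr : ∀ (l : List (S × Y)) s, reward (fun s o => -(α * r s o)) s l = -(α * reward r s l) := by
    intro l
    induction l with
    | nil => intro s; simp [reward]
    | cons o l ih => intro s; simp only [reward, ih]; ring
  rw [← expect_exp_reward f (fun s o => -(α * r s o)), ← expect_const_mul]
  refine expect_mono n _ s fun l _ => ?_
  rw [hr, ← Real.exp_add]
  split_ifs with h
  · rw [Real.one_le_exp_iff]
    have := mul_le_mul_of_nonneg_left h.le hα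
    linarith
  · exact (Real.exp_pos _).le

open Classical in
/-- There are two input policies and a test between them, of every large length, that rejects the
first policy with small probability and accepts the second with probability at most `β n`. -/
def Confirmable (K : MarkovChannel S X Y) (β : ℕ → ℝ) : Prop :=
  ∃ f f' : S → X, ∀ η > 0, ∃ N, ∀ n ≥ N, ∃ acc : S → List (S × Y) → Prop, ∀ s,
    K.expect n (fun l => f (lastState s l)) s (fun l => if acc s l then 0 else 1) ≤ η ∧
    K.expect n (fun l => f' (lastState s l)) s (fun l => if acc s l then 1 else 0) ≤ β n

open Classical in
/-- The accumulated reward is rarely much smaller than its mean. -/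
lemma exists_expect_reward_lt_le {f : S → X} {r : S → S × Y → ℝ} {h : S → ℝ} {g a : ℝ}
    (hpoi : ∀ s, ∑ o, K.p s (f s) o * (r s o + h o.1) = g + h s) (ha : a < g) {η : ℝ}
    (hη : 0 < η) : ∃ N : ℕ, ∀ n ≥ N, ∀ s, K.expect n (fun l => f (lastState s l)) s
      (fun l => if reward r s l < a * n then 1 else 0) ≤ η := by
  obtain ⟨b, hb, hle⟩ := pathSum_exp_le (k := fun s o => K.p s (f s) o) (nx := Prod.fst)
    (fun s o => K.p_nonneg _ _ _) (fun s => K.sum_p _ _) hpoi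
  obtain ⟨α, hα, hαb, hαg⟩ : ∃ α : ℝ, 0 < α ∧ α * b ≤ 1 ∧ α * b ^ 2 ≤ (g - a) / 2 := by
    have : 0 < g - a := by linarith
    refine ⟨min (1 / b) ((g - a) / 2 / b ^ 2), by positivity, ?_, ?_⟩
    · rw [← le_div_iff₀ hb]; exact min_le_left _ _
    · rw [← le_div_iff₀ (by positivity)]; exact min_le_right _ _
  have hlt : Real.exp (-(α * ((g - a) / 2))) < 1 := by
    rw [Real.exp_lt_one_iff]
    have : 0 < α * ((g - a) / 2) := mul_pos hα (by linarith)
    linarith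
  obtain ⟨N, hN⟩ := exists_pow_lt_of_lt_one (div_pos hη (Real.exp_pos b)) hlt
  refine ⟨N, fun n hn s => (expect_reward_lt_le f r n s hα.le (a * n)).trans ?_⟩
  refine (mul_le_mul_of_nonneg_left (hle α hα.le hαb n s) (Real.exp_pos _).le).trans ?_
  calc Real.exp (α * (a * n)) * (Real.exp b * Real.exp (-(α * (g - α * b ^ 2))) ^ n)
      = Real.exp b * Real.exp (-(α * (g - α * b ^ 2 - a))) ^ n := by
        rw [← Real.exp_nat_mul, ← Real.exp_nat_mul, ← Real.exp_add, ← Real.exp_add,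
          ← Real.exp_add]
        congr 1; ring
    _ ≤ Real.exp b * Real.exp (-(α * ((g - a) / 2))) ^ n := by
        gcongr
        linarith
    _ ≤ Real.exp b * Real.exp (-(α * ((g - a) / 2))) ^ N := by
        refine mul_le_mul_of_nonneg_left ?_ (Real.exp_pos _).le
        exact pow_le_pow_of_le_one (Real.exp_pos _).le hlt.le hn
    _ ≤ η := by
        have := mul_le_mul_of_nonneg_left hN.le (Real.exp_pos b).le
        rwa [mul_div_cancel₀ _ (Real.exp_pos b).ne'] at this

variable [Fintype X]

/-- Likelihood ratio test between a policy `f` attaining `D` and the policy that answers `f s` by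
the input of largest divergence. The log-likelihood ratio grows at rate `D` under `f`, whereas its
exponential has mean one under `f'`; accepting above the level a n bounds both errors. -/
lemma Ergodic.confirmable_of_commonSupport [Nonempty X] (hE : K.Ergodic) (hK : K.CommonSupport)
    {a : ℝ} (ha : ENNReal.ofReal a < K.burnashevCoeff) :
    K.Confirmable fun n => Real.exp (-(a * n)) := by
  classical
  obtain ⟨f, h, D, hD0, hD, hpoi, -⟩ := hE.burnashevCoeff_eq hK
  have haD : a < D := by
    rw [hD] at ha
    exact (ENNReal.ofReal_lt_ofReal_iff'.1 ha).1
  choose f' hf' using fun s => K.exists_kl_eq_dmax s (f s)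
  refine ⟨f, f', fun η hη => ?_⟩
  set r : S → S × Y → ℝ := fun s o => Real.log (K.p s (f s) o / K.p s (f' s) o) with hr
  obtain ⟨N, hN⟩ := exists_expect_reward_lt_le (K := K) (f := f) (r := r) (h := h) (g := D)
    (fun s => by
      rw [← hpoi s, ← hf' s, kl]
      simp only [mul_add, Finset.sum_add_distrib, hr]) haD hη
  refine ⟨N, fun n hn => ⟨fun s l => a * n ≤ reward r s l, fun s => ⟨?_, ?_⟩⟩⟩
  · refine (expect_mono n _ s fun l _ => ?_).trans (hN n hn s)
    by_cases h : a * n ≤ reward r s l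
    · simp [h, not_lt.2 h]
    · simp [h, not_le.1 h]
  · have hone : ∀ n s, pathSum (fun s o => K.p s (f' s) o * Real.exp (r s o)) Prod.fst n s
        = 1 := by
      intro n
      have h1 : ∀ s o, K.p s (f' s) o * Real.exp (r s o) = K.p s (f s) o := by
        intro s o
        by_cases h0 : K.p s (f s) o = 0
        · rw [h0, hK s (f' s) (f s) o h0, zero_mul]
        · have h0' : K.p s (f' s) o ≠ 0 := fun h => h0 (hK s (f s) (f' s) o h)
          simp only [hr]
          rw [Real.exp_log (div_pos ((K.p_nonneg _ _ _).lt_of_ne' h0)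
            ((K.p_nonneg _ _ _).lt_of_ne' h0')), mul_div_cancel₀ _ h0']
      induction n with
      | zero => intro s; rfl
      | succ n ih =>
        intro s
        exact (Finset.sum_congr rfl fun o _ => by rw [ih, mul_one]; exact h1 s o).trans (K.sum_p s (f s))
    refine (expect_mono (G := fun l => Real.exp (-(a * n)) * Real.exp (reward r s l)) n _ s
      fun l _ => ?_).trans (le_of_eq ?_)
    · rw [← Real.exp_add]
      by_cases h : a * n ≤ reward r s l
      · simp only [h, if_true, Real.one_le_exp_iff]; linarith
      · simp only [h, if_false]; exact (Real.exp_pos _).le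
    · rw [expect_const_mul, expect_exp_reward, hone, mul_one]

/-- Some outcome in some state is possible for `x` and impossible for `x'`. With `x` throughout it
occurs with positive frequency, with `x'` throughout it never occurs; the test counts occurrences.
-/
lemma Ergodic.confirmable_of_not_commonSupport (hE : K.Ergodic) (hK : ¬ K.CommonSupport) :
    K.Confirmable fun _ => 0 := by
  classical
  simp only [CommonSupport, not_forall] at hK
  obtain ⟨s₀, x, x', o₀, h0, h1⟩ := hK
  have := K.nonempty_state
  have hP0 : ∀ s t, 0 ≤ K.tr s x t := fun s t => K.tr_nonneg _ _ _
  obtain ⟨m, hm0, hm1, hm⟩ := exists_invariant_law hP0 (fun s => K.sum_tr s x)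
  have hirr := hE.irreducible_tr fun _ => x
  have hpos := hirr.invariant_pos hP0 hm0 hm1 hm
  set r : S → S × Y → ℝ := fun s o => if s = s₀ ∧ o = o₀ then 1 else 0 with hr
  obtain ⟨h, hh⟩ := hirr.exists_poisson hP0 (fun s => K.sum_tr s x) hm1 hm
    fun s => ∑ o, K.p s x o * r s o
  set g := ∑ s, m s * ∑ o, K.p s x o * r s o with hg
  have hg0 : 0 < g := by
    refine Finset.sum_pos' (fun s _ => mul_nonneg (hm0 s) (Finset.sum_nonneg fun o _ =>
      mul_nonneg (K.p_nonneg _ _ _) ?_)) ⟨s₀, Finset.mem_univ _, mul_pos (hpos s₀) ?_⟩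
    · simp only [hr]; split_ifs <;> norm_num
    · refine Finset.sum_pos' (fun o _ => mul_nonneg (K.p_nonneg _ _ _) ?_)
        ⟨o₀, Finset.mem_univ _, mul_pos ((K.p_nonneg _ _ _).lt_of_ne' h1) ?_⟩
      · simp only [hr]; split_ifs <;> norm_num
      · simp [hr]
  refine ⟨fun _ => x, fun _ => x', fun η hη => ?_⟩
  obtain ⟨N, hN⟩ := exists_expect_reward_lt_le (K := K) (f := fun _ => x) (r := r) (h := h) (g := g)
    (fun s => by
      rw [← hh s, K.sum_tr_mul]
      simp only [mul_add, Finset.sum_add_distrib]) (half_lt_self hg0) hη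
  -- Positive length makes the threshold positive, so that a count of zero is rejected.
  refine ⟨N + 1, fun n hn => ⟨fun s l => g / 2 * n ≤ reward r s l, fun s => ⟨?_, ?_⟩⟩⟩
  · refine (expect_mono n _ s fun l _ => ?_).trans (hN n (by omega) s)
    by_cases h : g / 2 * n ≤ reward r s l
    · simp [h, not_lt.2 h]
    · simp [h, not_le.1 h]
  · have hn0 : (0 : ℝ) < n := by exact_mod_cast (show 0 < n by omega)
    have hrev : ∀ n s, K.expect n (fun _ => x') s (fun l => reward r s l) = 0 := by
      intro n
      induction n with
      | zero => intro s; rfl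
      | succ n ih =>
        intro s
        simp only [expect, reward]
        refine Finset.sum_eq_zero fun o _ => ?_
        rw [expect_add, ih, expect_const, add_zero]
        by_cases hso : s = s₀ ∧ o = o₀
        · rw [hso.1, hso.2, h0, zero_mul]
        · simp [hr, hso]
    have hrnn : ∀ (l : List (S × Y)) s, 0 ≤ reward r s l := by
      intro l
      induction l with
      | nil => intro s; exact le_rfl
      | cons o l ih =>
        intro s
        refine add_nonneg ?_ (ih _)
        simp only [hr]; split_ifs <;> norm_num
    refine (expect_mono (G := fun l => (g / 2 * n)⁻¹ * reward r s l) n _ s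
      fun l _ => ?_).trans (le_of_eq ?_)
    · have hpos' : 0 < g / 2 * n := by positivity
      by_cases h : g / 2 * n ≤ reward r s l
      · simp only [h, if_true, inv_mul_eq_div, one_le_div hpos']
      · simp only [h, if_false]
        exact mul_nonneg (inv_nonneg.2 hpos'.le) (hrnn _ _)
    · rw [expect_const_mul, hrev, mul_zero]

end MarkovChannel

/-! ### Channel coding at rates below capacity. -/

section Feinstein

open Classical in
/-- Feinstein's maximal coding lemma: codewords are added greedily, each decoded on the outputs of
large likelihood that are not yet used. -/
lemma exists_code {A B : Type*} [Fintype A] [Fintype B] {W : A → B → ℝ} (hW0 : ∀ a b, 0 ≤ W a b)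
    (hW1 : ∀ a, ∑ b, W a b = 1) {ν : A → ℝ} (hν0 : ∀ a, 0 ≤ ν a) (hν1 : ∑ a, ν a = 1)
    {Q : B → ℝ} (hQ : ∀ b, ∑ a, ν a * W a b = Q b) {γ η : ℝ} (hγ : 0 < γ)
    (hinfo : ∑ a, ν a * ∑ b, (if W a b ≤ γ * Q b then W a b else 0) ≤ η) (M : ℕ) :
    ∀ m ≤ M, ∃ (code : ℕ → A) (dec : B → Option ℕ),
      (∀ b i, dec b = some i → i < m ∧ γ * Q b < W (code i) b) ∧
      ∀ i < m, ∑ b, (if dec b = some i then 0 else W (code i) b) ≤ η + M / γ := by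
  have hA : Nonempty A := by
    by_contra h
    rw [not_nonempty_iff] at h
    simp at hν1
  have hQ0 : ∀ b, 0 ≤ Q b := fun b => hQ b ▸
    Finset.sum_nonneg fun a _ => mul_nonneg (hν0 a) (hW0 a b)
  intro m
  induction m with
  | zero =>
    exact fun _ => ⟨fun _ => Classical.arbitrary A, fun _ => none, fun b i h => by simp at h,
      fun i hi => absurd hi (Nat.not_lt_zero i)⟩
  | succ m ih =>
    intro hm
    obtain ⟨code, dec, hdec, herr⟩ := ih (by omega)
    -- On its decoding set each codeword has likelihood above γ Q, so the set has Q-mass at most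
    -- 1/γ.
    have hused : ∑ b, (if dec b = none then 0 else Q b) ≤ m / γ := by
      have h1 : ∀ b, (if dec b = none then 0 else Q b)
          ≤ ∑ i ∈ Finset.range m, W (code i) b / γ * (if dec b = some i then 1 else 0) := by
        intro b
        cases hb : dec b with
        | none => simp
        | some j =>
          have hj := hdec b j hb
          simp only [reduceCtorEq, if_false]
          refine le_trans ?_ (Finset.single_le_sum (fun i _ => ?_) (Finset.mem_range.2 hj.1))
          · simp only [if_true, mul_one]
            rw [le_div_iff₀ hγ]; linarith [hj.2]
          · have := hW0 (code i) b
            split_ifs <;> positivity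
      refine (Finset.sum_le_sum fun b _ => h1 b).trans ?_
      rw [Finset.sum_comm]
      calc ∑ i ∈ Finset.range m, ∑ b, W (code i) b / γ * (if dec b = some i then 1 else 0)
          ≤ ∑ i ∈ Finset.range m, ∑ b, W (code i) b / γ := by
            refine Finset.sum_le_sum fun i _ => Finset.sum_le_sum fun b _ => ?_
            have := div_nonneg (hW0 (code i) b) hγ.le
            split_ifs
            · simp
            · simpa using this
        _ = m / γ := by
            simp only [← Finset.sum_div, hW1, Finset.sum_const, Finset.card_range, nsmul_eq_mul]
            ring
    have hmM : (m : ℝ) / γ ≤ M / γ := by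
      have : (m : ℝ) ≤ M := by exact_mod_cast (show m ≤ M by omega)
      gcongr
    obtain ⟨a, ha⟩ : ∃ a, ∑ b, (if dec b = none ∧ γ * Q b < W a b then 0 else W a b)
        ≤ η + M / γ := by
      by_contra! hcon
      -- Under the random codeword a failure means low likelihood or an output already in use, and
      -- the output has law `Q`. The average failure is small, hence some codeword fails rarely.
      have hsum : ∑ a, ν a * ∑ b, (if dec b = none ∧ γ * Q b < W a b then 0 else W a b)
          ≤ η + m / γ := by
        have h1 : ∀ a, ∑ b, (if dec b = none ∧ γ * Q b < W a b then 0 else W a b)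
            ≤ ∑ b, (if W a b ≤ γ * Q b then W a b else 0)
              + ∑ b, (if dec b = none then 0 else W a b) := by
          intro a
          rw [← Finset.sum_add_distrib]
          refine Finset.sum_le_sum fun b _ => ?_
          have := hW0 a b
          by_cases h1 : dec b = none
          · by_cases h2 : γ * Q b < W a b
            · simp [h1, h2, not_le.2 h2]
            · simp [h1, h2, not_lt.1 h2]
          · simp only [h1, false_and, if_false]
            split_ifs <;> linarith
        calc ∑ a, ν a * ∑ b, (if dec b = none ∧ γ * Q b < W a b then 0 else W a b)
            ≤ ∑ a, ν a * (∑ b, (if W a b ≤ γ * Q b then W a b else 0)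
              + ∑ b, (if dec b = none then 0 else W a b)) :=
              Finset.sum_le_sum fun a _ => mul_le_mul_of_nonneg_left (h1 a) (hν0 a)
          _ = ∑ a, ν a * ∑ b, (if W a b ≤ γ * Q b then W a b else 0)
              + ∑ b, (if dec b = none then 0 else Q b) := by
              simp only [mul_add, Finset.sum_add_distrib]
              congr 1
              simp only [Finset.mul_sum]
              rw [Finset.sum_comm]
              refine Finset.sum_congr rfl fun b _ => ?_
              split_ifs
              · simp
              · exact hQ b
          _ ≤ η + m / γ := add_le_add hinfo hused
      have hlt : η + M / γ < ∑ a, ν a *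
          ∑ b, (if dec b = none ∧ γ * Q b < W a b then 0 else W a b) := by
        have h2 : ∃ a, 0 < ν a := by
          by_contra! h
          have : ∑ a, ν a = 0 := Finset.sum_eq_zero fun a _ => le_antisymm (h a) (hν0 a)
          linarith
        obtain ⟨a₀, ha₀⟩ := h2
        calc η + M / γ = ∑ a, ν a * (η + M / γ) := by rw [← Finset.sum_mul, hν1, one_mul]
          _ < _ := Finset.sum_lt_sum
            (fun a _ => mul_le_mul_of_nonneg_left (hcon a).le (hν0 a))
            ⟨a₀, Finset.mem_univ _, mul_lt_mul_of_pos_left (hcon a₀) ha₀⟩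
      linarith
    refine ⟨Function.update code m a,
      fun b => if dec b = none ∧ γ * Q b < W a b then some m else dec b, ?_, ?_⟩
    · intro b i hi
      dsimp only at hi
      split_ifs at hi with h
      · obtain rfl := Option.some.inj hi
        exact ⟨Nat.lt_succ_self _, by simpa using h.2⟩
      · have := hdec b i hi
        exact ⟨by omega, by rw [Function.update_of_ne (by omega)]; exact this.2⟩
    · intro i hi
      rcases Nat.lt_succ_iff_lt_or_eq.1 hi with hi' | rfl
      · refine le_trans (le_of_eq (Finset.sum_congr rfl fun b _ => ?_)) (herr i hi')
        rw [Function.update_of_ne (by omega)]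
        by_cases h : dec b = none ∧ γ * Q b < W a b
        · have : m ≠ i := by omega
          simp [h.1, h.2, this]
        · simp [h]
      · refine le_trans (Finset.sum_le_sum fun b _ => ?_) ha
        rw [Function.update_self]
        by_cases h : dec b = none ∧ γ * Q b < W a b
        · simp [h.1, h.2]
        · simp only [h, if_false]
          split_ifs
          · exact hW0 a b
          · exact le_rfl

end Feinstein

lemma sum_fin_succ_fun {α : Type*} [Fintype α] {n : ℕ} (F : (Fin (n + 1) → α) → ℝ) :
    ∑ b, F b = ∑ o, ∑ b : Fin n → α, F (Fin.cons o b) := by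
  rw [← Fintype.sum_prod_type (f := fun z : α × (Fin n → α) => F (Fin.cons z.1 z.2))]
  exact (Fintype.sum_equiv (Fin.consEquiv fun _ => α) _ _ fun z => rfl).symm

/-- The product law of a random function with independent values has the right marginals. -/
lemma sum_prod_mul_eval {ι α : Type*} [Fintype ι] [DecidableEq ι] [Fintype α] {π : ι → α → ℝ}
    (hπ : ∀ i, ∑ x, π i x = 1) (i : ι) (g : α → ℝ) :
    ∑ c : ι → α, (∏ j, π j (c j)) * g (c i) = ∑ x, π i x * g x := by
  have h := Finset.prod_univ_sum (fun _ : ι => (Finset.univ : Finset α))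
    (fun j x => π j x * if j = i then g x else 1)
  rw [Fintype.piFinset_univ] at h
  have h1 : ∀ c : ι → α, ∏ j, (π j (c j) * if j = i then g (c j) else 1)
      = (∏ j, π j (c j)) * g (c i) := by
    intro c
    rw [Finset.prod_mul_distrib]
    simp
  simp only [h1] at h
  rw [← h, Finset.prod_eq_single i]
  · simp
  · intro j _ hj
    simp [hj, hπ]
  · simp

namespace MarkovChannel

variable {S X Y : Type*} [Fintype S] [Fintype Y]

/-- The probability of the outcomes `b` when the input functions `a` are used. -/
noncomputable def pathProb (K : MarkovChannel S X Y) :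
    (n : ℕ) → (Fin n → S → X) → S → (Fin n → S × Y) → ℝ
  | 0, _, _, _ => 1
  | n + 1, a, s, b => K.p s (a 0 s) (b 0) * K.pathProb n (Fin.tail a) (b 0).1 (Fin.tail b)

/-- The probability of the outcomes `b` under the randomized policy `π`. -/
noncomputable def mixProb [Fintype X] (K : MarkovChannel S X Y) (π : S → X → ℝ) :
    (n : ℕ) → S → (Fin n → S × Y) → ℝ
  | 0, _, _ => 1
  | n + 1, s, b => K.q s (π s) (b 0) * K.mixProb π n (b 0).1 (Fin.tail b)

variable {K : MarkovChannel S X Y}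

lemma pathProb_nonneg (n : ℕ) : ∀ (a : Fin n → S → X) (s : S) (b : Fin n → S × Y),
    0 ≤ K.pathProb n a s b := by
  induction n with
  | zero => intro a s b; exact zero_le_one
  | succ n ih => intro a s b; exact mul_nonneg (K.p_nonneg _ _ _) (ih _ _ _)

lemma sum_pathProb_mul (n : ℕ) : ∀ (a : ℕ → S → X) (s : S) (F : List (S × Y) → ℝ),
    ∑ b, K.pathProb n (fun i => a i) s b * F (List.ofFn b)
      = K.expect n (fun l => a l.length (lastState s l)) s F := by
  induction n with
  | zero => intro a s F; simp [pathProb, expect]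
  | succ n ih =>
    intro a s F
    rw [sum_fin_succ_fun]
    simp only [pathProb, Fin.cons_zero, List.ofFn_cons, expect, mul_assoc, ← Finset.mul_sum]
    refine Finset.sum_congr rfl fun o _ => congrArg _ ?_
    exact ih (fun i => a (i + 1)) o.1 fun l => F (o :: l)

lemma sum_pathProb (n : ℕ) : ∀ (a : Fin n → S → X) (s : S), ∑ b, K.pathProb n a s b = 1 := by
  induction n with
  | zero => intro a s; simp [pathProb]
  | succ n ih =>
    intro a s
    rw [sum_fin_succ_fun]
    simp only [pathProb, Fin.cons_zero, Fin.tail_cons, ← Finset.mul_sum, ih, mul_one, K.sum_p]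

variable [Fintype X] [DecidableEq S] {π : S → X → ℝ}

/-- The law of a random sequence of input functions. -/
noncomputable def codeLaw (π : S → X → ℝ) {n : ℕ} (a : Fin n → S → X) : ℝ :=
  ∏ i, ∏ s, π s (a i s)

lemma codeLaw_nonneg (hπ0 : ∀ s x, 0 ≤ π s x) {n : ℕ} (a : Fin n → S → X) : 0 ≤ codeLaw π a :=
  Finset.prod_nonneg fun _ _ => Finset.prod_nonneg fun _ _ => hπ0 _ _

lemma codeLaw_cons {n : ℕ} (c : S → X) (a : Fin n → S → X) :
    codeLaw π (Fin.cons c a : Fin (n + 1) → S → X) = (∏ s, π s (c s)) * codeLaw π a := by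
  simp [codeLaw, Fin.prod_univ_succ]

lemma sum_codeLaw [Nonempty S] (hπ1 : ∀ s, ∑ x, π s x = 1) (n : ℕ) :
    ∑ a : Fin n → S → X, codeLaw π a = 1 := by
  induction n with
  | zero => simp [codeLaw]
  | succ n ih =>
    rw [sum_fin_succ_fun]
    simp only [codeLaw_cons, ← Finset.mul_sum, ih, mul_one]
    have := sum_prod_mul_eval hπ1 (Classical.arbitrary S) fun _ => 1
    simpa [hπ1] using this

/-- At each time only the value of the random map at the current state is used, and the maps at
different times are independent; averaging therefore reproduces the randomized policy. -/
lemma sum_codeLaw_mul_pathProb (hπ1 : ∀ s, ∑ x, π s x = 1) (n : ℕ) :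
    ∀ (s : S) (b : Fin n → S × Y),
      ∑ a, codeLaw π a * K.pathProb n a s b = K.mixProb π n s b := by
  induction n with
  | zero => intro s b; simp [codeLaw, pathProb, mixProb]
  | succ n ih =>
    intro s b
    rw [sum_fin_succ_fun]
    simp only [codeLaw_cons, pathProb, Fin.cons_zero, Fin.tail_cons, mixProb]
    have h1 : ∀ (c : S → X) (a : Fin n → S → X), (∏ s, π s (c s)) * codeLaw π a *
        (K.p s (c s) (b 0) * K.pathProb n a (b 0).1 (Fin.tail b))
        = (∏ s, π s (c s)) * K.p s (c s) (b 0)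
          * (codeLaw π a * K.pathProb n a (b 0).1 (Fin.tail b)) := fun c a => by ring
    simp only [h1, ← Finset.mul_sum, ih, ← Finset.sum_mul]
    rw [sum_prod_mul_eval hπ1 s fun x => K.p s x (b 0), q]

/-- The tilted weight of an input and an outcome. -/
noncomputable def tilt (K : MarkovChannel S X Y) (π : S → X → ℝ) (α : ℝ) (s : S)
    (z : X × (S × Y)) : ℝ :=
  π s z.1 * K.p s z.1 z.2 * (K.q s (π s) z.2 / K.p s z.1 z.2) ^ α

lemma mixProb_nonneg (hπ0 : ∀ s x, 0 ≤ π s x) (n : ℕ) : ∀ (s : S) (b : Fin n → S × Y),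
    0 ≤ K.mixProb π n s b := by
  induction n with
  | zero => intro s b; exact zero_le_one
  | succ n ih => intro s b; exact mul_nonneg (q_nonneg (hπ0 s) _ _) (ih _ _)

/-- The likelihood ratio is a product along the path, so its power factorizes as the probabilities
do and the average becomes a weight of paths accessible to `pathSum_exp_le`. -/
lemma sum_codeLaw_tilted (hπ0 : ∀ s x, 0 ≤ π s x) (hπ1 : ∀ s, ∑ x, π s x = 1) (α : ℝ) (n : ℕ) :
    ∀ s : S, ∑ a, codeLaw π a * ∑ b, K.pathProb n a s b
        * (K.mixProb π n s b / K.pathProb n a s b) ^ α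
      = pathSum (K.tilt π α) (fun z => z.2.1) n s := by
  induction n with
  | zero => intro s; simp [codeLaw, pathProb, mixProb, pathSum]
  | succ n ih =>
    intro s
    rw [sum_fin_succ_fun]
    have h1 : ∀ (c : S → X) (a : Fin n → S → X),
        ∑ b, K.pathProb (n + 1) (Fin.cons c a) s b
          * (K.mixProb π (n + 1) s b / K.pathProb (n + 1) (Fin.cons c a) s b) ^ α
        = ∑ o, K.p s (c s) o * (K.q s (π s) o / K.p s (c s) o) ^ α *
          ∑ b, K.pathProb n a o.1 b * (K.mixProb π n o.1 b / K.pathProb n a o.1 b) ^ α := by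
      intro c a
      rw [sum_fin_succ_fun]
      refine Finset.sum_congr rfl fun o _ => ?_
      rw [Finset.mul_sum]
      refine Finset.sum_congr rfl fun b _ => ?_
      simp only [pathProb, mixProb, Fin.cons_zero, Fin.tail_cons]
      rw [mul_div_mul_comm, Real.mul_rpow
        (div_nonneg (q_nonneg (hπ0 s) _ _) (K.p_nonneg _ _ _))
        (div_nonneg (mixProb_nonneg hπ0 _ _ _) (pathProb_nonneg _ _ _ _))]
      ring
    simp only [h1, codeLaw_cons]
    have h2 : ∀ c : S → X, ∑ a : Fin n → S → X, (∏ s, π s (c s)) * codeLaw π a *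
        ∑ o, K.p s (c s) o * (K.q s (π s) o / K.p s (c s) o) ^ α *
          ∑ b, K.pathProb n a o.1 b * (K.mixProb π n o.1 b / K.pathProb n a o.1 b) ^ α
        = (∏ s, π s (c s)) * ∑ o, K.p s (c s) o * (K.q s (π s) o / K.p s (c s) o) ^ α *
          pathSum (K.tilt π α) (fun z => z.2.1) n o.1 := by
      intro c
      simp only [← ih, mul_assoc, ← Finset.mul_sum]
      congr 1
      simp only [Finset.mul_sum]
      rw [Finset.sum_comm]
      refine Finset.sum_congr rfl fun o _ => Finset.sum_congr rfl fun a _ =>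
        Finset.sum_congr rfl fun b _ => by ring
    simp only [h2]
    rw [sum_prod_mul_eval hπ1 s fun x => ∑ o, K.p s x o * (K.q s (π s) o / K.p s x o) ^ α *
          pathSum (K.tilt π α) (fun z => z.2.1) n o.1, pathSum, Fintype.sum_prod_type]
    simp only [Finset.mul_sum, tilt, mul_assoc]

/-- Chernoff's inequality: on paths of low likelihood the ratio γ · mixProb / pathProb is at least
one, and so is its power. -/
lemma sum_codeLaw_indicator_le (hπ0 : ∀ s x, 0 ≤ π s x) (hπ1 : ∀ s, ∑ x, π s x = 1)
    {α γ : ℝ} (hα : 0 ≤ α) (hγ : 0 < γ) (n : ℕ) (s : S) :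
    ∑ a, codeLaw π a * ∑ b, (if K.pathProb n a s b ≤ γ * K.mixProb π n s b then
        K.pathProb n a s b else 0)
      ≤ γ ^ α * pathSum (K.tilt π α) (fun z => z.2.1) n s := by
  rw [← sum_codeLaw_tilted hπ0 hπ1, Finset.mul_sum]
  refine Finset.sum_le_sum fun a _ => ?_
  rw [mul_left_comm]
  refine mul_le_mul_of_nonneg_left ?_ (codeLaw_nonneg hπ0 a)
  rw [Finset.mul_sum]
  refine Finset.sum_le_sum fun b _ => ?_
  have hW := pathProb_nonneg (K := K) n a s b
  have hQ := mixProb_nonneg (K := K) hπ0 n s b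
  split_ifs with h
  · rcases hW.eq_or_lt with h0 | h0
    · rw [← h0]; simp
    · rw [mul_left_comm, ← Real.mul_rpow hγ.le (div_nonneg hQ hW)]
      refine le_mul_of_one_le_right hW (Real.one_le_rpow ?_ hα)
      rw [← mul_div_assoc, one_le_div h0]
      exact h
  · exact mul_nonneg (Real.rpow_nonneg hγ.le _)
      (mul_nonneg hW (Real.rpow_nonneg (div_nonneg hQ hW) _))

lemma tilt_eq (hπ0 : ∀ s x, 0 ≤ π s x) (α : ℝ) (s : S) (z : X × (S × Y)) :
    K.tilt π α s z = π s z.1 * K.p s z.1 z.2 *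
      Real.exp (-(α * Real.log (K.p s z.1 z.2 / K.q s (π s) z.2))) := by
  rw [tilt]
  by_cases h : π s z.1 * K.p s z.1 z.2 = 0
  · rw [h, zero_mul, zero_mul]
  · have hp : 0 < K.p s z.1 z.2 := (K.p_nonneg _ _ _).lt_of_ne' (right_ne_zero_of_mul h)
    have hq : 0 < K.q s (π s) z.2 := lt_of_lt_of_le
      ((mul_nonneg (hπ0 _ _) (K.p_nonneg _ _ _)).lt_of_ne' h) (le_q (hπ0 s) s z.1 z.2)
    rw [Real.rpow_def_of_pos (div_pos hq hp), ← inv_div, Real.log_inv]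
    congr 2; ring

/-- The channel coding theorem: reliable block codes with feedback of the state at every rate below
the capacity. -/
lemma Ergodic.exists_block_code [Nonempty X] (hE : K.Ergodic) {c : ℝ} (hc0 : 0 ≤ c)
    (hc : c < K.capacity) {η : ℝ} (hη : 0 < η) :
    ∃ N : ℕ, ∀ n ≥ N, ∃ M : ℕ, Real.exp (c * n) ≤ M ∧ ∀ s : S,
      ∃ (a : Fin M → ℕ → S → X) (dec : List (S × Y) → ℕ), ∀ w : Fin M,
        K.expect n (fun l => a w l.length (lastState s l)) s
          (fun l => if dec l = w then 0 else 1) ≤ η := by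
  classical
  have := K.nonempty_state
  obtain ⟨π, h, hπ0, hπ1, hpoi, -⟩ := hE.exists_optimal_policy
  -- The reward is the information density. By the optimality equation of the policy `π`, its mean
  -- growth rate is the capacity.
  obtain ⟨b, hb, hle⟩ := pathSum_exp_le
    (k := fun s (z : X × (S × Y)) => π s z.1 * K.p s z.1 z.2) (nx := fun z => z.2.1)
    (r := fun s z => Real.log (K.p s z.1 z.2 / K.q s (π s) z.2)) (h := h) (g := K.capacity)
    (fun s z => mul_nonneg (hπ0 _ _) (K.p_nonneg _ _ _))
    (fun s => by
      rw [Fintype.sum_prod_type]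
      simp only [← Finset.mul_sum, K.sum_p, mul_one, hπ1])
    (fun s => by
      rw [← hpoi s, Fintype.sum_prod_type]
      simp only [mul_add, Finset.sum_add_distrib, info, Finset.mul_sum, mul_assoc])
  set C := K.capacity
  -- The gap is split in three: one part separates the threshold rate c + δ from `c`, one covers the
  -- quadratic Chernoff loss, one remains as decay.
  set δ := (C - c) / 3 with hδ
  have hδ0 : 0 < δ := by rw [hδ]; linarith
  obtain ⟨α, hα, hαb, hαδ⟩ : ∃ α : ℝ, 0 < α ∧ α * b ≤ 1 ∧ α * b ^ 2 ≤ δ := by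
    refine ⟨min (1 / b) (δ / b ^ 2), by positivity, ?_, ?_⟩
    · rw [← le_div_iff₀ hb]; exact min_le_left _ _
    · rw [← le_div_iff₀ (by positivity)]; exact min_le_right _ _
  have hlt1 : Real.exp (-(α * δ)) < 1 := by
    rw [Real.exp_lt_one_iff]; have := mul_pos hα hδ0; linarith
  have hlt2 : Real.exp (-δ) < 1 := by rw [Real.exp_lt_one_iff]; linarith
  obtain ⟨N₁, hN₁⟩ := exists_pow_lt_of_lt_one (show 0 < η / 2 / Real.exp b by positivity) hlt1
  obtain ⟨N₂, hN₂⟩ := exists_pow_lt_of_lt_one (show 0 < η / 4 by positivity) hlt2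
  refine ⟨max N₁ N₂, fun n hn => ?_⟩
  have hn1 : N₁ ≤ n := (le_max_left _ _).trans hn
  have hn2 : N₂ ≤ n := (le_max_right _ _).trans hn
  set M := ⌈Real.exp (c * n)⌉₊ with hM
  have hMle : (M : ℝ) ≤ 2 * Real.exp (c * n) := by
    have h1 := (Nat.ceil_lt_add_one (Real.exp_pos (c * n)).le).le
    have h2 : 1 ≤ Real.exp (c * n) := Real.one_le_exp (by positivity)
    linarith
  refine ⟨M, Nat.le_ceil _, fun s => ?_⟩
  set γ := Real.exp ((c + δ) * n) with hγ
  have hγ0 : 0 < γ := Real.exp_pos _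
  have hMγ : (M : ℝ) / γ ≤ η / 2 := by
    have h1 : (M : ℝ) / γ ≤ 2 * Real.exp (-δ) ^ n := by
      rw [div_le_iff₀ hγ0, ← Real.exp_nat_mul, hγ, mul_assoc, ← Real.exp_add]
      refine hMle.trans (le_of_eq ?_)
      congr 2; ring
    have h2 := pow_le_pow_of_le_one (Real.exp_pos _).le hlt2.le hn2
    linarith
  have hinfo : ∑ a, codeLaw π a * ∑ b, (if K.pathProb n a s b ≤ γ * K.mixProb π n s b then
        K.pathProb n a s b else 0) ≤ η / 2 := by
    refine (sum_codeLaw_indicator_le hπ0 hπ1 hα.le hγ0 n s).trans ?_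
    have e : K.tilt π α = fun s z => π s z.1 * K.p s z.1 z.2 *
      Real.exp (-(α * Real.log (K.p s z.1 z.2 / K.q s (π s) z.2))) :=
      funext fun s => funext fun z => tilt_eq hπ0 α s z
    rw [e]
    refine (mul_le_mul_of_nonneg_left (hle α hα.le hαb n s) (Real.rpow_nonneg hγ0.le _)).trans ?_
    calc γ ^ α * (Real.exp b * Real.exp (-(α * (C - α * b ^ 2))) ^ n)
        = Real.exp b * Real.exp (-(α * (C - α * b ^ 2 - c - δ))) ^ n := by
          rw [hγ, ← Real.exp_mul, ← Real.exp_nat_mul, ← Real.exp_nat_mul, ← Real.exp_add,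
            ← Real.exp_add, ← Real.exp_add]
          congr 1; ring
      _ ≤ Real.exp b * Real.exp (-(α * δ)) ^ n := by
          gcongr
          rw [hδ] at hαδ ⊢; linarith
      _ ≤ Real.exp b * Real.exp (-(α * δ)) ^ N₁ := by
          refine mul_le_mul_of_nonneg_left ?_ (Real.exp_pos _).le
          exact pow_le_pow_of_le_one (Real.exp_pos _).le hlt1.le hn1
      _ ≤ η / 2 := by
          have := mul_le_mul_of_nonneg_left hN₁.le (Real.exp_pos b).le
          rwa [mul_div_cancel₀ _ (Real.exp_pos b).ne'] at this
  obtain ⟨code, dec, -, herr⟩ := exists_code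
    (W := fun (a : Fin n → S → X) (b : Fin n → S × Y) => K.pathProb n a s b)
    (fun a b => pathProb_nonneg _ _ _ _) (fun a => sum_pathProb _ _ _)
    (fun a => codeLaw_nonneg hπ0 a) (sum_codeLaw hπ1 n)
    (fun b => sum_codeLaw_mul_pathProb hπ1 n s b) hγ0 (by convert hinfo) M M le_rfl
  let x₀ : X := Classical.arbitrary X
  -- Undecoded outputs are sent to the value `M`, which is no message. The input `x₀` fills the
  -- times after the block and is never used.
  refine ⟨fun w => Function.extend Fin.val (code w) fun _ _ => x₀,
    Function.extend (List.ofFn (n := n)) (fun b => (dec b).getD M) fun _ => M, fun w => ?_⟩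
  rw [← sum_pathProb_mul n (Function.extend Fin.val (code w) fun _ _ => x₀)]
  have e1 : (fun i : Fin n => Function.extend Fin.val (code w) (fun _ _ => x₀) (i : ℕ)) = code w :=
    funext fun i => Fin.val_injective.extend_apply _ _ i
  rw [e1]
  refine le_trans (Finset.sum_le_sum fun b _ => ?_) ((herr w w.2).trans (by linarith))
  rw [List.ofFn_injective.extend_apply]
  by_cases h : dec b = some (w : ℕ)
  · simp [h]
  · simp only [h, if_false]
    refine mul_le_of_le_one_right (pathProb_nonneg _ _ _ _) ?_
    split_ifs <;> norm_num

end MarkovChannel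

/-! ### Block codes with a confirmation phase. -/

namespace MarkovChannel

variable {S X Y : Type*} [Fintype S] [Fintype Y] {K : MarkovChannel S X Y}

lemma expect_le_one (n : ℕ) (ψ : List (S × Y) → X) (s : S) {F : List (S × Y) → ℝ}
    (h : ∀ l, F l ≤ 1) : K.expect n ψ s F ≤ 1 :=
  (expect_mono n ψ s fun l _ => h l).trans_eq (expect_const n 1 ψ s)

end MarkovChannel

/-- A block code of length `n` with feedback: inputs and decisions depend on the state at the
beginning of the block and the outcomes in the block. The decoder may reject. -/
structure BlockCode (S X Y : Type*) where
  size : ℕ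
  n : ℕ
  input : Fin size → S → List (S × Y) → X
  dec : S → List (S × Y) → Option (Fin size)

open Classical in
/-- `r` bounds the probability of rejection, and `b` that of a wrong decision. -/
structure BlockCode.IsReliable {S X Y : Type*} [Fintype S] [Fintype Y] (B : BlockCode S X Y)
    (K : MarkovChannel S X Y) (r b : ℝ) : Prop where
  reject_le : ∀ w s, K.expect B.n (B.input w s) s (fun l => if B.dec s l = none then 1 else 0) ≤ r
  wrong_le : ∀ w s, K.expect B.n (B.input w s) s
    (fun l => if B.dec s l ≠ none ∧ B.dec s l ≠ some w then 1 else 0) ≤ b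

namespace MarkovChannel

variable {S X Y : Type*} [Fintype S] [Fintype Y] [Fintype X] {K : MarkovChannel S X Y}

/-- Communication phase followed by a confirmation phase. -/
lemma Ergodic.exists_blockCode [Nonempty X] (hE : K.Ergodic) {β : ℕ → ℝ} (hβ : K.Confirmable β)
    (hβ0 : ∀ n, 0 ≤ β n) {c : ℝ} (hc0 : 0 ≤ c) (hc : c < K.capacity) {η : ℝ} (hη : 0 < η) :
    ∃ N : ℕ, ∀ n₁ ≥ N, ∀ n₂ ≥ N, ∃ B : BlockCode S X Y, B.n = n₁ + n₂ ∧
      Real.exp (c * n₁) ≤ B.size ∧ B.IsReliable K (η + η) (β n₂ * η) := by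
  classical
  obtain ⟨N₁, hN₁⟩ := hE.exists_block_code hc0 hc hη
  obtain ⟨f, f', hff⟩ := hβ
  obtain ⟨N₂, hN₂⟩ := hff η hη
  refine ⟨max N₁ N₂, fun n₁ hn₁ n₂ hn₂ => ?_⟩
  obtain ⟨M, hM, hcode⟩ := hN₁ n₁ ((le_max_left _ _).trans hn₁)
  obtain ⟨acc, hacc⟩ := hN₂ n₂ ((le_max_right _ _).trans hn₂)
  choose a d had using hcode
  -- Through feedback the encoder knows the tentative decision: it confirms with `f` if this is the
  -- message and denies with `f'` if not.
  let ψ : Fin M → S → List (S × Y) → X := fun w s l =>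
    if l.length < n₁ then a s w l.length (lastState s l)
    else if d s (l.take n₁) = w then f (lastState s l) else f' (lastState s l)
  let D : S → List (S × Y) → Option (Fin M) := fun s l =>
    if h : d s (l.take n₁) < M ∧ acc (lastState s (l.take n₁)) (l.drop n₁) then some ⟨_, h.1⟩
    else none
  have hDnone : ∀ s l l', l.length = n₁ → (D s (l ++ l') = none ↔
      ¬ (d s l < M ∧ acc (lastState s l) l')) := by
    intro s l l' hl
    simp only [D, List.take_left' hl, List.drop_left' hl]
    split_ifs with h <;> simp [h]
  have hDsome : ∀ s l l' (w : Fin M), l.length = n₁ → D s (l ++ l') ≠ none →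
      D s (l ++ l') ≠ some w → d s l ≠ w := by
    intro s l l' w hl h1 h2 h3
    rw [Ne, hDnone s l l' hl, not_not] at h1
    refine h2 ?_
    simp only [D, List.take_left' hl, List.drop_left' hl]
    rw [dif_pos h1]
    exact congrArg some (Fin.ext h3)
  have hψ : ∀ (w : Fin M) s l, l.length = n₁ → (fun l' => ψ w s (l ++ l')) = fun l' =>
      if d s l = w then f (lastState (lastState s l) l') else f' (lastState (lastState s l) l') := by
    intro w s l hl
    funext l'
    have : ¬ (l ++ l').length < n₁ := by rw [List.length_append, hl]; omega
    simp only [ψ, this, if_false, List.take_left' hl, lastState_append]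
  have hfirst : ∀ (w : Fin M) s, K.expect n₁ (ψ w s) s (fun l => if d s l = w then 0 else 1) ≤ η := by
    intro w s
    refine le_trans (le_of_eq ?_) (had s w)
    exact expect_congr n₁ s (fun l hl => by simp only [ψ, hl, if_true]) fun _ _ => rfl
  refine ⟨⟨M, n₁ + n₂, ψ, D⟩, rfl, hM, ?_, ?_⟩
  · intro w s
    rw [expect_append]
    have hin : ∀ l : List (S × Y), l.length = n₁ →
        K.expect n₂ (fun l' => ψ w s (l ++ l')) (lastState s l)
          (fun l' => if D s (l ++ l') = none then 1 else 0)
        ≤ (if d s l = w then 0 else 1) + η := by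
      intro l hl
      rw [hψ w s l hl]
      by_cases h : d s l = w
      · simp only [h, if_true, zero_add]
        refine le_trans (expect_mono n₂ _ _ fun l' _ => ?_) (hacc (lastState s l)).1
        have : d s l < M := h ▸ w.2
        by_cases h2 : acc (lastState s l) l'
        · simp [hDnone s l l' hl, h2, this]
        · simp only [h2, if_false]
          split_ifs <;> norm_num
      · simp only [h, if_false]
        refine (expect_le_one n₂ _ _ fun l' => ?_).trans (by linarith)
        split_ifs <;> norm_num
    refine (expect_mono n₁ _ s hin).trans ?_
    rw [expect_add, expect_const]
    linarith [hfirst w s]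
  · intro w s
    rw [expect_append]
    -- An accepted wrong decision needs both an error in the first phase and a false acceptance in
    -- the second, which explains the product of the bounds.
    have hin : ∀ l : List (S × Y), l.length = n₁ →
        K.expect n₂ (fun l' => ψ w s (l ++ l')) (lastState s l)
          (fun l' => if D s (l ++ l') ≠ none ∧ D s (l ++ l') ≠ some w then 1 else 0)
        ≤ β n₂ * (if d s l = w then 0 else 1) := by
      intro l hl
      rw [hψ w s l hl]
      by_cases h : d s l = w
      · simp only [h, if_true, mul_zero]
        refine (expect_mono (G := fun _ => 0) n₂ _ _ fun l' _ => ?_).trans_eq (expect_const _ _ _ _)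
        rw [if_neg]
        exact fun h2 => hDsome s l l' w hl h2.1 h2.2 h
      · simp only [h, if_false, mul_one]
        refine le_trans (expect_mono n₂ _ _ fun l' _ => ?_) (hacc (lastState s l)).2
        by_cases h2 : acc (lastState s l) l'
        · simp only [h2, if_true]
          split_ifs <;> norm_num
        · have : D s (l ++ l') = none := (hDnone s l l' hl).2 fun h3 => h2 h3.2
          simp [this, h2]
    refine (expect_mono n₁ _ s hin).trans ?_
    rw [expect_const_mul]
    exact mul_le_mul_of_nonneg_left (hfirst w s) (hβ0 n₂)

end MarkovChannel

/-! ### Repetition of a block code until a block is accepted. -/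

namespace BlockCode

variable {S X Y : Type*} (B : BlockCode S X Y)

/-- The length of a block, including one final channel use that shows the last state. -/
abbrev len : ℕ := B.n + 1

/-- The input when the block code is used again and again. -/
def runInput (w : Fin B.size) (s : S) (l : List (S × Y)) : X :=
  B.input w (lastState s (l.take (l.length / B.len * B.len))) (l.drop (l.length / B.len * B.len))

/-- The decision in the block number `j`. -/
def decision (j : ℕ) (s : S) (l : List (S × Y)) : Option (Fin B.size) :=
  B.dec (lastState s (l.take (j * B.len))) ((l.drop (j * B.len)).take B.n)

/-- All blocks before the block number `k` are rejected. -/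
def Rejected (k : ℕ) (s : S) (l : List (S × Y)) : Prop := ∀ j < k, B.decision j s l = none

/-- The first block that is not rejected is block number `k`, and its decision is not `w`. -/
def FirstWrong (w : Fin B.size) (k : ℕ) (s : S) (l : List (S × Y)) : Prop :=
  B.Rejected k s l ∧ B.decision k s l ≠ none ∧ B.decision k s l ≠ some w

lemma decision_append {j : ℕ} {l : List (S × Y)} (hl : j * B.len + B.n ≤ l.length) (s : S)
    (l' : List (S × Y)) : B.decision j s (l ++ l') = B.decision j s l := by
  rw [decision, decision, List.take_append_of_le_length (by omega),
    List.drop_append_of_le_length (by omega), List.take_append_of_le_length]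
  rw [List.length_drop]; omega

lemma decision_last {k : ℕ} {l : List (S × Y)} (hl : l.length = k * B.len) (s : S)
    (l' : List (S × Y)) : B.decision k s (l ++ l') = B.dec (lastState s l) (l'.take B.n) := by
  rw [decision, List.take_left' hl, List.drop_left' hl]

lemma rejected_append {k : ℕ} {l : List (S × Y)} (hl : l.length = k * B.len) (s : S)
    (l' : List (S × Y)) : B.Rejected k s (l ++ l') ↔ B.Rejected k s l := by
  refine forall₂_congr fun j hj => ?_
  rw [B.decision_append]
  rw [hl]
  have : (j + 1) * B.len ≤ k * B.len := Nat.mul_le_mul_right _ hj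
  simp only [len] at *
  linarith

lemma runInput_append {k : ℕ} {l : List (S × Y)} (hl : l.length = k * B.len) (w : Fin B.size)
    (s : S) {l' : List (S × Y)} (hl' : l'.length < B.len) :
    B.runInput w s (l ++ l') = B.input w (lastState s l) l' := by
  have : (l ++ l').length / B.len = k := by
    rw [List.length_append, hl, mul_comm, Nat.mul_add_div (Nat.succ_pos _),
      Nat.div_eq_of_lt hl', add_zero]
  rw [runInput, this, List.take_left' hl, List.drop_left' hl]

variable [Fintype S] [Fintype Y] {B} {K : MarkovChannel S X Y} {r b : ℝ}

open Classical in
lemma expect_block (w : Fin B.size) (s : S) (F : List (S × Y) → ℝ) :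
    K.expect B.len (B.input w s) s (fun l => F (l.take B.n)) = K.expect B.n (B.input w s) s F := by
  rw [len, MarkovChannel.expect_append]
  refine MarkovChannel.expect_congr _ _ (fun _ _ => rfl) fun l hl => ?_
  simp only [List.take_left' hl, MarkovChannel.expect_const]

open Classical in
/-- One more block after `k` rejected blocks. -/
lemma expect_rejected_succ_le (k : ℕ) (w : Fin B.size) (s : S) {q : ℝ}
    (F : S → List (S × Y) → Prop)
    (hF : ∀ s, K.expect B.n (B.input w s) s (fun l => if F s l then 1 else 0) ≤ q)
    (G : List (S × Y) → Prop)
    (hG : ∀ l l', l.length = k * B.len →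
      (G (l ++ l') → B.Rejected k s l ∧ F (lastState s l) (l'.take B.n))) :
    K.expect ((k + 1) * B.len) (B.runInput w s) s (fun l => if G l then 1 else 0)
      ≤ q * K.expect (k * B.len) (B.runInput w s) s
        (fun l => if B.Rejected k s l then 1 else 0) := by
  rw [Nat.succ_mul, MarkovChannel.expect_append, ← MarkovChannel.expect_const_mul]
  refine MarkovChannel.expect_mono _ _ _ fun l hl => ?_
  rw [MarkovChannel.expect_congr B.len (lastState s l) (ψ' := B.input w (lastState s l))
    (fun l' hl' => B.runInput_append hl w s hl') (fun _ _ => rfl)]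
  by_cases hR : B.Rejected k s l
  · simp only [hR, if_true, mul_one]
    refine le_trans (MarkovChannel.expect_mono _ _ _ fun l' _ => ?_)
      ((expect_block w (lastState s l) fun l' => if F (lastState s l) l' then 1 else 0).le.trans
        (hF (lastState s l)))
    by_cases h : G (l ++ l')
    · simp [h, (hG l l' hl h).2]
    · simp only [h, if_false]
      split_ifs <;> norm_num
  · simp only [hR, if_false, mul_zero]
    refine (MarkovChannel.expect_mono (G := fun _ => 0) _ _ _ fun l' _ => ?_).trans_eq
      (MarkovChannel.expect_const _ _ _ _)
    rw [if_neg]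
    exact fun h => hR (hG l l' hl h).1

open Classical in
lemma IsReliable.expect_rejected_le (hB : B.IsReliable K r b) (hr : 0 ≤ r) (w : Fin B.size) (s : S)
    (k : ℕ) : K.expect (k * B.len) (B.runInput w s) s
      (fun l => if B.Rejected k s l then 1 else 0) ≤ r ^ k := by
  induction k with
  | zero => simp [MarkovChannel.expect, Rejected]
  | succ k ih =>
    refine (expect_rejected_succ_le k w s (q := r) (fun s l => B.dec s l = none)
      (fun s => by convert hB.reject_le w s) _
      fun l l' hl h => ⟨?_, ?_⟩).trans ?_
    · exact (B.rejected_append hl s l').1 fun j hj => h j (Nat.lt_succ_of_lt hj)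
    · rw [← B.decision_last hl]
      exact h k (Nat.lt_succ_self k)
    · rw [pow_succ, mul_comm]
      exact mul_le_mul_of_nonneg_right ih hr

open Classical in
lemma IsReliable.expect_firstWrong_le (hB : B.IsReliable K r b) (hr : 0 ≤ r) (hb : 0 ≤ b)
    (w : Fin B.size) (s : S) (k : ℕ) : K.expect ((k + 1) * B.len) (B.runInput w s) s
      (fun l => if B.FirstWrong w k s l then 1 else 0) ≤ b * r ^ k := by
  refine (expect_rejected_succ_le k w s (fun s l => B.dec s l ≠ none ∧ B.dec s l ≠ some w)
    (q := b) (fun s => by convert hB.wrong_le w s) _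
    fun l l' hl h => ⟨(B.rejected_append hl s l').1 h.1, ?_⟩).trans ?_
  · rw [← B.decision_last hl]
    exact h.2
  · exact mul_le_mul_of_nonneg_left (hB.expect_rejected_le hr w s k) hb

end BlockCode

/-! ### Existence of a transmission for every encoder. -/

section Simulation

variable {S : Type*} {X : Type*} {Y : Type*} (Φ : CausalEncoder S X Y)

/-- The outcomes that result when `g (t, s, x)` is the outcome at time `t` of the input `x` in the
state `s`. -/
def CausalEncoder.simulate (ω : Φ.Msg × S × (ℕ × S × X → S × Y)) : ℕ → List (S × Y)
  | 0 => []
  | t + 1 => simulate ω t ++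
      [ω.2.2 (t, lastState ω.2.1 (simulate ω t), Φ.enc ω.1 ω.2.1 (simulate ω t))]

namespace CausalEncoder

variable (ω : Φ.Msg × S × (ℕ × S × X → S × Y))

@[simp] lemma length_simulate (t : ℕ) : (Φ.simulate ω t).length = t := by
  induction t with
  | zero => rfl
  | succ t ih => simp [simulate, ih]

/-- The state at time `t` in a simulation. -/
def simState (t : ℕ) : S := lastState ω.2.1 (Φ.simulate ω t)

/-- The input at time `t` in a simulation. -/
def simInput (t : ℕ) : X := Φ.enc ω.1 ω.2.1 (Φ.simulate ω t)

/-- The outcome at time `t` in a simulation. -/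
def simOutcome (t : ℕ) : S × Y := ω.2.2 (t, Φ.simState ω t, Φ.simInput ω t)

lemma simulate_succ (t : ℕ) : Φ.simulate ω (t + 1) = Φ.simulate ω t ++ [Φ.simOutcome ω t] := rfl

lemma simState_succ (t : ℕ) : Φ.simState ω (t + 1) = (Φ.simOutcome ω t).1 := by
  simp [simState, simulate_succ]

lemma simulate_getElem (t i : ℕ) (h : i < (Φ.simulate ω t).length) :
    (Φ.simulate ω t)[i] = Φ.simOutcome ω i := by
  induction t with
  | zero => simp [simulate] at h
  | succ t ih =>
    rw [length_simulate] at h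
    simp only [simulate_succ]
    rcases Nat.lt_succ_iff_lt_or_eq.1 h with h | rfl
    · rw [List.getElem_append_left (by simpa using h)]
      exact ih _
    · simp

lemma φ_simulate (t : ℕ) : Φ.φ t ω.1 (fun i => (Φ.simOutcome ω i).2) (fun i => Φ.simState ω i)
    = Φ.simInput ω t := by
  refine Φ.φ_eq_enc ω.1 _ _ (Φ.length_simulate ω t) fun i => ?_
  rw [List.get_eq_getElem, simulate_getElem, Fin.val_succ, simState_succ]
  rfl

variable {Φ ω} in
-- A run consults one cell of the table per time. Agreement with a reference run thus only
-- constrains the cells visited by the reference, which turns histories into product events.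
lemma simulate_eq_iff {ω' : Φ.Msg × S × (ℕ × S × X → S × Y)} (hw : ω.1 = ω'.1)
    (hs : ω.2.1 = ω'.2.1) {t : ℕ} : Φ.simulate ω t = Φ.simulate ω' t ↔
      ∀ i < t, ω.2.2 (i, Φ.simState ω' i, Φ.simInput ω' i) = Φ.simOutcome ω' i := by
  induction t with
  | zero => simp [simulate]
  | succ t ih =>
    rw [simulate_succ, simulate_succ]
    have key : Φ.simulate ω t = Φ.simulate ω' t →
        ω.2.2 (t, Φ.simState ω' t, Φ.simInput ω' t) = Φ.simOutcome ω t := by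
      intro h
      rw [simOutcome, simState, simInput, simState, simInput, h, hw, hs]
    constructor
    · intro h i hi
      obtain ⟨h1, h2⟩ := List.append_inj' h rfl
      rcases Nat.lt_succ_iff_lt_or_eq.1 hi with h' | rfl
      · exact ih.1 h1 i h'
      · rw [key h1]
        exact List.singleton_inj.1 h2
    · intro h
      have h1 := ih.2 fun i hi => h i (Nat.lt_succ_of_lt hi)
      rw [← key h1, h t (Nat.lt_succ_self t), h1]

section Measurable

variable [MeasurableSpace S] [DiscreteMeasurableSpace S] [MeasurableSpace Y]
  [DiscreteMeasurableSpace Y] [MeasurableSpace Φ.Msg] [DiscreteMeasurableSpace Φ.Msg]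
  [Finite S] [Finite Y]

/-- Once the message, the initial state and the past outcomes are fixed, the next cell consulted is
fixed as well, and measurability reduces to that of one coordinate. -/
lemma measurableSet_simulate (t : ℕ) (l : List (S × Y)) :
    MeasurableSet {ω | Φ.simulate ω t = l} := by
  induction t generalizing l with
  | zero => simp [simulate]
  | succ t ih =>
    rcases List.eq_nil_or_concat' l with rfl | ⟨l, o, rfl⟩
    · simp [simulate]
    have : {ω | Φ.simulate ω (t + 1) = l ++ [o]} = ⋃ (w : Φ.Msg) (s : S),
        {ω | Φ.simulate ω t = l} ∩ ({ω | ω.1 = w} ∩ ({ω | ω.2.1 = s} ∩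
          {ω | ω.2.2 (t, lastState s l, Φ.enc w s l) = o})) := by
      ext ω
      simp only [simulate, Set.mem_ofPred_eq, Set.mem_iUnion, Set.mem_inter_iff]
      constructor
      · intro h
        obtain ⟨h1, h2⟩ := List.append_inj' h rfl
        rw [h1] at h2
        exact ⟨_, _, h1, rfl, rfl, List.singleton_inj.1 h2⟩
      · rintro ⟨w, s, h1, rfl, rfl, rfl⟩
        rw [h1]
    rw [this]
    refine MeasurableSet.iUnion fun w => MeasurableSet.iUnion fun s => (ih l).inter
      (.inter ?_ (.inter ?_ ?_))
    · exact measurable_fst (measurableSet_singleton w)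
    · exact (measurable_fst.comp measurable_snd) (measurableSet_singleton s)
    · exact ((measurable_pi_apply (X := fun _ : ℕ × S × X => S × Y) _).comp
        (measurable_snd.comp measurable_snd)) (measurableSet_singleton o)

/-- Functions of the message, the initial state and finitely many outcomes are measurable. -/
lemma measurable_simulate {β : Type*} {f : Φ.Msg × S × (ℕ × S × X → S × Y) → β} (t : ℕ)
    (F : Φ.Msg → S → List (S × Y) → β) (hf : ∀ ω, f ω = F ω.1 ω.2.1 (Φ.simulate ω t)) :
    Measurable[_, ⊤] f := by
  intro A _
  have : f ⁻¹' A = ⋃ (w : Φ.Msg) (s : S) (l : List (S × Y)) (_ : F w s l ∈ A),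
      {ω | Φ.simulate ω t = l} ∩ ({ω | ω.1 = w} ∩ {ω | ω.2.1 = s}) := by
    ext ω
    simp only [Set.mem_preimage, Set.mem_iUnion, Set.mem_inter_iff, Set.mem_ofPred_eq, hf]
    constructor
    · exact fun h => ⟨_, _, _, h, rfl, rfl, rfl⟩
    · rintro ⟨w, s, l, h, rfl, rfl, rfl⟩
      exact h
  rw [this]
  refine MeasurableSet.iUnion fun w => MeasurableSet.iUnion fun s => MeasurableSet.iUnion fun l =>
    MeasurableSet.iUnion fun _ => (Φ.measurableSet_simulate t l).inter (.inter ?_ ?_)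
  · exact measurable_fst (measurableSet_singleton w)
  · exact (measurable_fst.comp measurable_snd) (measurableSet_singleton s)

end Measurable

end CausalEncoder

/-- The probability of outcomes of independent experiments, one at each time. -/
lemma infinitePi_outcomes {ι O : Type*} [MeasurableSpace O] [DiscreteMeasurableSpace O]
    (κ : ι → PMF O) (x : ℕ → ι) (o : ℕ → O) (t : ℕ) :
    Measure.infinitePi (fun j : ℕ × ι => (κ j.2).toMeasure) {g | ∀ i < t, g (i, x i) = o i}
      = ∏ i ∈ Finset.range t, κ (x i) (o i) := by
  classical
  have : {g : ℕ × ι → O | ∀ i < t, g (i, x i) = o i} =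
      Set.pi (((Finset.range t).image fun i => (i, x i) : Finset (ℕ × ι)) : Set (ℕ × ι))
        fun j => {o j.1} := by
    ext g
    simp [Set.mem_pi]
  rw [this, Measure.infinitePi_pi _ fun _ _ => measurableSet_singleton _, Finset.prod_image]
  · exact Finset.prod_congr rfl fun i _ => PMF.toMeasure_apply_singleton _ _ (measurableSet_singleton _)
  · exact fun i _ j _ h => (Prod.ext_iff.1 h).1

end Simulation

/-- Every encoder can be used on every channel. -/
theorem Transmission.exists_of_encoder {S : Type u} {X : Type v} {Y : Type w} [Finite S]
    [Finite Y] (K : MarkovChannel S X Y) (Φ : CausalEncoder S X Y) [Nonempty Φ.Msg] :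
    ∃ (Ω : Type (max u v w)) (_ : MeasurableSpace Ω) (Pr : Measure Ω),
      Nonempty (Transmission K Φ Pr) := by
  let mS : MeasurableSpace S := ⊤
  let mY : MeasurableSpace Y := ⊤
  let mM : MeasurableSpace Φ.Msg := ⊤
  have : DiscreteMeasurableSpace S := ⟨fun _ => trivial⟩
  have : DiscreteMeasurableSpace Y := ⟨fun _ => trivial⟩
  have : DiscreteMeasurableSpace Φ.Msg := ⟨fun _ => trivial⟩
  -- An outcome is drawn independently for every time, state and input beforehand; the encoder reads
  -- off the cells that it visits.
  let ν : Measure (ℕ × S × X → S × Y) :=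
    Measure.infinitePi fun j : ℕ × S × X => (K.P j.2.1 j.2.2).toMeasure
  let Pr : Measure (Φ.Msg × S × (ℕ × S × X → S × Y)) :=
    (PMF.uniformOfFintype Φ.Msg).toMeasure.prod (K.init.toMeasure.prod ν)
  have hPr : ∀ w s A, Pr ({w} ×ˢ ({s} ×ˢ A)) = (Fintype.card Φ.Msg : ℝ≥0∞)⁻¹ * (K.init s * ν A) := by
    intro w s A
    simp only [Pr, Measure.prod_prod, PMF.toMeasure_apply_singleton _ _ (measurableSet_singleton _),
      PMF.uniformOfFintype_apply]
  have hMsg : ∀ w, Pr {ω | ω.1 = w} = (Fintype.card Φ.Msg : ℝ≥0∞)⁻¹ := by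
    intro w
    have : {ω : Φ.Msg × S × (ℕ × S × X → S × Y) | ω.1 = w} = {w} ×ˢ Set.univ := by ext; simp
    rw [this, Measure.prod_prod, PMF.toMeasure_apply_singleton _ _ (measurableSet_singleton _),
      PMF.uniformOfFintype_apply, measure_univ, mul_one]
  refine ⟨_, _, Pr, ⟨⟨inferInstance, fun ω => ω.1, fun t ω => Φ.simInput ω t,
    fun t ω => (Φ.simOutcome ω t).2, fun t ω => Φ.simState ω t, ?_, ?_, ?_, ?_, hMsg, ?_, ?_, ?_⟩⟩⟩
  · exact Φ.measurable_simulate 0 (fun w _ _ => w) fun _ => rfl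
  · exact fun t => Φ.measurable_simulate t (fun w s l => Φ.enc w s l) fun _ => rfl
  · intro t A hA
    refine Φ.measurable_simulate (f := fun ω => (Φ.simOutcome ω t).2 ∈ A) (t + 1)
      (fun _ _ l => ∃ h : l ≠ [], (l.getLast h).2 ∈ A) (fun ω => ?_)
      (show MeasurableSet[⊤] {True} from trivial) |> fun h => by simpa [Set.preimage] using h
    simp [CausalEncoder.simulate_succ]
  · exact fun t => Φ.measurable_simulate t (fun _ s l => lastState s l) fun _ => rfl
  · intro w s
    rw [hMsg]
    have : {ω : Φ.Msg × S × (ℕ × S × X → S × Y) | ω.1 = w ∧ Φ.simState ω 0 = s}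
        = {w} ×ˢ ({s} ×ˢ Set.univ) := by
      ext; simp [CausalEncoder.simState, CausalEncoder.simulate]
    rw [this, hPr, measure_univ, mul_one]
  · exact fun t => ae_of_all _ fun ω => (Φ.φ_simulate ω t).symm
  · intro t w s x y s' y'
    set E := {ω : Φ.Msg × S × (ℕ × S × X → S × Y) | ω.1 = w ∧
      (∀ i : Fin (t + 1), Φ.simState ω i = s i) ∧ (∀ i : Fin (t + 1), Φ.simInput ω i = x i) ∧
        ∀ i : Fin t, (Φ.simOutcome ω i).2 = y i} with hE
    have hE' : {ω : Φ.Msg × S × (ℕ × S × X → S × Y) | (ω.1 = w ∧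
      (∀ i : Fin (t + 1), Φ.simState ω i = s i) ∧ (∀ i : Fin (t + 1), Φ.simInput ω i = x i) ∧
        ∀ i : Fin t, (Φ.simOutcome ω i).2 = y i) ∧ Φ.simState ω (t + 1) = s' ∧
          (Φ.simOutcome ω t).2 = y'} = E ∩ {ω | Φ.simOutcome ω t = (s', y')} := by
      ext ω
      simp only [hE, Set.mem_inter_iff, Set.mem_ofPred_eq, CausalEncoder.simState_succ,
        Prod.ext_iff]
    rw [hE']
    rcases E.eq_empty_or_nonempty with h0 | ⟨ω₀, hω₀⟩
    · rw [h0]; simp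
    obtain ⟨hw, hs, hx, hy⟩ := hω₀
    -- The outcomes of the reference run, continued at time `t` by the outcome in question.
    let o : ℕ → S × Y := fun i => if i < t then Φ.simOutcome ω₀ i else (s', y')
    let ξ : ℕ → S × X := fun i => (Φ.simState ω₀ i, Φ.simInput ω₀ i)
    have hsim : ∀ ω : Φ.Msg × S × (ℕ × S × X → S × Y), ω ∈ E ↔ ω.1 = ω₀.1 ∧ ω.2.1 = ω₀.2.1 ∧
        Φ.simulate ω t = Φ.simulate ω₀ t := by
      intro ω
      constructor
      · rintro ⟨h1, h2, h3, h4⟩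
        have e1 : ω.1 = ω₀.1 := h1.trans hw.symm
        have e2 : ω.2.1 = ω₀.2.1 := (h2 0).trans (hs 0).symm
        refine ⟨e1, e2, (CausalEncoder.simulate_eq_iff e1 e2).2 fun i hi => ?_⟩
        have a1 := (h2 ⟨i, by omega⟩).trans (hs ⟨i, by omega⟩).symm
        have a2 := (h2 ⟨i + 1, by omega⟩).trans (hs ⟨i + 1, by omega⟩).symm
        have a3 := (h3 ⟨i, by omega⟩).trans (hx ⟨i, by omega⟩).symm
        have a4 := (h4 ⟨i, hi⟩).trans (hy ⟨i, hi⟩).symm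
        simp only [CausalEncoder.simState_succ] at a1 a2 a3 a4
        rw [← a1, ← a3]
        exact Prod.ext a2 a4
      · rintro ⟨e1, e2, h⟩
        have hpre : ∀ i ≤ t, Φ.simulate ω i = Φ.simulate ω₀ i := fun i hi =>
          (CausalEncoder.simulate_eq_iff e1 e2).2 fun j hj =>
            (CausalEncoder.simulate_eq_iff e1 e2).1 h j (hj.trans_le hi)
        refine ⟨e1.trans hw, fun i => ?_, fun i => ?_, fun i => ?_⟩
        · rw [← hs i, CausalEncoder.simState, CausalEncoder.simState,
            hpre i (Nat.lt_succ_iff.1 i.2), e2]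
        · rw [← hx i, CausalEncoder.simInput, CausalEncoder.simInput,
            hpre i (Nat.lt_succ_iff.1 i.2), e1, e2]
        · rw [← hy i]
          have := hpre (i + 1) i.2
          rw [CausalEncoder.simulate_succ, CausalEncoder.simulate_succ] at this
          rw [List.singleton_inj.1 (List.append_inj' this rfl).2]
    have hbox : E = {ω₀.1} ×ˢ ({ω₀.2.1} ×ˢ {g | ∀ i < t, g (i, ξ i) = o i}) := by
      ext ω
      rw [hsim]
      simp only [Set.mem_prod, Set.mem_singleton_iff, Set.mem_ofPred_eq]
      refine and_congr_right fun e1 => and_congr_right fun e2 => ?_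
      rw [CausalEncoder.simulate_eq_iff e1 e2]
      exact forall₂_congr fun i hi => by simp only [o, ξ, hi, if_true]
    have hbox' : E ∩ {ω | Φ.simOutcome ω t = (s', y')} =
        {ω₀.1} ×ˢ ({ω₀.2.1} ×ˢ {g | ∀ i < t + 1, g (i, ξ i) = o i}) := by
      ext ω
      have hstep : ω ∈ E → Φ.simOutcome ω t = ω.2.2 (t, ξ t) := by
        intro h
        obtain ⟨e1, e2, h⟩ := (hsim ω).1 h
        simp only [CausalEncoder.simOutcome, ξ, CausalEncoder.simState, CausalEncoder.simInput,
          h, e1, e2]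
      have hmem : ω ∈ E ↔ ω.1 = ω₀.1 ∧ ω.2.1 = ω₀.2.1 ∧ ∀ i < t, ω.2.2 (i, ξ i) = o i := by
        rw [hbox]; simp [Set.mem_prod]
      have ho : o t = (s', y') := by simp [o]
      simp only [Set.mem_inter_iff, Set.mem_prod, Set.mem_singleton_iff, Set.mem_ofPred_eq,
        Nat.forall_lt_succ_right, ho]
      constructor
      · rintro ⟨h, h'⟩
        obtain ⟨e1, e2, h3⟩ := hmem.1 h
        exact ⟨e1, e2, h3, (hstep h).symm.trans h'⟩
      · rintro ⟨e1, e2, h3, h4⟩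
        have := hmem.2 ⟨e1, e2, h3⟩
        exact ⟨this, (hstep this).trans h4⟩
    have hν := infinitePi_outcomes (fun j : S × X => K.P j.1 j.2) ξ o
    rw [hbox', hbox, hPr, hPr, hν, hν, Finset.prod_range_succ, ← mul_assoc, ← mul_assoc,
      ← mul_assoc]
    congr 1
    rw [show o t = (s', y') by simp [o], ← hs (Fin.last t), ← hx (Fin.last t)]
    rfl

/-! ### The variable-length scheme obtained from a repeated block code. -/

namespace Transmission

variable {S X Y : Type*} {K : MarkovChannel S X Y} {Φ : CausalEncoder S X Y}
  {Ω : Type*} [m : MeasurableSpace Ω] {Pr : Measure Ω} (τ : Transmission K Φ Pr)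

lemma exists_hist_eq_append {t t' : ℕ} (h : t ≤ t') (ω : Ω) :
    ∃ l, τ.hist t' ω = τ.hist t ω ++ l := by
  obtain ⟨k, rfl⟩ := Nat.exists_eq_add_of_le h
  refine ⟨((List.range k).map fun i => t + i).map fun i => (τ.state (i + 1) ω, τ.output i ω), ?_⟩
  rw [hist, List.range_add, List.map_append]
  rfl

/-- `hist t'` contains the state at time `t'`, which the receiver sees only after one more channel
use. Hence the strict inequality, and the extra use at the end of each block. -/
lemma measurableSet_hist_receiver {t t' : ℕ} (h : t' < t) (l : List (S × Y)) :
    MeasurableSet[τ.receiverFiltration t] {ω | τ.hist t' ω = l} := by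
  induction t' generalizing l with
  | zero => simp [hist]
  | succ t' ih =>
    rcases List.eq_nil_or_concat' l with rfl | ⟨l, o, rfl⟩
    · simp [hist_succ]
    have : {ω | τ.hist (t' + 1) ω = l ++ [o]} = {ω | τ.hist t' ω = l} ∩
        (τ.state (t' + 1) ⁻¹' {o.1} ∩ τ.output t' ⁻¹' {o.2}) := by
      ext ω
      simp only [hist_succ, Set.mem_ofPred_eq, Set.mem_inter_iff, Set.mem_preimage,
        Set.mem_singleton_iff]
      constructor
      · intro h
        obtain ⟨h1, h2⟩ := List.append_inj' h rfl
        exact ⟨h1, Prod.ext_iff.1 (List.singleton_inj.1 h2)⟩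
      · rintro ⟨h1, h2⟩
        rw [h1, h2.1, h2.2]
    rw [this]
    refine (ih (by omega) l).inter (.inter ?_ ?_)
    · refine (le_iSup₂_of_le (t' + 1) h le_sup_left :
        MeasurableSpace.comap (τ.state (t' + 1)) ⊤ ≤ _) _ ⟨_, trivial, rfl⟩
    · refine (le_iSup₂_of_le t' (by omega) le_sup_right :
        MeasurableSpace.comap (τ.output t') ⊤ ≤ _) _ ⟨_, trivial, rfl⟩

lemma measurableSet_receiver [Finite S] [Finite Y] {t t' : ℕ} (h : t' < t)
    (P : S → List (S × Y) → Prop) :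
    MeasurableSet[τ.receiverFiltration t] {ω | P (τ.state 0 ω) (τ.hist t' ω)} := by
  have : {ω | P (τ.state 0 ω) (τ.hist t' ω)} = ⋃ (s : S) (l : List (S × Y)) (_ : P s l),
      τ.state 0 ⁻¹' {s} ∩ {ω | τ.hist t' ω = l} := by
    ext ω
    simp only [Set.mem_iUnion, Set.mem_ofPred_eq, Set.mem_inter_iff, Set.mem_preimage,
      Set.mem_singleton_iff]
    constructor
    · exact fun h => ⟨_, _, h, rfl, rfl⟩
    · rintro ⟨s, l, h, rfl, rfl⟩
      exact h
  rw [this]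
  refine MeasurableSet.iUnion fun s => MeasurableSet.iUnion fun l => MeasurableSet.iUnion fun _ =>
    .inter ?_ (τ.measurableSet_hist_receiver h l)
  exact (le_iSup₂_of_le 0 (by omega) le_sup_left :
        MeasurableSpace.comap (τ.state 0) ⊤ ≤ _) _ ⟨_, trivial, rfl⟩

variable [Fintype S] [Fintype Y]

open Classical in
-- Induction on the number of remaining channel uses, with `nodeProb_append` for each outcome; this
-- passes from probabilities on `Ω` to the recursive expectations.
lemma real_histEvent_inter (w : Φ.Msg) (s : S) (F : List (S × Y) → Prop) (n : ℕ) :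
    ∀ l : List (S × Y), Pr.real (τ.histEvent s l ∩
        ({ω | τ.msg ω = w} ∩ {ω | F (τ.hist (l.length + n) ω)})) =
      τ.nodeProb s l w * K.expect n (fun l' => Φ.enc w s (l ++ l')) (lastState s l)
        (fun l' => if F (l ++ l') then 1 else 0) := by
  induction n with
  | zero =>
    intro l
    simp only [MarkovChannel.expect, List.append_nil, add_zero]
    by_cases h : F l
    · simp only [h, if_true, mul_one, nodeProb]
      congr 1
      ext ω
      simp only [histEvent, Set.mem_inter_iff, Set.mem_ofPred_eq]
      constructor
      · exact fun h => ⟨h.1, h.2.1⟩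
      · exact fun h' => ⟨h'.1, h'.2, by rw [h'.1.2]; exact h⟩
    · simp only [h, if_false, mul_zero]
      convert measureReal_empty
      refine Set.eq_empty_iff_forall_notMem.2 fun ω hω => h ?_
      have := hω.2.2
      simp only [Set.mem_ofPred_eq] at this
      rwa [hω.1.2] at this
  | succ n ih =>
    intro l
    rw [← sum_histEvent_append, MarkovChannel.expect, Finset.mul_sum]
    refine Finset.sum_congr rfl fun o _ => ?_
    have := ih (l ++ [o])
    simp only [List.length_append, List.length_singleton] at this
    rw [show l.length + (n + 1) = l.length + 1 + n by ring, this, nodeProb_append, mul_assoc]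
    simp

open Classical in
/-- A bound on the conditional probability given the message and the initial state is a bound on
the probability. -/
lemma real_le_of_expect_le {q : ℝ} (n : ℕ) (F : Φ.Msg → S → List (S × Y) → Prop)
    (h : ∀ w s, K.expect n (Φ.enc w s) s (fun l => if F w s l then 1 else 0) ≤ q) :
    Pr.real {ω | F (τ.msg ω) (τ.state 0 ω) (τ.hist n ω)} ≤ q := by
  have := τ.isProb
  rw [← τ.sum_histEvent_nil]
  calc ∑ s, Pr.real (τ.histEvent s [] ∩ {ω | F (τ.msg ω) (τ.state 0 ω) (τ.hist n ω)})
      = ∑ s, ∑ w, τ.nodeProb s [] w *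
          K.expect n (Φ.enc w s) s (fun l => if F w s l then 1 else 0) := by
        refine Finset.sum_congr rfl fun s _ => ?_
        rw [measureReal_eq_sum_fiber Pr (f := τ.msg) τ.measurableSet_msg]
        refine Finset.sum_congr rfl fun w _ => ?_
        have := τ.real_histEvent_inter w s (F w s) n []
        simp only [List.nil_append, lastState_nil, List.length_nil, zero_add] at this
        rw [← this, Set.inter_assoc]
        congr 1
        ext ω
        simp only [histEvent, Set.mem_inter_iff, Set.mem_ofPred_eq]
        constructor
        · rintro ⟨⟨rfl, h1⟩, h2, rfl⟩
          exact ⟨⟨rfl, h1⟩, rfl, h2⟩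
        · rintro ⟨⟨rfl, h1⟩, rfl, h2⟩
          exact ⟨⟨rfl, h1⟩, h2, rfl⟩
    _ ≤ ∑ s, ∑ w, τ.nodeProb s [] w * q := Finset.sum_le_sum fun s _ =>
        Finset.sum_le_sum fun w _ => mul_le_mul_of_nonneg_left (h w s) (τ.nodeProb_nonneg _ _ _)
    _ = q := by
        simp only [← Finset.sum_mul, sum_nodeProb]
        have := τ.sum_histEvent_nil Set.univ
        simp only [Set.inter_univ, probReal_univ] at this
        rw [this, one_mul]

end Transmission

namespace BlockCode

/-- The encoder that uses a block code again and again. -/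
def encoder {S X Y : Type*} (B : BlockCode S X Y) : CausalEncoder S X Y where
  Msg := Fin B.size
  φ _ w y s := B.runInput w (s 0) (List.ofFn fun i => (s i.succ, y i))

lemma encoder_enc {S X Y : Type*} (B : BlockCode S X Y) (w : Fin B.size) (s : S)
    (l : List (S × Y)) : B.encoder.enc w s l = B.runInput w s l := by
  simp only [CausalEncoder.enc, encoder, Fin.cons_zero, Fin.cons_succ, Prod.mk.eta, List.ofFn_get]

section Run

variable {S X Y : Type*} {B : BlockCode S X Y} {K : MarkovChannel S X Y}
  {Ω : Type*} [m : MeasurableSpace Ω] {Pr : Measure Ω} (τ : Transmission K B.encoder Pr)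

/-- The first block that is not rejected is block number `j`, and its decision is `w`. -/
def First (j : ℕ) (w : Fin B.size) : Set Ω :=
  {ω | B.Rejected j (τ.state 0 ω) (τ.hist (j * B.len + B.n) ω) ∧
    B.decision j (τ.state 0 ω) (τ.hist (j * B.len + B.n) ω) = some w}

/-- All blocks before the block number `k` are rejected. -/
def RejectedEvent (k : ℕ) : Set Ω := {ω | B.Rejected k (τ.state 0 ω) (τ.hist (k * B.len) ω)}

lemma decision_hist {j t : ℕ} (ht : j * B.len + B.n ≤ t) (s : S) (ω : Ω) :
    B.decision j s (τ.hist t ω) = B.decision j s (τ.hist (j * B.len + B.n) ω) := by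
  obtain ⟨l, hl⟩ := τ.exists_hist_eq_append ht ω
  rw [hl, decision_append _ (by simp)]

lemma rejected_hist {k t : ℕ} (ht : k * B.len ≤ t) (s : S) (ω : Ω) :
    B.Rejected k s (τ.hist t ω) ↔
      ∀ j < k, B.decision j s (τ.hist (j * B.len + B.n) ω) = none := by
  refine forall₂_congr fun j hj => ?_
  rw [decision_hist τ]
  have : (j + 1) * B.len ≤ k * B.len := Nat.mul_le_mul_right _ hj
  simp only [len] at *
  linarith

lemma mem_first_iff {j : ℕ} {w : Fin B.size} {ω : Ω} : ω ∈ First τ j w ↔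
    (∀ i < j, B.decision i (τ.state 0 ω) (τ.hist (i * B.len + B.n) ω) = none) ∧
      B.decision j (τ.state 0 ω) (τ.hist (j * B.len + B.n) ω) = some w := by
  rw [First, Set.mem_ofPred_eq, rejected_hist τ (Nat.le_add_right _ _)]

lemma mem_rejectedEvent_iff {k : ℕ} {ω : Ω} : ω ∈ RejectedEvent τ k ↔
    ∀ i < k, B.decision i (τ.state 0 ω) (τ.hist (i * B.len + B.n) ω) = none :=
  rejected_hist τ le_rfl _ _

lemma first_unique {j j' : ℕ} {w w' : Fin B.size} {ω : Ω} (h : ω ∈ First τ j w)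
    (h' : ω ∈ First τ j' w') : j = j' ∧ w = w' := by
  rw [mem_first_iff] at h h'
  have hj : j = j' := by
    by_contra hne
    rcases lt_or_gt_of_ne hne with hlt | hlt
    · have := h'.1 j hlt
      rw [h.2] at this
      cases this
    · have := h.1 j' hlt
      rw [h'.2] at this
      cases this
  subst hj
  exact ⟨rfl, Option.some_inj.1 (h.2.symm.trans h'.2)⟩

lemma exists_first_or_forall_rejected (ω : Ω) :
    (∃ j w, ω ∈ First τ j w) ∨ ∀ k, ω ∈ RejectedEvent τ k := by
  classical
  by_cases h : ∃ j, B.decision j (τ.state 0 ω) (τ.hist (j * B.len + B.n) ω) ≠ none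
  · obtain ⟨w, hw⟩ := Option.ne_none_iff_exists'.1 (Nat.find_spec h)
    exact Or.inl ⟨Nat.find h, w, (mem_first_iff τ).2
      ⟨fun i hi => not_not.1 (Nat.find_min h hi), hw⟩⟩
  · push Not at h
    exact Or.inr fun k => (mem_rejectedEvent_iff τ).2 fun i _ => h i

lemma exists_stop_decision (w₀ : Fin B.size) : ∃ (T : Ω → ℕ∞) (Ψ : Ω → Fin B.size),
    (∀ ω j w, ω ∈ First τ j w → T ω = ((j + 1) * B.len : ℕ) ∧ Ψ ω = w) ∧
      ∀ ω, (¬ ∃ j w, ω ∈ First τ j w) → T ω = ⊤ ∧ Ψ ω = w₀ := by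
  classical
  have : ∀ ω, ∃ p : ℕ∞ × Fin B.size, (∀ j w, ω ∈ First τ j w → p.1 = ((j + 1) * B.len : ℕ) ∧ p.2 = w)
      ∧ ((¬ ∃ j w, ω ∈ First τ j w) → p.1 = ⊤ ∧ p.2 = w₀) := by
    intro ω
    by_cases h : ∃ j w, ω ∈ First τ j w
    · obtain ⟨j, w, hj⟩ := h
      refine ⟨(((j + 1) * B.len : ℕ), w), fun j' w' h' => ?_, fun h => absurd ⟨j, w, hj⟩ h⟩
      obtain ⟨rfl, rfl⟩ := first_unique τ hj h'
      exact ⟨rfl, rfl⟩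
    · exact ⟨(⊤, w₀), fun j w hj => absurd ⟨j, w, hj⟩ h, fun _ => ⟨rfl, rfl⟩⟩
  choose p hp using this
  exact ⟨fun ω => (p ω).1, fun ω => (p ω).2, fun ω => (hp ω).1, fun ω => (hp ω).2⟩

lemma measurableSet_first [Finite S] [Finite Y] {j t : ℕ} (h : (j + 1) * B.len ≤ t)
    (w : Fin B.size) : MeasurableSet[τ.receiverFiltration t] (First τ j w) :=
  τ.measurableSet_receiver (by simp only [len] at *; linarith)
    fun s l => B.Rejected j s l ∧ B.decision j s l = some w

lemma measurableSet_rejectedEvent [Finite S] [Finite Y] (k : ℕ) :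
    MeasurableSet (RejectedEvent τ k) :=
  τ.receiverFiltration.le _ _ (τ.measurableSet_receiver (Nat.lt_succ_self _) fun s l =>
    B.Rejected k s l)

variable [Fintype S] [Fintype Y] {r b : ℝ}

lemma measure_rejectedEvent_le (hB : B.IsReliable K r b) (hr : 0 ≤ r) (k : ℕ) :
    Pr (RejectedEvent τ k) ≤ ENNReal.ofReal (r ^ k) := by
  have := τ.isProb
  rw [← ofReal_measureReal]
  refine ENNReal.ofReal_le_ofReal (τ.real_le_of_expect_le _ (fun _ s l => B.Rejected k s l)
    fun w s => ?_)
  rw [show B.encoder.enc w s = B.runInput w s from funext fun l => B.encoder_enc w s l]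
  exact hB.expect_rejected_le hr w s k

lemma measure_firstWrong_le (hB : B.IsReliable K r b) (hr : 0 ≤ r) (hb : 0 ≤ b) (k : ℕ) :
    Pr {ω | B.FirstWrong (τ.msg ω) k (τ.state 0 ω) (τ.hist ((k + 1) * B.len) ω)}
      ≤ ENNReal.ofReal (b * r ^ k) := by
  have := τ.isProb
  rw [← ofReal_measureReal]
  refine ENNReal.ofReal_le_ofReal (τ.real_le_of_expect_le _ (fun w s l => B.FirstWrong w k s l)
    fun w s => ?_)
  rw [show B.encoder.enc w s = B.runInput w s from funext fun l => B.encoder_enc w s l]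
  exact hB.expect_firstWrong_le hr hb w s k

end Run

lemma tsum_ofReal_mul_pow {r b : ℝ} (hr : 0 ≤ r) (hr1 : r < 1) (hb : 0 ≤ b) :
    ∑' k : ℕ, ENNReal.ofReal (b * r ^ k) = ENNReal.ofReal (b / (1 - r)) := by
  rw [← ENNReal.ofReal_tsum_of_nonneg (fun k => by positivity)
    ((summable_geometric_of_lt_one hr hr1).mul_left b), tsum_mul_left,
    tsum_geometric_of_lt_one hr hr1, div_eq_mul_inv]

/-- The block code is repeated until a block is not rejected. -/
theorem IsReliable.exists_codingScheme {S : Type u} {X : Type v} {Y : Type w} [Fintype S]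
    [Fintype Y] {B : BlockCode S X Y} {K : MarkovChannel S X Y} {r b : ℝ}
    (hB : B.IsReliable K r b) (hsize : 0 < B.size) (hr : 0 ≤ r) (hr1 : r < 1) (hb : 0 ≤ b) :
    ∃ 𝒮 : CodingScheme K, Fintype.card 𝒮.encoder.Msg = B.size ∧
      𝒮.expectedTime ≤ ENNReal.ofReal (B.len / (1 - r)) ∧
      𝒮.errorProb ≤ ENNReal.ofReal (b / (1 - r)) := by
  let w₀ : Fin B.size := ⟨0, hsize⟩
  have : Nonempty B.encoder.Msg := ⟨w₀⟩
  obtain ⟨Ω, _, Pr, ⟨τ⟩⟩ := Transmission.exists_of_encoder K B.encoder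
  have := τ.isProb
  obtain ⟨T, Ψ, hfirst, hnone⟩ := exists_stop_decision τ w₀
  -- The choice of the full set for `A` gives the stopping time, a general `A` the measurability of
  -- the decoder.
  have hset : ∀ (A : Set (Fin B.size)) (t : ℕ), MeasurableSet[τ.receiverFiltration t]
      (Ψ ⁻¹' A ∩ {ω | T ω ≤ t}) := by
    intro A t
    have : Ψ ⁻¹' A ∩ {ω | T ω ≤ t} =
        ⋃ (j : ℕ) (w : Fin B.size) (_ : w ∈ A) (_ : (j + 1) * B.len ≤ t), First τ j w := by
      ext ω
      simp only [Set.mem_inter_iff, Set.mem_preimage, Set.mem_ofPred_eq, Set.mem_iUnion]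
      constructor
      · rintro ⟨h1, h2⟩
        by_cases h : ∃ j w, ω ∈ First τ j w
        · obtain ⟨j, w, hj⟩ := h
          rw [(hfirst ω j w hj).1, Nat.cast_le] at h2
          rw [(hfirst ω j w hj).2] at h1
          exact ⟨j, w, h1, h2, hj⟩
        · rw [(hnone ω h).1] at h2
          simp at h2
      · rintro ⟨j, w, h1, h2, hj⟩
        rw [(hfirst ω j w hj).1, (hfirst ω j w hj).2, Nat.cast_le]
        exact ⟨h1, h2⟩
    rw [this]
    exact MeasurableSet.iUnion fun j => MeasurableSet.iUnion fun w => MeasurableSet.iUnion fun _ =>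
      MeasurableSet.iUnion fun h => measurableSet_first τ h w
  have hT : IsStoppingTime τ.receiverFiltration T := by
    intro t
    have := hset Set.univ t
    rwa [Set.preimage_univ, Set.univ_inter] at this
  have hΨ : Measurable[hT.measurableSpace, ⊤] Ψ := by
    refine fun A _ => ⟨?_, hset A⟩
    -- Where no block is ever accepted the decoder takes the default value `w₀`; this event belongs
    -- to the limit σ-algebra as a complement of a countable union.
    have htop : {ω | w₀ ∈ A ∧ T ω = ⊤} = (⋃ t : ℕ, Ψ ⁻¹' Set.univ ∩ {ω | T ω ≤ t})ᶜ ∩ {_ω | w₀ ∈ A} := by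
      ext ω
      simp only [Set.preimage_univ, Set.univ_inter, Set.mem_inter_iff, Set.mem_compl_iff,
        Set.mem_iUnion, Set.mem_ofPred_eq, not_exists, not_le, ENat.eq_top_iff_forall_gt]
      exact and_comm
    have : Ψ ⁻¹' A = (⋃ t : ℕ, Ψ ⁻¹' A ∩ {ω | T ω ≤ t}) ∪ {ω | w₀ ∈ A ∧ T ω = ⊤} := by
      ext ω
      simp only [Set.mem_union, Set.mem_iUnion, Set.mem_inter_iff, Set.mem_preimage,
        Set.mem_ofPred_eq]
      by_cases h : ∃ j w, ω ∈ First τ j w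
      · obtain ⟨j, w, hj⟩ := h
        obtain ⟨h1, h2⟩ := hfirst ω j w hj
        rw [h1, h2]
        exact ⟨fun h => Or.inl ⟨_, h, le_rfl⟩, fun h => h.elim (fun ⟨_, h, _⟩ => h)
          fun h => absurd h.2 (ENat.natCast_ne_top _)⟩
      · obtain ⟨h1, h2⟩ := hnone ω h
        rw [h1, h2]
        simp
    have hle : ∀ t, τ.receiverFiltration t ≤ ⨆ t, τ.receiverFiltration t := le_iSup _
    rw [this, htop]
    exact .union (.iUnion fun t => hle t _ (hset A t))
      (.inter (MeasurableSet.compl (.iUnion fun t => hle t _ (hset _ t))) (.const _))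
  refine ⟨⟨B.encoder, Ω, Pr, τ, T, hT, Ψ, hΨ⟩, Fintype.card_fin _, ?_, ?_⟩
  -- Block `k` is run exactly when all earlier blocks are rejected, so `T` is at most the sum of the
  -- block lengths over these events.
  · calc ∫⁻ ω, (T ω : ℝ≥0∞) ∂Pr
        ≤ ∫⁻ ω, ∑' k, (RejectedEvent τ k).indicator (fun _ => (B.len : ℝ≥0∞)) ω ∂Pr := by
          refine lintegral_mono fun ω => ?_
          by_cases h : ∃ j w, ω ∈ First τ j w
          · obtain ⟨j, w, hj⟩ := h
            refine le_trans ?_ (ENNReal.sum_le_tsum (Finset.range (j + 1)))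
            rw [Finset.sum_congr rfl (g := fun _ => (B.len : ℝ≥0∞)), (hfirst ω j w hj).1]
            · rw [Finset.sum_const, Finset.card_range, nsmul_eq_mul, ← Nat.cast_mul]
              exact (ENat.toENNReal_coe _).le
            · intro k hk
              refine Set.indicator_of_mem ?_ _
              rw [mem_rejectedEvent_iff]
              rw [mem_first_iff] at hj
              exact fun i hi => hj.1 i (by rw [Finset.mem_range] at hk; omega)
          · have h' := (exists_first_or_forall_rejected τ ω).resolve_left h
            rw [tsum_congr fun k => Set.indicator_of_mem (h' k) _,
              ENNReal.tsum_const_eq_top_of_ne_zero (by simp)]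
            exact le_top
      _ = ∑' k, B.len * Pr (RejectedEvent τ k) := by
          rw [lintegral_tsum fun k =>
            (measurable_const.indicator (measurableSet_rejectedEvent τ k)).aemeasurable]
          exact tsum_congr fun k => lintegral_indicator_const (measurableSet_rejectedEvent τ k) _
      _ ≤ ∑' k, ENNReal.ofReal (B.len * r ^ k) := by
          refine ENNReal.tsum_le_tsum fun k => ?_
          rw [ENNReal.ofReal_mul (Nat.cast_nonneg _), ENNReal.ofReal_natCast]
          gcongr
          exact measure_rejectedEvent_le τ hB hr k
      _ = _ := tsum_ofReal_mul_pow hr hr1 (Nat.cast_nonneg _)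
  -- An error is an accepted wrong block or an endless rejection, and the latter has probability
  -- zero.
  · have h0 : Pr (⋂ k, RejectedEvent τ k) = 0 := by
      have hlim : Tendsto (fun k : ℕ => ENNReal.ofReal (r ^ k)) atTop (𝓝 0) := by
        have := ENNReal.tendsto_ofReal (tendsto_pow_atTop_nhds_zero_of_lt_one hr hr1)
        rwa [ENNReal.ofReal_zero] at this
      exact le_antisymm (ge_of_tendsto' hlim fun k =>
        (measure_mono (Set.iInter_subset _ k)).trans (measure_rejectedEvent_le τ hB hr k)) bot_le
    calc Pr {ω | Ψ ω ≠ τ.msg ω}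
        ≤ Pr ((⋃ k, {ω | B.FirstWrong (τ.msg ω) k (τ.state 0 ω) (τ.hist ((k + 1) * B.len) ω)}) ∪
            ⋂ k, RejectedEvent τ k) := by
          refine measure_mono fun ω hω => ?_
          rcases exists_first_or_forall_rejected τ ω with ⟨j, w, hj⟩ | h
          · refine Or.inl (Set.mem_iUnion.2 ⟨j, ?_⟩)
            have hle : j * B.len + B.n ≤ (j + 1) * B.len := by simp only [len]; linarith
            have hw : w ≠ τ.msg ω := (hfirst ω j w hj).2 ▸ hω
            rw [mem_first_iff] at hj
            refine ⟨(rejected_hist τ ((Nat.le_add_right _ _).trans hle) _ _).2 hj.1, ?_⟩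
            rw [decision_hist τ hle, hj.2]
            exact ⟨by simp, fun h => hw (Option.some_inj.1 h)⟩
          · exact Or.inr (Set.mem_iInter.2 h)
      _ ≤ (∑' k, ENNReal.ofReal (b * r ^ k)) + 0 := by
          refine (measure_union_le _ _).trans (add_le_add ((measure_iUnion_le _).trans ?_) h0.le)
          exact ENNReal.tsum_le_tsum fun k => measure_firstWrong_le τ hB hr hb k
      _ = _ := by rw [add_zero, tsum_ofReal_mul_pow hr hr1 hb]

end BlockCode

/-! ### Choice of the phase lengths, and the theorem. -/

namespace MarkovChannel

lemma confirmable_one {S X Y : Type*} [Fintype S] [Fintype X] [Fintype Y] [Nonempty X]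
    (K : MarkovChannel S X Y) : K.Confirmable fun _ => 1 := by
  classical
  let x : X := Classical.arbitrary X
  refine ⟨fun _ => x, fun _ => x, fun η hη => ⟨0, fun n _ => ⟨fun _ _ => True, fun s => ⟨?_, ?_⟩⟩⟩⟩
  · simp only [if_true]
    rw [expect_const]; exact hη.le
  · simp only [if_true]
    rw [expect_const]

/-- Lengths of the two phases of a block. -/
lemma exists_phase_lengths {R C κ : ℝ} (hR : 0 < R) (hRC : R < C) (hκ : 0 < κ) (hκ1 : κ ≤ 1 / 4)
    (N : ℕ) : ∃ n₁ ≥ N, ∃ n₂ ≥ N,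
      (1 - 4 * κ) * R * (((n₁ + n₂ + 1 : ℕ) : ℝ) / (1 - (κ + κ))) ≤ (1 - κ) * C * n₁ ∧
      (1 - 4 * κ) * (1 - R / C) * (((n₁ + n₂ + 1 : ℕ) : ℝ) / (1 - (κ + κ))) ≤ n₂ := by
  have hC : 0 < C := hR.trans hRC
  -- The ratio of the confirmation to the communication length, (1 - R/C) : R/C.
  set ρ := C / R - 1 with hρ
  have hρ0 : 0 < ρ := by rw [hρ, sub_pos, one_lt_div hR]; exact hRC
  -- The first bound makes rounding and the extra channel use, together at most 2, negligible
  -- against κ n₁; the second makes the confirmation phase at least `N` long.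
  obtain ⟨m, hm⟩ := exists_nat_ge (max (2 / κ) (N / ρ))
  have hm1 : 2 ≤ κ * m := by
    have := (le_max_left _ _).trans hm
    rwa [div_le_iff₀ hκ, mul_comm] at this
  have hm2 : (N : ℝ) ≤ ρ * m := by
    have := (le_max_right _ _).trans hm
    rwa [div_le_iff₀ hρ0, mul_comm] at this
  set n₁ := max N m with hn₁
  have hmn : (m : ℝ) ≤ n₁ := by exact_mod_cast le_max_right _ _
  have h1 : 2 ≤ κ * n₁ := hm1.trans (mul_le_mul_of_nonneg_left hmn hκ.le)
  have h2 : (N : ℝ) ≤ ρ * n₁ := hm2.trans (mul_le_mul_of_nonneg_left hmn hρ0.le)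
  set n₂ := ⌈ρ * n₁⌉₊ with hn₂
  have h3 : ρ * n₁ ≤ n₂ := Nat.le_ceil _
  have h4 : (n₂ : ℝ) ≤ ρ * n₁ + 1 := (Nat.ceil_lt_add_one (by positivity)).le
  have hlen : ((n₁ + n₂ + 1 : ℕ) : ℝ) ≤ C / R * n₁ + 2 := by
    push_cast
    have : C / R * n₁ = ρ * n₁ + n₁ := by rw [hρ]; ring
    linarith
  have hκ2 : 0 < 1 - (κ + κ) := by linarith
  have hκ4 : 0 ≤ 1 - 4 * κ := by linarith
  have hn₁0 : (0 : ℝ) ≤ n₁ := Nat.cast_nonneg _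
  refine ⟨n₁, le_max_left _ _, n₂, by exact_mod_cast h2.trans h3, ?_, ?_⟩
  · rw [mul_div_assoc', div_le_iff₀ hκ2]
    calc (1 - 4 * κ) * R * ((n₁ + n₂ + 1 : ℕ) : ℝ) ≤ (1 - 4 * κ) * R * (C / R * n₁ + 2) :=
          mul_le_mul_of_nonneg_left hlen (by positivity)
      _ = (1 - 4 * κ) * (C * n₁ + 2 * R) := by field_simp
      _ ≤ (1 - 4 * κ) * (C * n₁) + 2 * C := by nlinarith
      _ ≤ (1 - 4 * κ) * (C * n₁) + κ * n₁ * C := by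
          gcongr
      _ ≤ (1 - κ) * C * n₁ * (1 - (κ + κ)) := by
          have : 0 ≤ κ ^ 2 * (C * n₁) := by positivity
          nlinarith
  · rw [mul_div_assoc', div_le_iff₀ hκ2]
    have hRC' : 1 - R / C = ρ * (R / C) := by rw [hρ]; field_simp
    have hRC1 : R / C ≤ 1 := (div_le_one hC).2 hRC.le
    have hRC0 : 0 ≤ R / C := by positivity
    calc (1 - 4 * κ) * (1 - R / C) * ((n₁ + n₂ + 1 : ℕ) : ℝ)
        ≤ (1 - 4 * κ) * (ρ * (R / C)) * (C / R * n₁ + 2) := by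
          rw [hRC']
          exact mul_le_mul_of_nonneg_left hlen (by positivity)
      _ = ρ * ((1 - 4 * κ) * (n₁ + 2 * (R / C))) := by field_simp
      _ ≤ ρ * (n₁ * (1 - (κ + κ))) := by
          refine mul_le_mul_of_nonneg_left ?_ hρ0.le
          nlinarith
      _ = ρ * n₁ * (1 - (κ + κ)) := by ring
      _ ≤ n₂ * (1 - (κ + κ)) := mul_le_mul_of_nonneg_right h3 hκ2.le

variable {S : Type u} {X : Type v} {Y : Type w} [Fintype S] [Fintype X] [Fintype Y]
  {K : MarkovChannel S X Y}

/-- Schemes whose error probability is controlled by a test between two policies. -/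
lemma Ergodic.exists_codingScheme (hE : K.Ergodic) {β : ℕ → ℝ} (hβ : K.Confirmable β)
    (hβ0 : ∀ n, 0 ≤ β n) {R : ℝ} (hR : 0 < R) (hRC : R < K.capacity) {κ : ℝ} (hκ : 0 < κ)
    (hκ1 : κ < 1 / 4) : ∃ (𝒮 : CodingScheme K) (n : ℕ),
      𝒮.errorProb ≤ ENNReal.ofReal (β n * (2 * κ)) ∧
      ENNReal.ofReal ((1 - 4 * κ) * R) ≤ 𝒮.rate ∧ 𝒮.expectedTime ≠ ∞ ∧
      ENNReal.ofReal ((1 - 4 * κ) * (1 - R / K.capacity)) * 𝒮.expectedTime ≤ n := by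
  have hC : 0 < K.capacity := hR.trans hRC
  have := K.nonempty_input_of_capacity_ne_zero hC.ne'
  have hκ2 : 0 < 1 - (κ + κ) := by linarith
  have hκ4 : 0 < 1 - 4 * κ := by linarith
  have hRC1 : 0 ≤ 1 - R / K.capacity := by rw [sub_nonneg, div_le_one hC]; exact hRC.le
  obtain ⟨N, hN⟩ := hE.exists_blockCode hβ hβ0 (c := (1 - κ) * K.capacity)
    (mul_nonneg (by linarith) hC.le) (by nlinarith) hκ
  obtain ⟨n₁, hn₁, n₂, hn₂, h1, h2⟩ := exists_phase_lengths hR hRC hκ hκ1.le N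
  obtain ⟨B, hBn, hsize, hB⟩ := hN n₁ hn₁ n₂ hn₂
  have hsize0 : (0 : ℝ) < B.size := (Real.exp_pos _).trans_le hsize
  obtain ⟨𝒮, hcard, htime, herr⟩ := hB.exists_codingScheme (by exact_mod_cast hsize0)
    (by linarith) (by linarith) (mul_nonneg (hβ0 n₂) hκ.le)
  rw [BlockCode.len, hBn] at htime
  have hfin : 𝒮.expectedTime ≠ ∞ := (htime.trans_lt ENNReal.ofReal_lt_top).ne
  have hlog : (1 - κ) * K.capacity * n₁ ≤ Real.log B.size := (Real.le_log_iff_exp_le hsize0).2 hsize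
  refine ⟨𝒮, n₂, herr.trans (ENNReal.ofReal_le_ofReal ?_), ?_, hfin, ?_⟩
  · rw [mul_div_assoc]
    refine mul_le_mul_of_nonneg_left ?_ (hβ0 n₂)
    rw [div_le_iff₀ hκ2]
    nlinarith
  · have hlog' := h1.trans hlog
    have hlog0 : 0 < Real.log B.size := lt_of_lt_of_le (by positivity) hlog'
    rw [CodingScheme.rate, hcard, ENNReal.le_div_iff_mul_le
      (Or.inr (ENNReal.ofReal_pos.2 hlog0).ne') (Or.inl hfin)]
    refine (mul_le_mul_right htime _).trans ?_
    rw [← ENNReal.ofReal_mul (by positivity)]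
    exact ENNReal.ofReal_le_ofReal hlog'
  · refine (mul_le_mul_right htime _).trans ?_
    rw [← ENNReal.ofReal_mul (by positivity), ← ENNReal.ofReal_natCast]
    exact ENNReal.ofReal_le_ofReal h2

/-- The confirmation test makes -log p_e at least (1 - κ) D n, and the choice of phase lengths makes
`n` at least nearly (1 - R/C) E[T]. -/
lemma Ergodic.exists_codingScheme_exponent (hE : K.Ergodic) (hK : K.CommonSupport) {R : ℝ}
    (hR : 0 < R) (hRC : R < K.capacity) {κ : ℝ} (hκ : 0 < κ) (hκ1 : κ < 1 / 4) :
    ∃ 𝒮 : CodingScheme K, 𝒮.errorProb ≤ ENNReal.ofReal (2 * κ) ∧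
      ENNReal.ofReal ((1 - 4 * κ) * R) ≤ 𝒮.rate ∧
      ENNReal.ofReal ((1 - κ) * (1 - 4 * κ)) * K.burnashevExponent R ≤ 𝒮.errorExponent := by
  have hC : 0 < K.capacity := hR.trans hRC
  have := K.nonempty_input_of_capacity_ne_zero hC.ne'
  have hκ4 : 0 < 1 - 4 * κ := by linarith
  have hκ0 : 0 < 1 - κ := by linarith
  obtain ⟨-, -, D, hD0, hD, -⟩ := hE.burnashevCoeff_eq hK
  have hβ : K.Confirmable fun n => Real.exp (-((1 - κ) * D * n)) := by
    -- For `D = 0` the required bound is 1, and the test that always accepts will do.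
    rcases hD0.eq_or_lt with h0 | h0
    · simpa [← h0] using K.confirmable_one
    · refine hE.confirmable_of_commonSupport hK ?_
      rw [hD]
      exact ENNReal.ofReal_lt_ofReal_iff'.2 ⟨by nlinarith, h0⟩
  obtain ⟨𝒮, n, herr, hrate, hfin, htime⟩ :=
    hE.exists_codingScheme hβ (fun n => (Real.exp_pos _).le) hR hRC hκ hκ1
  have hDn : 0 ≤ (1 - κ) * D * n := by positivity
  refine ⟨𝒮, herr.trans (ENNReal.ofReal_le_ofReal ?_), hrate, ?_⟩
  · exact mul_le_of_le_one_left (by linarith) (Real.exp_le_one_iff.2 (by linarith))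
  have hlog : ENNReal.ofReal ((1 - κ) * D * n - Real.log (2 * κ))
      ≤ (-ENNReal.log 𝒮.errorProb).toENNReal := by
    have h := EReal.toENNReal_le_toENNReal (EReal.neg_le_neg_iff.2 (ENNReal.log_monotone herr))
    rw [neg_log_toENNReal (by positivity), Real.log_mul (Real.exp_pos _).ne' (by positivity),
      Real.log_exp] at h
    exact (ENNReal.ofReal_le_ofReal (by linarith)).trans h
  have hlogκ : Real.log (2 * κ) < 0 := Real.log_neg (by linarith) (by linarith)
  rw [CodingScheme.errorExponent, ENNReal.le_div_iff_mul_le (Or.inr ?_) (Or.inl hfin)]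
  · refine le_trans ?_ ((ENNReal.ofReal_le_ofReal (by linarith)).trans hlog :
      ENNReal.ofReal ((1 - κ) * D * n) ≤ _)
    rw [burnashevExponent, hD, ENNReal.ofReal_mul hκ0.le, ENNReal.ofReal_mul (by positivity),
      ENNReal.ofReal_mul hκ0.le, ENNReal.ofReal_natCast]
    rw [ENNReal.ofReal_mul hκ4.le] at htime
    calc ENNReal.ofReal (1 - κ) * ENNReal.ofReal (1 - 4 * κ) *
          (ENNReal.ofReal D * ENNReal.ofReal (1 - R / K.capacity)) * 𝒮.expectedTime
        = ENNReal.ofReal (1 - κ) * ENNReal.ofReal D * (ENNReal.ofReal (1 - 4 * κ) *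
          ENNReal.ofReal (1 - R / K.capacity) * 𝒮.expectedTime) := by ring
      _ ≤ _ := mul_le_mul_right htime _
  · exact ((ENNReal.ofReal_pos.2 (by linarith)).trans_le hlog).ne'

lemma Ergodic.exists_codingScheme_errorProb_eq_zero (hE : K.Ergodic) (hK : ¬ K.CommonSupport)
    {R : ℝ} (hR : 0 < R) (hRC : R < K.capacity) {κ : ℝ} (hκ : 0 < κ) (hκ1 : κ < 1 / 4) :
    ∃ 𝒮 : CodingScheme K, 𝒮.errorProb = 0 ∧ ENNReal.ofReal ((1 - 4 * κ) * R) ≤ 𝒮.rate := by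
  obtain ⟨𝒮, n, herr, hrate, -⟩ := hE.exists_codingScheme (hE.confirmable_of_not_commonSupport hK)
    (fun _ => le_rfl) hR hRC hκ hκ1
  refine ⟨𝒮, le_antisymm (herr.trans ?_) bot_le, hrate⟩
  simp

lemma exists_tendsto_zero_lt_quarter : ∃ κ : ℕ → ℝ, (∀ n, 0 < κ n ∧ κ n < 1 / 4) ∧
    Tendsto κ atTop (𝓝 0) := by
  refine ⟨fun n => 1 / 5 * (1 / ((n : ℝ) + 1)), fun n => ⟨by positivity, ?_⟩, ?_⟩
  · have : 1 / ((n : ℝ) + 1) ≤ 1 := by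
      rw [div_le_one (by positivity)]
      linarith [(Nat.cast_nonneg n : (0 : ℝ) ≤ n)]
    linarith
  · have := (tendsto_one_div_add_atTop_nhds_zero_nat (𝕜 := ℝ)).const_mul (1 / 5)
    rwa [mul_zero] at this

lemma le_liminf_rate {𝒮 : ℕ → CodingScheme K} {κ : ℕ → ℝ} (hκ : Tendsto κ atTop (𝓝 0)) {R : ℝ}
    (h : ∀ n, ENNReal.ofReal ((1 - 4 * κ n) * R) ≤ (𝒮 n).rate) :
    ENNReal.ofReal R ≤ liminf (fun n => (𝒮 n).rate) atTop := by
  have hlim : Tendsto (fun n => ENNReal.ofReal ((1 - 4 * κ n) * R)) atTop (𝓝 (ENNReal.ofReal R)) := by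
    refine ENNReal.tendsto_ofReal ?_
    simpa using ((hκ.const_mul 4).const_sub 1).mul_const R
  rw [← hlim.liminf_eq]
  exact liminf_le_liminf (Eventually.of_forall h)

/-- The error exponent of Burnashev is attained. -/
theorem Ergodic.exists_codingScheme_seq (hE : K.Ergodic) {R : ℝ} (hR : 0 < R)
    (hRC : R < K.capacity) : ∃ 𝒮 : ℕ → CodingScheme K,
      Tendsto (fun n => (𝒮 n).errorProb) atTop (𝓝 0) ∧
      ENNReal.ofReal R ≤ liminf (fun n => (𝒮 n).rate) atTop ∧
      (K.burnashevCoeff < ∞ →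
        Tendsto (fun n => (𝒮 n).errorExponent) atTop (𝓝 (K.burnashevExponent R))) ∧
      (K.burnashevCoeff = ∞ → ∀ n, (𝒮 n).errorProb = 0) := by
  have := K.nonempty_input_of_capacity_ne_zero (hR.trans hRC).ne'
  obtain ⟨κ, hκ, hκ0⟩ := exists_tendsto_zero_lt_quarter
  by_cases hK : K.CommonSupport
  · choose 𝒮 herr hrate hexp using fun n =>
      hE.exists_codingScheme_exponent hK hR hRC (hκ n).1 (hκ n).2
    obtain ⟨-, -, D, -, hD, -⟩ := hE.burnashevCoeff_eq hK
    have herr' : Tendsto (fun n => (𝒮 n).errorProb) atTop (𝓝 0) := by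
      refine tendsto_of_tendsto_of_tendsto_of_le_of_le tendsto_const_nhds ?_ (fun _ => bot_le) herr
      simpa using ENNReal.tendsto_ofReal (hκ0.const_mul 2)
    have hrate' := le_liminf_rate hκ0 hrate
    refine ⟨𝒮, herr', hrate', fun _ => ?_, fun h => ?_⟩
    · have hlim : Tendsto (fun n => ENNReal.ofReal ((1 - κ n) * (1 - 4 * κ n)) *
          K.burnashevExponent R) atTop (𝓝 (K.burnashevExponent R)) := by
        have h1 : Tendsto (fun n => ENNReal.ofReal ((1 - κ n) * (1 - 4 * κ n))) atTop (𝓝 1) := by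
          simpa using ENNReal.tendsto_ofReal
            ((hκ0.const_sub 1).mul ((hκ0.const_mul 4).const_sub 1))
        simpa using ENNReal.Tendsto.mul_const (b := K.burnashevExponent R) h1 (Or.inl one_ne_zero)
      -- The construction bounds the exponents from below; the converse, applied to these schemes,
      -- bounds them from above.
      refine tendsto_of_le_liminf_of_limsup_le ?_ (hE.limsup_errorExponent_le hR hRC 𝒮 herr' hrate')
      rw [← hlim.liminf_eq]
      exact liminf_le_liminf (Eventually.of_forall hexp)
    · rw [hD] at h
      exact absurd h ENNReal.ofReal_ne_top
  · choose 𝒮 herr hrate using fun n =>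
      hE.exists_codingScheme_errorProb_eq_zero hK hR hRC (hκ n).1 (hκ n).2
    refine ⟨𝒮, by simp [herr], le_liminf_rate hκ0 hrate, fun h => ?_, fun _ => herr⟩
    rw [hE.burnashevCoeff_eq_top hK] at h
    exact absurd h (lt_irrefl _)

end MarkovChannel

theorem theorem1 {S X Y : Type*} [Fintype S] [Fintype X] [Fintype Y]
    (K : MarkovChannel S X Y) (hK : K.Ergodic)
    (R : ℝ) (hR : 0 < R) (hRC : R < K.capacity) :
    (∀ 𝒮 : ℕ → CodingScheme K,
      Tendsto (fun n => (𝒮 n).errorProb) atTop (𝓝 0) →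
      ENNReal.ofReal R ≤ liminf (fun n => (𝒮 n).rate) atTop →
      limsup (fun n => (𝒮 n).errorExponent) atTop ≤ K.burnashevExponent R) ∧
    (∃ 𝒮 : ℕ → CodingScheme K,
      Tendsto (fun n => (𝒮 n).errorProb) atTop (𝓝 0) ∧
      ENNReal.ofReal R ≤ liminf (fun n => (𝒮 n).rate) atTop ∧
      (K.burnashevCoeff < ∞ →
        Tendsto (fun n => (𝒮 n).errorExponent) atTop (𝓝 (K.burnashevExponent R))) ∧
      (K.burnashevCoeff = ∞ → ∀ n, (𝒮 n).errorProb = 0)) :=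
  ⟨fun 𝒮 hpe hrate => hK.limsup_errorExponent_le hR hRC 𝒮 hpe hrate,
    hK.exists_codingScheme_seq hR hRC⟩
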